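/- Let $\Gamma$ be a finite metric graph with vertex set $V$, internal edges $e$ identified with $[0,l_e]$, $0<l_e<\infty$, and external edges identified with $[0,\infty)$; write $I_e$ for the interval of the edge $e$, $L^2(\Gamma)=\bigoplus_e L^2(I_e)$, and $W^{k,2}(\Gamma)=\bigoplus_e W^{k,2}(I_e)$. For each vertex $v$ let $n_v$ be the number of edge ends at $v$, and let $A_v,B_v\in\mathbb C^{n_v\times n_v}$ be such that $(A_v,B_v)$ has rank $n_v$ and $A_vB_v^{\dagger}$ is self-adjoint. Let $\Delta_\Gamma$ be the corresponding (self-adjoint) Laplacian on $L^2(\Gamma)$: $\Delta_\Gamma f=(f_e'')_e$ on $$D(\Delta_\Gamma)=\{f\in W^{2,2}(\Gamma): A_v f(v)+B_v f'(v)=0 \text{ for all } v\in V\},$$ where $f(v),f'(v)\in\mathbb C^{n_v}$ are the vectors of the values at $v$ and of the derivatives at $v$ in the directions from $v$ into the edges. Let $P_{D,v}$ and $P_{N,v}$ be the orthogonal projections of $\mathbb C^{n_v}$ onto $\ker B_v$ and $\ker A_v$, let $P_{R,v}=1-P_{D,v}-P_{N,v}$, and let $\Lambda_v$ be the operator on $P_{R,v}\mathbb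 C^{n_v}$ determined by $A_va+B_v\Lambda_va=0$, so that the coupling conditions read $P_{D,v}f(v)=0$, $P_{N,v}f'(v)=0$, $P_{R,v}f'(v)=\Lambda_vP_{R,v}f(v)$. Let $$D(\mathcal E)=\{f\in W^{1,2}(\Gamma): P_{D,v}f(v)=0\ \text{for all } v\},\qquad \mathcal E(f,f)=\sum_e\int_{I_e}|f_e'|^2\,dx+\sum_{v}\langle\Lambda_vP_{R,v}f(v),P_{R,v}f(v)\rangle .$$ Let $\theta\in C_c^\infty(\mathbb R)$ be real-valued with $\theta=1$ on $[0,1]$ and $\theta=0$ on $[2,\infty)$, let $\sigma\ge\frac12$, $R>0$, and $F(z)=|z|^{2\sigma}z\,\theta(|z|^2/R)$, $z\in\mathbb C$. For $T>0$, $n\in C([0,T],\mathbb R)$ and $u_0\in D(\mathcal E)$ consider the mild equation $$u(t)=S_n(t,0)u_0+\mathrm i\int_0^tS_n(t,s)F(u(s))\,ds,\quad t\in[0,T],\qquad S_n(t,s)=\mathrm e^{\mathrm i[n(t)-n(s)]\Delta_\Gamma}.\tag{1}$$ Let $\beta$ be a standard real Brownian motion, let $(m(t))_{t\ge0}$ be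 a real process with a.s. locally integrable paths, and for $\varepsilon>0$ let $\beta_\varepsilon(t)=\int_0^t\frac1\varepsilon m\big(\frac s{\varepsilon^2}\big)ds$. Assume: (H.0) $\beta_\varepsilon$ converges in law to $\beta$ as $\varepsilon\to0$, in $C([0,T'],\mathbb R)$ for every $T'>0$; (H.2) if $u\in D(\mathcal E)$, then $F(u)\in D(\mathcal E)$. Let $T>0$ and $u_0\in D(\mathcal E)$. Then: 1. $\mathrm i\Delta_\Gamma$ generates a strongly continuous group of isometries $(\mathrm e^{\mathrm it\Delta_\Gamma})_{t\in\mathbb R}$ on $L^2(\Gamma)$, and for some $M>0$ the norm $\sqrt{M\|f\|_{L^2}^2+\mathcal E(f,f)}$ on $D(\mathcal E)$ is well defined and equivalent to the norm of $W^{1,2}(\Gamma)$; $D(\mathcal E)$ is equipped with the topology of these norms. 2. For every $n\in C([0,T],\mathbb R)$, equation (1) has a unique solution $u_n\in C([0,T],L^2(\Gamma))$, it belongs to $C([0,T],D(\mathcal E))$, and the map $n\mapsto u_n$ from $C([0,T],\mathbb R)$ to $C([0,T],D(\mathcal E))$ is continuous. 3. Let $u_\varepsilon$ be the mild solution of $\mathrm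 i\frac{du}{dt}+\frac1\varepsilon m\big(\frac t{\varepsilon^2}\big)\Delta_\Gamma u+F(u)=0$, $u(0)=u_0$, that is, almost surely the solution of (1) with $n=\beta_\varepsilon$, and let $u$ be the mild solution of $du=\mathrm i\Delta_\Gamma u\,d\beta-\frac12\Delta_\Gamma^2u\,dt+\mathrm iF(u)\,dt$, $u(0)=u_0$, that is, almost surely the solution of (1) with $n=\beta$. Then $u_\varepsilon$ converges in law to $u$ in $C([0,T],D(\mathcal E))$ as $\varepsilon\to0$. -/

import Mathlib

open MeasureTheory ProbabilityTheory Filter Topology Set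
open scoped NNReal ENNReal InnerProductSpace

/-- A finite metric graph with vertex set `V`, internal edges `I` (identified with `[0, length i]`,
with `0` at `source i`) and external edges `X` (identified with `[0, ∞)`, with `0` at `base x`).
Loops and multiple edges are allowed. -/
structure MetricGraph (V I X : Type*) where
  source : I → V
  target : I → V
  base : X → V
  length : I → ℝ
  length_pos : ∀ i, 0 < length i

namespace MetricGraph

variable {V I X : Type*} (G : MetricGraph V I X)

/-- The interior of an edge, as a subset of `ℝ`. -/
def edgeInterior : I ⊕ X → Set ℝ
  | Sum.inl i => Ioo 0 (G.length i)
  | Sum.inr _ => Ioi 0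

/-- The closed interval identified with an edge. -/
def edgeClosed : I ⊕ X → Set ℝ
  | Sum.inl i => Icc 0 (G.length i)
  | Sum.inr _ => Ici 0

/-- Lebesgue measure on an edge. -/
noncomputable def edgeMeasure (e : I ⊕ X) : Measure ℝ := volume.restrict (G.edgeInterior e)

/-- The vertex at which an edge end is attached. The edge ends are `Sum.inl e`, the end of `e` with
coordinate `0`, for every edge `e`, and `Sum.inr i`, the end of `i` with coordinate `length i`,
for every internal edge `i`. -/
def endVertex : (I ⊕ X) ⊕ I → V
  | Sum.inl (Sum.inl i) => G.source i
  | Sum.inl (Sum.inr x) => G.base x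
  | Sum.inr i => G.target i

/-- The edge to which an edge end belongs. -/
def endEdge : (I ⊕ X) ⊕ I → I ⊕ X
  | Sum.inl e => e
  | Sum.inr i => Sum.inl i

/-- The coordinate of an edge end. -/
def endPoint : (I ⊕ X) ⊕ I → ℝ
  | Sum.inl _ => 0
  | Sum.inr i => G.length i

/-- The sign which turns the derivative in the edge coordinate into the derivative in the
direction pointing from the vertex into the edge. -/
def endSign : (I ⊕ X) ⊕ I → ℂ
  | Sum.inl _ => 1
  | Sum.inr _ => -1

/-- The edge ends attached to the vertex `v`; there are `n_v` of them. -/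
abbrev Star (v : V) : Type _ := {h : (I ⊕ X) ⊕ I // G.endVertex h = v}

/-- The family of the values at the edge ends attached to `v`. -/
def atVertex (v : V) (a : (I ⊕ X) ⊕ I → ℂ) : EuclideanSpace ℂ (G.Star v) :=
  WithLp.toLp 2 (fun h => a h.1)

/-- `g` is the weak derivative of `f` in the interior of the edge `e`. -/
def IsWeakDeriv (e : I ⊕ X) (f g : Lp ℂ 2 (G.edgeMeasure e)) : Prop :=
  ∀ φ : ℝ → ℝ, ContDiff ℝ (⊤ : ℕ∞) φ → HasCompactSupport φ → tsupport φ ⊆ G.edgeInterior e →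
    ∫ x, deriv φ x • f x ∂(G.edgeMeasure e) = -∫ x, φ x • g x ∂(G.edgeMeasure e)

/-- The Hilbert space `L²(Γ) = ⨁ₑ L²(Iₑ)`. -/
abbrev L2 : Type _ := PiLp 2 (fun e : I ⊕ X => Lp ℂ 2 (G.edgeMeasure e))

/-- `a` is the family of the boundary values of `f`, at all edge ends, taken along
representatives that are continuous on the closed edges. -/
def HasTraces (f : G.L2) (a : (I ⊕ X) ⊕ I → ℂ) : Prop :=
  ∃ r : I ⊕ X → ℝ → ℂ,
    (∀ e, ContinuousOn (r e) (G.edgeClosed e) ∧ f e =ᵐ[G.edgeMeasure e] r e) ∧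
    ∀ h, a h = r (endEdge h) (G.endPoint h)

open Classical in
/-- The superposition `(F ∘ u_e)_e`, as an element of `L²(Γ)`, for `u` in `L²(Γ)`. It is only used
for functions `F` with `|F z| ≤ C |z|`, for which the second alternative does not occur. -/
noncomputable def superposition (F : ℂ → ℂ) (u : G.L2) : G.L2 :=
  WithLp.toLp 2 fun e =>
    if h : MemLp (fun x => F (u e x)) 2 (G.edgeMeasure e) then h.toLp else 0

end MetricGraph

/-- A quantum graph: a finite metric graph with coupling matrices `A v`, `B v` at each vertex, such
that the concatenated matrix `(A v, B v)` has maximal rank and `A v * (B v)ᴴ` is self-adjoint; this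
says that the Laplacian with these coupling conditions is self-adjoint. -/
structure QuantumGraph (V I X : Type*) [Fintype V] [Fintype I] [Fintype X] [DecidableEq V]
    extends MetricGraph V I X where
  A : ∀ v, Matrix (toMetricGraph.Star v) (toMetricGraph.Star v) ℂ
  B : ∀ v, Matrix (toMetricGraph.Star v) (toMetricGraph.Star v) ℂ
  rank_eq : ∀ v, (Matrix.fromCols (A v) (B v)).rank = Fintype.card (toMetricGraph.Star v)
  isHermitian : ∀ v, (A v * (B v).conjTranspose).IsHermitian

namespace MetricGraph

variable {V I X : Type*} {G : MetricGraph V I X}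

lemma integrable_test_smul {e : I ⊕ X} (f : Lp ℂ 2 (G.edgeMeasure e)) {φ : ℝ → ℝ}
    (hφ : Continuous φ) (hc : HasCompactSupport φ) :
    Integrable (fun x => φ x • f x) (G.edgeMeasure e) := by
  have h1 : MemLp φ 2 (G.edgeMeasure e) :=
    (hφ.memLp_of_hasCompactSupport (p := 2) (μ := volume) hc).restrict _
  have h2 := Lp.memLp f
  exact memLp_one_iff_integrable.1 (h2.smul h1)

lemma IsWeakDeriv.add {e : I ⊕ X} {f₁ g₁ f₂ g₂ : Lp ℂ 2 (G.edgeMeasure e)}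
    (h₁ : G.IsWeakDeriv e f₁ g₁) (h₂ : G.IsWeakDeriv e f₂ g₂) :
    G.IsWeakDeriv e (f₁ + f₂) (g₁ + g₂) := by
  intro φ hφ hc hs
  have hd : Continuous (deriv φ) := hφ.continuous_deriv (by simp)
  have e1 : ∫ x, deriv φ x • (f₁ + f₂ : Lp ℂ 2 (G.edgeMeasure e)) x ∂(G.edgeMeasure e)
      = ∫ x, (deriv φ x • f₁ x + deriv φ x • f₂ x) ∂(G.edgeMeasure e) := by
    refine integral_congr_ae ?_
    filter_upwards [Lp.coeFn_add f₁ f₂] with x hx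
    rw [hx, Pi.add_apply, smul_add]
  have e2 : ∫ x, φ x • (g₁ + g₂ : Lp ℂ 2 (G.edgeMeasure e)) x ∂(G.edgeMeasure e)
      = ∫ x, (φ x • g₁ x + φ x • g₂ x) ∂(G.edgeMeasure e) := by
    refine integral_congr_ae ?_
    filter_upwards [Lp.coeFn_add g₁ g₂] with x hx
    rw [hx, Pi.add_apply, smul_add]
  rw [e1, e2, integral_add (integrable_test_smul f₁ hd hc.deriv)
    (integrable_test_smul f₂ hd hc.deriv), integral_add (integrable_test_smul g₁ hφ.continuous hc)
    (integrable_test_smul g₂ hφ.continuous hc), h₁ φ hφ hc hs, h₂ φ hφ hc hs, neg_add]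

lemma IsWeakDeriv.smul {e : I ⊕ X} {f g : Lp ℂ 2 (G.edgeMeasure e)} (c : ℂ)
    (h : G.IsWeakDeriv e f g) : G.IsWeakDeriv e (c • f) (c • g) := by
  intro φ hφ hc hs
  have e1 : ∫ x, deriv φ x • (c • f : Lp ℂ 2 (G.edgeMeasure e)) x ∂(G.edgeMeasure e)
      = ∫ x, c • (deriv φ x • f x) ∂(G.edgeMeasure e) := by
    refine integral_congr_ae ?_
    filter_upwards [Lp.coeFn_smul c f] with x hx
    rw [hx, Pi.smul_apply, smul_comm]
  have e2 : ∫ x, φ x • (c • g : Lp ℂ 2 (G.edgeMeasure e)) x ∂(G.edgeMeasure e)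
      = ∫ x, c • (φ x • g x) ∂(G.edgeMeasure e) := by
    refine integral_congr_ae ?_
    filter_upwards [Lp.coeFn_smul c g] with x hx
    rw [hx, Pi.smul_apply, smul_comm]
  rw [e1, e2, integral_smul, integral_smul, h φ hφ hc hs, smul_neg]

lemma HasTraces.add {f₁ f₂ : G.L2} {a₁ a₂ : (I ⊕ X) ⊕ I → ℂ} (h₁ : G.HasTraces f₁ a₁)
    (h₂ : G.HasTraces f₂ a₂) : G.HasTraces (f₁ + f₂) (a₁ + a₂) := by
  obtain ⟨r₁, hr₁, ha₁⟩ := h₁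
  obtain ⟨r₂, hr₂, ha₂⟩ := h₂
  refine ⟨r₁ + r₂, fun e => ⟨(hr₁ e).1.add (hr₂ e).1, ?_⟩, fun h => ?_⟩
  · filter_upwards [Lp.coeFn_add (f₁ e) (f₂ e), (hr₁ e).2, (hr₂ e).2] with x hx h1 h2
    rw [PiLp.add_apply, hx]
    simp [h1, h2]
  · simp [ha₁, ha₂]

lemma HasTraces.smul {f : G.L2} {a : (I ⊕ X) ⊕ I → ℂ} (c : ℂ) (h : G.HasTraces f a) :
    G.HasTraces (c • f) (c • a) := by
  obtain ⟨r, hr, ha⟩ := h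
  refine ⟨c • r, fun e => ⟨(hr e).1.const_smul c, ?_⟩, fun h => ?_⟩
  · filter_upwards [Lp.coeFn_smul c (f e), (hr e).2] with x hx h1
    rw [PiLp.smul_apply, hx]
    simp [h1]
  · simp [ha]

lemma isWeakDeriv_zero (e : I ⊕ X) : G.IsWeakDeriv e 0 0 := by
  intro φ hφ hc hs
  have h0 := Lp.coeFn_zero ℂ 2 (G.edgeMeasure e)
  rw [integral_eq_zero_of_ae, integral_eq_zero_of_ae, neg_zero]
  · filter_upwards [h0] with x hx
    rw [hx, Pi.zero_apply, smul_zero]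
  · filter_upwards [h0] with x hx
    rw [hx, Pi.zero_apply, smul_zero]

lemma hasTraces_zero : G.HasTraces 0 0 := by
  refine ⟨0, fun e => ⟨continuousOn_const, ?_⟩, fun h => rfl⟩
  filter_upwards [Lp.coeFn_zero ℂ 2 (G.edgeMeasure e)] with x hx
  rw [PiLp.zero_apply, hx]
  rfl

end MetricGraph

namespace QuantumGraph

variable {V I X : Type*} [Fintype V] [Fintype I] [Fintype X] [DecidableEq V] [DecidableEq I]
  [DecidableEq X] (G : QuantumGraph V I X)

/-- `f ∈ D(Δ_Γ)` and `Δ_Γ f = k`: the function `f` is in `H²(Γ)`, with first and second weak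
derivatives `g` and `k`, and its boundary values `a` and its derivatives `b` at the edge ends,
in the directions from the vertices into the edges, satisfy `A_v a_v + B_v b_v = 0` at all `v`. -/
def IsLaplacian (f k : G.L2) : Prop :=
  ∃ g : G.L2, (∀ e, G.IsWeakDeriv e (f e) (g e)) ∧ (∀ e, G.IsWeakDeriv e (g e) (k e)) ∧
    ∃ a b : (I ⊕ X) ⊕ I → ℂ, G.HasTraces f a ∧ G.HasTraces g b ∧
      ∀ v, Matrix.toEuclideanLin (G.A v) (G.atVertex v a) +
        Matrix.toEuclideanLin (G.B v)
          (G.atVertex v (fun h => MetricGraph.endSign h * b h)) = 0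

/-- `U` is the strongly continuous group of isometries on `L²(Γ)` with generator `i Δ_Γ`. -/
structure IsSchrodingerGroup (U : ℝ → G.L2 →L[ℂ] G.L2) : Prop where
  zero : U 0 = 1
  add : ∀ s t, U (s + t) = U s ∘L U t
  norm_map : ∀ t f, ‖U t f‖ = ‖f‖
  continuous : ∀ f, Continuous fun t => U t f
  generator : ∀ f h, Tendsto (fun t : ℝ => (t : ℂ)⁻¹ • (U t f - f)) (𝓝[≠] 0) (𝓝 h) ↔
    ∃ k, G.IsLaplacian f k ∧ h = Complex.I • k

/-- The group `t ↦ exp (i t Δ_Γ)`. -/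
noncomputable def schrodingerGroup : ℝ → G.L2 →L[ℂ] G.L2 :=
  Classical.epsilon G.IsSchrodingerGroup

/-- The Dirichlet projector at `v`: the orthogonal projection onto `ker B_v`. -/
noncomputable def projD (v : V) : EuclideanSpace ℂ (G.Star v) →L[ℂ] EuclideanSpace ℂ (G.Star v) :=
  (LinearMap.ker (Matrix.toEuclideanLin (G.B v))).starProjection

/-- The Neumann projector at `v`: the orthogonal projection onto `ker A_v`. -/
noncomputable def projN (v : V) : EuclideanSpace ℂ (G.Star v) →L[ℂ] EuclideanSpace ℂ (G.Star v) :=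
  (LinearMap.ker (Matrix.toEuclideanLin (G.A v))).starProjection

/-- The Robin projector at `v`. -/
noncomputable def projR (v : V) : EuclideanSpace ℂ (G.Star v) →L[ℂ] EuclideanSpace ℂ (G.Star v) :=
  1 - G.projD v - G.projN v

/-- `L` is the operator `Λ_v`, extended by zero from the range of the Robin projector: it acts in
that range, and the coupling condition `A_v a + B_v b = 0` is `b = L a` there. -/
structure IsRobinOperator (v : V)
    (L : EuclideanSpace ℂ (G.Star v) →L[ℂ] EuclideanSpace ℂ (G.Star v)) : Prop where
  comp_projR : L ∘L G.projR v = L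
  projR_comp : G.projR v ∘L L = L
  coupling : ∀ a, Matrix.toEuclideanLin (G.A v) (G.projR v a) +
    Matrix.toEuclideanLin (G.B v) (L a) = 0

/-- The value `𝓔(f, f)` of the quadratic form of `-Δ_Γ` at a function with derivative `g` and
boundary values `a`, where `L v` is the operator `Λ_v`. -/
noncomputable def energy
    (L : ∀ v, EuclideanSpace ℂ (G.Star v) →L[ℂ] EuclideanSpace ℂ (G.Star v))
    (g : G.L2) (a : (I ⊕ X) ⊕ I → ℂ) : ℝ :=
  ‖g‖ ^ 2 + ∑ v, (⟪L v (G.projR v (G.atVertex v a)), G.projR v (G.atVertex v a)⟫_ℂ).re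

/-- The form domain `D(𝓔) = {f ∈ W^{1,2}(Γ) : P_{D,v} f(v) = 0 for all v}`. The function `f` is
represented by the pair `(f, f')`, so that the norm is the one of `W^{1,2}(Γ)`. -/
def energyDomain : Submodule ℂ (WithLp 2 (G.L2 × G.L2)) where
  carrier := {p | (∀ e, G.IsWeakDeriv e (p.fst e) (p.snd e)) ∧
    ∃ a, G.HasTraces p.fst a ∧ ∀ v, G.projD v (G.atVertex v a) = 0}
  add_mem' := by
    rintro p q ⟨hp, a, ha, hpa⟩ ⟨hq, b, hb, hqb⟩
    refine ⟨fun e => (hp e).add (hq e), a + b, ha.add hb, fun v => ?_⟩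
    have : G.atVertex v (a + b) = G.atVertex v a + G.atVertex v b := rfl
    rw [this, map_add, hpa, hqb, add_zero]
  zero_mem' := ⟨fun e => MetricGraph.isWeakDeriv_zero e, 0, MetricGraph.hasTraces_zero,
    fun v => by
      have : G.atVertex v (0 : (I ⊕ X) ⊕ I → ℂ) = 0 := rfl
      rw [this, map_zero]⟩
  smul_mem' := by
    rintro c p ⟨hp, a, ha, hpa⟩
    refine ⟨fun e => (hp e).smul c, c • a, ha.smul c, fun v => ?_⟩
    have : G.atVertex v (c • a) = c • G.atVertex v a := rfl
    rw [this, map_smul, hpa, smul_zero]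

/-- The form domain as a normed space. -/
abbrev EnergyDomain : Type _ := G.energyDomain

variable {G} in
/-- The inclusion of `D(𝓔)` in `L²(Γ)`. -/
def EnergyDomain.toL2 (f : G.EnergyDomain) : G.L2 := f.1.fst

variable {G} in
/-- The derivative of an element of `D(𝓔)`. -/
def EnergyDomain.deriv (f : G.EnergyDomain) : G.L2 := f.1.snd

/-- The form domain is stable under the nonlinearity `F`. -/
def StableUnder (F : ℂ → ℂ) : Prop :=
  ∀ u : G.EnergyDomain, ∃ w : G.EnergyDomain, w.toL2 = G.superposition F u.toL2

/-- `u : [0,T] → L²(Γ)` satisfies `u(t) = S_n(t,0) u₀ + i ∫₀ᵗ S_n(t,s) F(u(s)) ds` for all `t` in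
`[0,T]`, where `S_n(t,s) = exp (i (n(t) - n(s)) Δ_Γ)`. -/
def IsMildSolution (F : ℂ → ℂ) {T : ℝ} (hT : 0 < T) (n : C(Icc 0 T, ℝ)) (u₀ : G.L2)
    (u : Icc 0 T → G.L2) : Prop :=
  ∀ t : Icc 0 T, u t = G.schrodingerGroup (n t - n ⟨0, le_rfl, hT.le⟩) u₀ +
    Complex.I • ∫ s in (0 : ℝ)..t,
      G.schrodingerGroup (n t - n (projIcc 0 T hT.le s))
        (G.superposition F (u (projIcc 0 T hT.le s)))

end QuantumGraph

/-- The truncated nonlinearity `F(z) = |z|^{2σ} z θ(|z|²/R)`. -/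
noncomputable def truncatedNonlinearity (σ R : ℝ) (θ : ℝ → ℝ) (z : ℂ) : ℂ :=
  ((‖z‖ ^ (2 * σ) : ℝ) : ℂ) * z * (θ (‖z‖ ^ 2 / R) : ℂ)

/-- Spaces of continuous functions carry the Borel `σ`-algebra of the compact-open topology, which
is the topology of uniform convergence if the source is compact. -/
instance continuousMapMeasurableSpace {K Y : Type*} [TopologicalSpace K] [TopologicalSpace Y] :
    MeasurableSpace C(K, Y) := borel _

instance continuousMapBorelSpace {K Y : Type*} [TopologicalSpace K] [TopologicalSpace Y] :
    BorelSpace C(K, Y) := ⟨rfl⟩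

/-- The restriction to `[0,T]` of a continuous path `x : [0,∞) → ℝ` (and `0` if this restriction
is not continuous). -/
noncomputable def pathOn (T : ℝ) (x : ℝ≥0 → ℝ) : C(Icc 0 T, ℝ) :=
  ContinuousMap.mkD (fun t => x ⟨t, t.2.1⟩) 0

/-- `β_ε(t) = ∫₀ᵗ ε⁻¹ m(s / ε²) ds`. -/
noncomputable def integratedDispersion {Ω : Type*} (m : ℝ → Ω → ℝ) (ε : ℝ) (ω : Ω) (t : ℝ≥0) : ℝ :=
  ∫ s in (0 : ℝ)..t, 1 / ε * m (s / ε ^ 2) ω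

/-- The filter `ε → 0` on the set of all `ε > 0`. -/
def epsToZero : Filter (Ioi (0 : ℝ)) := comap Subtype.val (𝓝 0)

/-- The invariance principle: `β_ε` converges in law to `β` as `ε → 0`, locally uniformly in time,
that is, in `C([0,T], ℝ)` for every `T > 0`. -/
def InvariancePrinciple {Ω Ω' : Type*} [MeasurableSpace Ω] [MeasurableSpace Ω'] (P : Measure Ω)
    [IsProbabilityMeasure P] (P' : Measure Ω') [IsProbabilityMeasure P'] (m : ℝ → Ω → ℝ)
    (β : ℝ≥0 → Ω' → ℝ) : Prop :=
  ∀ T : ℝ, 0 < T →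
    TendstoInDistribution
      (fun (ε : Ioi (0 : ℝ)) (ω : Ω) => pathOn T (integratedDispersion m ε ω)) epsToZero
      (fun ω => pathOn T (fun t => β t ω)) (fun _ => P) P'

/-! ### Coupling conditions at a vertex -/

namespace QuantumGraph

variable {V I X : Type*} [Fintype V] [Fintype I] [Fintype X] [DecidableEq V] [DecidableEq I]
  [DecidableEq X] (G : QuantumGraph V I X) (v : V)

/-! The probabilistic claim is an instance of the continuous mapping theorem. Mild solutions are
defined path by path, so `u_ε` and `u` are almost surely the images of `β_ε` and `β` under one
deterministic map, from the clock `n` to the solution `u_n`. Once this map is continuous into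
`C([0,T], D(𝓔))`, the invariance principle transfers to the solutions; no stochastic calculus is
involved.

Continuity in the clock. The path `n` is only continuous, but in the moving frame `α(t) =
exp(-iν(t)Δ) u(t)`, with `ν(t) = n(t) - n(0)`, the mild equation is the ODE `α' = i exp(-iνΔ)
F(exp(iνΔ) α)`, in which no derivative of `n` occurs. If the group is bounded and `F` is bounded and
Lipschitz, then Picard-Lindelöf gives existence and Gronwall gives uniqueness and continuous
dependence (`exists_continuous_isMild`). On `D(𝓔)` the nonlinearity is only locally Lipschitz, but
it has linear growth. This yields an a priori bound, and cutting the nonlinearity off beyond that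
bound does not affect the solution. Uniqueness is proved in `L²`, where the nonlinearity is globally
Lipschitz (`exists_continuous_isMild_iff`).

The group. A trace inequality with a small constant in front of the derivative makes `M‖f‖² +
𝓔(f,f)` coercive on `D(𝓔)`. It is represented there by an invertible bounded operator `S`, and with
the inclusion `J` of `D(𝓔)` in `L²` the operator `K = J S⁻¹ J*` is `(M - Δ)⁻¹`: bounded,
self-adjoint and injective. The function `x ↦ x exp(it(M - 1/x))` is continuous on the line, so the
continuous functional calculus of `K` supplies `exp(itΔ) K`. This has the same norms as `K` and
hence extends from the dense range of `K` to an isometry `exp(itΔ)`. The group commutes with `K`, so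
it preserves `⟨f, Kf⟩`, the form energy of `Kf`; therefore it restricts to a bounded group on `D(𝓔)`
(`exists_group_on_formDomain`).

The Laplacian. The operator of the form is `Δ_Γ` by integration by parts, with the coupling
conditions as natural boundary conditions (`form_eq_iff_isLaplacian`). The linear algebra behind
this is that the admissible boundary data form a Lagrangian subspace (`coupling_iff`).

The nonlinearity. Since `2σ ≥ 1` and `θ` has compact support, `F` is Lipschitz and `C¹` with
Lipschitz derivative. The chain rule and the bound of Sobolev functions in `L^∞` give the estimates
of the superposition operator on `D(𝓔)` (`exists_superposition`). -/

lemma inner_toEuclideanLin_conjTranspose {n : Type*} [Fintype n] [DecidableEq n]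
    (A : Matrix n n ℂ) (x y : EuclideanSpace ℂ n) :
    ⟪Matrix.toEuclideanLin A.conjTranspose x, y⟫_ℂ = ⟪x, Matrix.toEuclideanLin A y⟫_ℂ := by
  rw [Matrix.toEuclideanLin_conjTranspose_eq_adjoint, LinearMap.adjoint_inner_left]

/-- The coupling condition says that the boundary data are in the Lagrangian subspace
parametrized by `c ↦ (Bᴴ c, -Aᴴ c)`. -/
lemma coupling_iff (a b : EuclideanSpace ℂ (G.Star v)) :
    Matrix.toEuclideanLin (G.A v) a + Matrix.toEuclideanLin (G.B v) b = 0 ↔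
      ∃ c, a = Matrix.toEuclideanLin (G.B v).conjTranspose c ∧
        b = -Matrix.toEuclideanLin (G.A v).conjTranspose c := by
  set TA := Matrix.toEuclideanLin (G.A v)
  set TB := Matrix.toEuclideanLin (G.B v)
  set TA' := Matrix.toEuclideanLin (G.A v).conjTranspose
  set TB' := Matrix.toEuclideanLin (G.B v).conjTranspose
  let P : EuclideanSpace ℂ (G.Star v) × EuclideanSpace ℂ (G.Star v) →ₗ[ℂ]
    EuclideanSpace ℂ (G.Star v) := TA.coprod TB
  let Q : EuclideanSpace ℂ (G.Star v) →ₗ[ℂ]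
    EuclideanSpace ℂ (G.Star v) × EuclideanSpace ℂ (G.Star v) := TB'.prod (-TA')
  have hcomm : ∀ c, TA (TB' c) = TB (TA' c) := by
    intro c
    have h := G.isHermitian v
    rw [Matrix.IsHermitian, Matrix.conjTranspose_mul, Matrix.conjTranspose_conjTranspose] at h
    have := congrArg (fun N => Matrix.toEuclideanLin N c) h
    simp only [Matrix.toLpLin_apply, ← Matrix.mulVec_mulVec, TA, TB, TA', TB'] at this ⊢
    exact this.symm
  have hPQ : LinearMap.range Q ≤ LinearMap.ker P := by
    rintro _ ⟨c, rfl⟩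
    simp [P, Q, hcomm]
  have hsurj : Function.Surjective P := by
    have h1 := G.rank_eq v
    have h2 : LinearMap.range (Matrix.fromCols (G.A v) (G.B v)).mulVecLin = ⊤ := by
      apply Submodule.eq_top_of_finrank_eq
      rw [← Matrix.rank, h1]; simp
    intro y
    obtain ⟨x, hx⟩ := LinearMap.range_eq_top.1 h2 (WithLp.ofLp y)
    refine ⟨(WithLp.toLp 2 (x ∘ Sum.inl), WithLp.toLp 2 (x ∘ Sum.inr)), ?_⟩
    have h3 : x = Sum.elim (x ∘ Sum.inl) (x ∘ Sum.inr) := by simp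
    rw [Matrix.mulVecLin_apply, h3, Matrix.fromCols_mulVec_sumElim] at hx
    simp only [P, TA, TB, LinearMap.coprod_apply, Matrix.toLpLin_apply]
    rw [← WithLp.toLp_add, hx]
  -- Up to a swap and a sign, `Q` is the adjoint of `P`, so it is injective because `P` is
  -- surjective.
  have hinj : Function.Injective Q := by
    rw [injective_iff_map_eq_zero]
    intro c hc
    obtain ⟨hB, hA⟩ := Prod.mk.inj (show (TB' c, -TA' c) = (0, 0) from hc)
    obtain ⟨⟨x, y⟩, hxy⟩ := hsurj c
    have h1 : ⟪c, P (x, y)⟫_ℂ = 0 := by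
      simp only [P, LinearMap.coprod_apply, inner_add_right]
      rw [← inner_toEuclideanLin_conjTranspose, ← inner_toEuclideanLin_conjTranspose]
      change ⟪TA' c, x⟫_ℂ + ⟪TB' c, y⟫_ℂ = 0
      rw [hB, neg_eq_zero.1 hA, inner_zero_left, inner_zero_left, add_zero]
    rw [hxy] at h1
    exact inner_self_eq_zero.1 h1
  -- Both subspaces have dimension `n_v`: the range because `Q` is injective, the kernel because `P`
  -- maps a space of dimension `2 n_v` onto one of dimension `n_v`.
  have hker : LinearMap.range Q = LinearMap.ker P := by
    apply Submodule.eq_of_le_of_finrank_eq hPQ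
    have e1 := LinearMap.finrank_range_add_finrank_ker P
    rw [LinearMap.range_eq_top.2 hsurj] at e1
    rw [LinearMap.finrank_range_of_inj hinj]
    simp only [finrank_top, finrank_euclideanSpace, Module.finrank_prod] at e1 ⊢
    omega
  constructor
  · intro h
    have : (a, b) ∈ LinearMap.range Q := by rw [hker]; exact h
    obtain ⟨c, hc⟩ := this
    obtain ⟨h1, h2⟩ := Prod.mk.inj (show (TB' c, -TA' c) = (a, b) from hc)
    exact ⟨c, h1.symm, h2.symm⟩
  · rintro ⟨c, rfl, rfl⟩
    rw [map_neg, hcomm, add_neg_cancel]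

/-- The coupling conditions are symmetric. -/
lemma inner_eq_of_coupling {a b a' b' : EuclideanSpace ℂ (G.Star v)}
    (h : Matrix.toEuclideanLin (G.A v) a + Matrix.toEuclideanLin (G.B v) b = 0)
    (h' : Matrix.toEuclideanLin (G.A v) a' + Matrix.toEuclideanLin (G.B v) b' = 0) :
    ⟪b, a'⟫_ℂ = ⟪a, b'⟫_ℂ := by
  obtain ⟨c, rfl, rfl⟩ := (G.coupling_iff v a b).1 h
  rw [inner_neg_left, inner_toEuclideanLin_conjTranspose, inner_toEuclideanLin_conjTranspose,
    eq_neg_of_add_eq_zero_left h', inner_neg_right, neg_neg]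

/-- The pairs `(a, 0)` and `(0, b)` both satisfy the coupling condition, so the symmetry of these
conditions applies to them. This is what makes the Dirichlet and Neumann projectors orthogonal to
each other. -/
lemma inner_eq_zero_of_mem_ker {a b : EuclideanSpace ℂ (G.Star v)}
    (ha : Matrix.toEuclideanLin (G.A v) a = 0) (hb : Matrix.toEuclideanLin (G.B v) b = 0) :
    ⟪a, b⟫_ℂ = 0 := by
  have := G.inner_eq_of_coupling v (a := a) (b := 0) (a' := 0) (b' := b)
    (by simp [ha]) (by simp [hb])
  simpa using this.symm

lemma toEuclideanLin_B_projD (x : EuclideanSpace ℂ (G.Star v)) :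
    Matrix.toEuclideanLin (G.B v) (G.projD v x) = 0 :=
  LinearMap.mem_ker.1 (Submodule.starProjection_apply_mem _ x)

lemma toEuclideanLin_A_projN (x : EuclideanSpace ℂ (G.Star v)) :
    Matrix.toEuclideanLin (G.A v) (G.projN v x) = 0 :=
  LinearMap.mem_ker.1 (Submodule.starProjection_apply_mem _ x)

lemma projD_eq_self {x : EuclideanSpace ℂ (G.Star v)}
    (hx : Matrix.toEuclideanLin (G.B v) x = 0) : G.projD v x = x :=
  Submodule.starProjection_eq_self_iff.2 hx

lemma projD_eq_zero_iff {x : EuclideanSpace ℂ (G.Star v)} :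
    G.projD v x = 0 ↔ ∀ y, Matrix.toEuclideanLin (G.B v) y = 0 → ⟪y, x⟫_ℂ = 0 := by
  rw [projD, Submodule.starProjection_apply_eq_zero_iff, Submodule.mem_orthogonal]
  rfl

lemma projN_eq_zero_iff {x : EuclideanSpace ℂ (G.Star v)} :
    G.projN v x = 0 ↔ ∀ y, Matrix.toEuclideanLin (G.A v) y = 0 → ⟪y, x⟫_ℂ = 0 := by
  rw [projN, Submodule.starProjection_apply_eq_zero_iff, Submodule.mem_orthogonal]
  rfl

lemma inner_projD_left (x y : EuclideanSpace ℂ (G.Star v)) :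
    ⟪G.projD v x, y⟫_ℂ = ⟪x, G.projD v y⟫_ℂ :=
  Submodule.inner_starProjection_left_eq_right _ x y

lemma inner_projN_left (x y : EuclideanSpace ℂ (G.Star v)) :
    ⟪G.projN v x, y⟫_ℂ = ⟪x, G.projN v y⟫_ℂ :=
  Submodule.inner_starProjection_left_eq_right _ x y

lemma inner_projR_left (x y : EuclideanSpace ℂ (G.Star v)) :
    ⟪G.projR v x, y⟫_ℂ = ⟪x, G.projR v y⟫_ℂ := by
  simp only [projR, sub_apply, one_apply_eq_self, inner_sub_left, inner_sub_right,
    inner_projD_left, inner_projN_left]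

lemma projD_projN (x : EuclideanSpace ℂ (G.Star v)) : G.projD v (G.projN v x) = 0 :=
  (G.projD_eq_zero_iff v).2 fun y hy => by
    rw [← inner_conj_symm, G.inner_eq_zero_of_mem_ker v (G.toEuclideanLin_A_projN v x) hy, map_zero]

lemma projN_projD (x : EuclideanSpace ℂ (G.Star v)) : G.projN v (G.projD v x) = 0 :=
  (G.projN_eq_zero_iff v).2 fun _ hy =>
    G.inner_eq_zero_of_mem_ker v hy (G.toEuclideanLin_B_projD v x)

lemma projD_projD (x : EuclideanSpace ℂ (G.Star v)) : G.projD v (G.projD v x) = G.projD v x :=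
  G.projD_eq_self v (G.toEuclideanLin_B_projD v x)

lemma projN_projN (x : EuclideanSpace ℂ (G.Star v)) : G.projN v (G.projN v x) = G.projN v x :=
  Submodule.starProjection_eq_self_iff.2 (G.toEuclideanLin_A_projN v x)

lemma projD_projR (x : EuclideanSpace ℂ (G.Star v)) : G.projD v (G.projR v x) = 0 := by
  simp [projR, projD_projD, projD_projN]

lemma projN_projR (x : EuclideanSpace ℂ (G.Star v)) : G.projN v (G.projR v x) = 0 := by
  simp [projR, projN_projD, projN_projN]

lemma projR_eq_self {x : EuclideanSpace ℂ (G.Star v)} (hD : G.projD v x = 0)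
    (hN : G.projN v x = 0) : G.projR v x = x := by
  simp [projR, hD, hN]

lemma projR_projR (x : EuclideanSpace ℂ (G.Star v)) : G.projR v (G.projR v x) = G.projR v x :=
  G.projR_eq_self v (G.projD_projR v x) (G.projN_projR v x)

lemma projD_eq_zero_of_coupling {a b : EuclideanSpace ℂ (G.Star v)}
    (h : Matrix.toEuclideanLin (G.A v) a + Matrix.toEuclideanLin (G.B v) b = 0) :
    G.projD v a = 0 := by
  refine (G.projD_eq_zero_iff v).2 fun y hy => ?_
  have := G.inner_eq_of_coupling v (a := 0) (b := y) (by simp [hy]) h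
  simpa using this

lemma projN_eq_zero_of_coupling {a b : EuclideanSpace ℂ (G.Star v)}
    (h : Matrix.toEuclideanLin (G.A v) a + Matrix.toEuclideanLin (G.B v) b = 0) :
    G.projN v b = 0 := by
  refine (G.projN_eq_zero_iff v).2 fun y hy => ?_
  have := G.inner_eq_of_coupling v (a := y) (b := 0) (by simp [hy]) h
  simpa using this.symm

/-- Every vector in the range of the Robin projector occurs in the coupling condition, together
with a vector of the same kind. -/
lemma exists_projR_coupling (a : EuclideanSpace ℂ (G.Star v)) :
    ∃ b, Matrix.toEuclideanLin (G.A v) (G.projR v a) +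
      Matrix.toEuclideanLin (G.B v) (G.projR v b) = 0 := by
  -- The range of `Bᴴ` is the orthogonal complement of `ker B`, and Robin vectors have no Dirichlet
  -- part.
  have hmem : G.projR v a ∈ LinearMap.range (Matrix.toEuclideanLin (G.B v).conjTranspose) := by
    rw [Matrix.toEuclideanLin_conjTranspose_eq_adjoint,
      ← Submodule.orthogonal_orthogonal (LinearMap.range _), LinearMap.orthogonal_range,
      LinearMap.adjoint_adjoint]
    exact (Submodule.mem_orthogonal _ _).2 fun y hy =>
      (G.projD_eq_zero_iff v).1 (G.projD_projR v a) y hy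
  obtain ⟨c, hc⟩ := hmem
  set b := -Matrix.toEuclideanLin (G.A v).conjTranspose c
  have h : Matrix.toEuclideanLin (G.A v) (G.projR v a) + Matrix.toEuclideanLin (G.B v) b = 0 :=
    (G.coupling_iff v _ _).2 ⟨c, hc.symm, rfl⟩
  refine ⟨b, ?_⟩
  have hN := G.projN_eq_zero_of_coupling v h
  -- The vector `b` has no Neumann part by symmetry, and dropping its Dirichlet part does not change
  -- `B b`.
  have e1 : G.projR v b = b - G.projD v b := by simp [projR, hN]
  rw [e1, map_sub, toEuclideanLin_B_projD, sub_zero, h]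

/-- The solutions of the coupling condition, which exist vector by vector, are chosen linearly by
lifting `-A P_R` through `B P_R`, and the lift is then compressed by `P_R` on both sides. -/
lemma exists_isRobinOperator : ∃ L, G.IsRobinOperator v L := by
  set PR : EuclideanSpace ℂ (G.Star v) →ₗ[ℂ] EuclideanSpace ℂ (G.Star v) := (G.projR v).toLinearMap
  set f := Matrix.toEuclideanLin (G.B v) ∘ₗ PR with hf
  set g := -(Matrix.toEuclideanLin (G.A v) ∘ₗ PR) with hg
  have hg' : ∀ x, g x ∈ LinearMap.range f := by
    intro x
    obtain ⟨b, hb⟩ := G.exists_projR_coupling v x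
    exact ⟨b, (neg_eq_of_add_eq_zero_right hb).symm⟩
  obtain ⟨l, hl⟩ := Module.projective_lifting_property f.rangeRestrict
    (g.codRestrict (LinearMap.range f) hg') f.surjective_rangeRestrict
  have hl' : ∀ x, f (l x) = g x := fun x => congrArg Subtype.val (DFunLike.congr_fun hl x)
  refine ⟨G.projR v ∘L l.toContinuousLinearMap ∘L G.projR v, ?_, ?_, ?_⟩
  · ext1 x; simp [projR_projR]
  · ext1 x; simp [projR_projR]
  · intro a
    have h1 := hl' (G.projR v a)
    have h2 : f (l (G.projR v a)) = Matrix.toEuclideanLin (G.B v)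
      (G.projR v (l (G.projR v a))) := rfl
    have h3 : g (G.projR v a) = -Matrix.toEuclideanLin (G.A v) (G.projR v (G.projR v a)) := rfl
    rw [projR_projR] at h3
    change _ + Matrix.toEuclideanLin (G.B v) (G.projR v (l (G.projR v a))) = 0
    rw [← h2, h1, h3, add_neg_cancel]

variable {G v} {L : EuclideanSpace ℂ (G.Star v) →L[ℂ] EuclideanSpace ℂ (G.Star v)}

lemma IsRobinOperator.apply_projR (hL : G.IsRobinOperator v L) (x : EuclideanSpace ℂ (G.Star v)) :
    L (G.projR v x) = L x := DFunLike.congr_fun hL.comp_projR x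

lemma IsRobinOperator.projR_apply (hL : G.IsRobinOperator v L) (x : EuclideanSpace ℂ (G.Star v)) :
    G.projR v (L x) = L x := DFunLike.congr_fun hL.projR_comp x

lemma IsRobinOperator.isSelfAdjoint (hL : G.IsRobinOperator v L) : IsSelfAdjoint L := by
  rw [ContinuousLinearMap.isSelfAdjoint_iff_isSymmetric]
  intro x y
  change ⟪L x, y⟫_ℂ = ⟪x, L y⟫_ℂ
  rw [← hL.projR_apply x, inner_projR_left, ← hL.projR_apply y, ← G.inner_projR_left v x]
  exact G.inner_eq_of_coupling v (hL.coupling x) (hL.coupling y)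

/-- Under the Dirichlet condition, the coupling condition is the natural boundary condition of the
form of `L`. -/
lemma IsRobinOperator.coupling_iff (hL : G.IsRobinOperator v L)
    {a b : EuclideanSpace ℂ (G.Star v)} (ha : G.projD v a = 0) :
    Matrix.toEuclideanLin (G.A v) a + Matrix.toEuclideanLin (G.B v) b = 0 ↔
      ∀ c, G.projD v c = 0 → ⟪b, c⟫_ℂ = ⟪L a, c⟫_ℂ := by
  have hA : Matrix.toEuclideanLin (G.A v) (G.projR v a) = Matrix.toEuclideanLin (G.A v) a := by
    simp [projR, ha, toEuclideanLin_A_projN]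
  have h1 := hL.coupling a
  rw [hA] at h1
  constructor
  · intro h c hc
    have h2 : Matrix.toEuclideanLin (G.B v) (b - L a) = 0 := by
      rw [map_sub, sub_eq_zero]
      exact add_left_cancel (h.trans h1.symm)
    rw [← sub_eq_zero, ← inner_sub_left]
    exact (G.projD_eq_zero_iff v).1 hc _ h2
  -- The vector `d = b - L a` is orthogonal to all admissible traces. Testing with `d - P_D d`,
  -- which is admissible, shows that `d` lies in `ker B`.
  · intro h
    have h2 : G.projD v (b - L a) = b - L a := by
      have h3 : ∀ c, G.projD v c = 0 → ⟪b - L a, c⟫_ℂ = 0 := fun c hc => by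
        rw [inner_sub_left, h c hc, sub_self]
      set d := b - L a
      have h4 : G.projD v (d - G.projD v d) = 0 := by rw [map_sub, projD_projD, sub_self]
      have h5 := h3 _ h4
      have h6 : ⟪G.projD v d, d - G.projD v d⟫_ℂ = 0 := by
        rw [inner_projD_left, h4, inner_zero_right]
      have h7 : ⟪d - G.projD v d, d - G.projD v d⟫_ℂ = 0 := by
        rw [inner_sub_left, h5, h6, sub_zero]
      exact (sub_eq_zero.1 (inner_self_eq_zero.1 h7)).symm
    have h3 := G.toEuclideanLin_B_projD v (b - L a)
    rw [h2, map_sub, sub_eq_zero] at h3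
    rw [h3, h1]

end QuantumGraph

/-! ### Unitary groups from the inverse of a self-adjoint operator -/

section UnitaryGroup

/-- Strong convergence of bounded families of operators may be checked on a dense set. -/
lemma tendsto_apply_of_denseRange {α β E F : Type*} [NormedAddCommGroup E] [NormedSpace ℂ E]
    [NormedAddCommGroup F] [NormedSpace ℂ F] {l : Filter α} {A : α → E →L[ℂ] F} {B : E →L[ℂ] F}
    {C : ℝ} (hA : ∀ t x, ‖A t x‖ ≤ C * ‖x‖) {D : β → E} (hD : DenseRange D)
    (h : ∀ b, Tendsto (fun t => A t (D b)) l (𝓝 (B (D b)))) (x : E) :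
    Tendsto (fun t => A t x) l (𝓝 (B x)) := by
  rw [Metric.tendsto_nhds]
  intro ε hε
  set K := |C| + ‖B‖ + 1 with hK
  have hK0 : 0 < K := by positivity
  obtain ⟨b, hb⟩ := Metric.denseRange_iff.1 hD x (ε / (2 * K)) (by positivity)
  filter_upwards [Metric.tendsto_nhds.1 (h b) (ε / 2) (by positivity)] with t ht
  have e1 : A t x - B x = A t (x - D b) + (A t (D b) - B (D b)) + B (D b - x) := by
    simp only [map_sub]; abel
  rw [dist_eq_norm] at hb ht ⊢
  rw [e1]
  have h1 : ‖A t (x - D b)‖ ≤ |C| * ‖x - D b‖ :=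
    (hA t _).trans (mul_le_mul_of_nonneg_right (le_abs_self C) (norm_nonneg _))
  have h2 : ‖B (D b - x)‖ ≤ ‖B‖ * ‖x - D b‖ := by
    rw [norm_sub_rev x]; exact B.le_opNorm _
  have h3 : K * ‖x - D b‖ < ε / 2 := by
    rw [lt_div_iff₀ (by positivity)] at hb
    nlinarith
  calc _ ≤ ‖A t (x - D b)‖ + ‖A t (D b) - B (D b)‖ + ‖B (D b - x)‖ := norm_add₃_le
    _ < ε := by nlinarith [norm_nonneg (x - D b)]

/-- The function `x ↦ x exp (i t (M - 1 / x))` of a real variable, extended to the plane. -/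
noncomputable def phase (M t : ℝ) (z : ℂ) : ℂ :=
  (z.re : ℂ) * Complex.exp (((t * (M - z.re⁻¹) : ℝ) : ℂ) * Complex.I)

lemma norm_phase (M t : ℝ) (z : ℂ) : ‖phase M t z‖ = |z.re| := by
  rw [phase, norm_mul, Complex.norm_exp_ofReal_mul_I, mul_one, Complex.norm_real, Real.norm_eq_abs]

/-- At `Re z = 0` the exponent is singular, but the modulus `|Re z|` forces the limit `0`. -/
lemma continuous_phase (M t : ℝ) : Continuous (phase M t) := by
  rw [continuous_iff_continuousAt]
  intro z
  by_cases hz : z.re = 0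
  · have h0 : phase M t z = 0 := by simp [phase, hz]
    rw [ContinuousAt, h0, tendsto_zero_iff_norm_tendsto_zero]
    simp_rw [norm_phase]
    have : ContinuousAt (fun w : ℂ => |w.re|) z := by fun_prop
    simpa [ContinuousAt, hz] using this
  · unfold phase
    have : ContinuousAt (fun w : ℂ => (w.re)⁻¹) z :=
      (Complex.continuous_re.continuousAt).inv₀ hz
    fun_prop

lemma phase_zero (M : ℝ) (z : ℂ) : phase M 0 z = z.re := by simp [phase]

/-- The exponential law, multiplied by the square of the variable so that only continuous functions
occur and the functional calculus applies. -/
lemma re_mul_phase_add (M s t : ℝ) (z : ℂ) :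
    z.re * phase M (s + t) z = phase M s z * phase M t z := by
  simp only [phase]
  rw [show (((s + t) * (M - z.re⁻¹) : ℝ) : ℂ) * Complex.I
    = ((s * (M - z.re⁻¹) : ℝ) : ℂ) * Complex.I + ((t * (M - z.re⁻¹) : ℝ) : ℂ) * Complex.I by
      push_cast; ring, Complex.exp_add]
  ring

/-- The factor `Re z` absorbs the pole of `1 / Re z`; the bound is of first order in `t`, uniformly
on bounded sets. -/
lemma norm_phase_sub_le (M t : ℝ) (z : ℂ) :
    ‖phase M t z - z.re‖ ≤ |t| * (|M| * |z.re| + 1) := by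
  have e1 : phase M t z - z.re
      = z.re * (Complex.exp (Complex.I * ((t * (M - z.re⁻¹) : ℝ) : ℂ)) - 1) := by
    rw [phase, mul_comm Complex.I]; ring
  rw [e1, norm_mul, Complex.norm_real, Real.norm_eq_abs]
  have h1 := Real.norm_exp_I_mul_ofReal_sub_one_le (x := t * (M - z.re⁻¹))
  have h2 : |z.re| * |t * (M - z.re⁻¹)| ≤ |t| * (|M| * |z.re| + 1) := by
    rw [abs_mul, mul_left_comm, ← abs_mul]
    gcongr
    rcases eq_or_ne z.re 0 with hz | hz
    · simp [hz]
    · rw [mul_sub, mul_inv_cancel₀ hz]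
      calc _ ≤ |z.re * M| + |1| := abs_sub _ _
        _ = _ := by rw [abs_mul, abs_one, mul_comm]
  refine le_trans ?_ h2
  rw [Real.norm_eq_abs] at h1
  gcongr

lemma norm_exp_ofReal_mul_I_sub_sub_le (x : ℝ) :
    ‖Complex.exp (x * Complex.I) - 1 - x * Complex.I‖ ≤ 3 * x ^ 2 := by
  have hx : ‖(x : ℂ) * Complex.I‖ = |x| := by simp
  rcases le_or_gt |x| 1 with h | h
  · have := Complex.norm_exp_sub_one_sub_id_le (x := x * Complex.I) (by rwa [hx])
    rw [hx, sq_abs] at this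
    nlinarith [sq_nonneg x]
  -- For `|x| > 1` the crude bound `2 + |x| ≤ 3 x²` suffices; this is the origin of the constant
  -- `3`.
  · have h1 : ‖Complex.exp (x * Complex.I) - 1 - x * Complex.I‖ ≤ 1 + 1 + |x| := by
      refine (norm_sub_le _ _).trans ?_
      rw [hx]
      gcongr
      refine (norm_sub_le _ _).trans ?_
      rw [Complex.norm_exp_ofReal_mul_I, norm_one]
    have : x ^ 2 = |x| ^ 2 := (sq_abs x).symm
    nlinarith

/-- A second-order Taylor estimate involves the square of the exponent, so a second factor `Re z` is
needed to cancel the pole. -/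
lemma norm_re_mul_phase_sub_sub_le (M t : ℝ) (z : ℂ) :
    ‖z.re * (phase M t z - z.re) - t * (Complex.I * ((M * z.re - 1) * z.re))‖
      ≤ 3 * t ^ 2 * (|M| * |z.re| + 1) ^ 2 := by
  rcases eq_or_ne z.re 0 with hz | hz
  · simp only [hz, Complex.ofReal_zero, zero_mul, mul_zero, sub_zero, norm_zero]; positivity
  · have hz' : (z.re : ℂ) ≠ 0 := by exact_mod_cast hz
    set ω := t * (M - z.re⁻¹) with hω
    have e1 : z.re * (phase M t z - z.re) - t * (Complex.I * ((M * z.re - 1) * z.re))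
        = (z.re : ℂ) ^ 2 * (Complex.exp (ω * Complex.I) - 1 - ω * Complex.I) := by
      rw [phase, ← hω, hω]; push_cast; field_simp
    rw [e1, norm_mul, norm_pow, Complex.norm_real, Real.norm_eq_abs]
    have h1 := norm_exp_ofReal_mul_I_sub_sub_le ω
    have h2 : |z.re * (M - z.re⁻¹)| ≤ |M| * |z.re| + 1 := by
      rw [mul_sub, mul_inv_cancel₀ hz]
      calc _ ≤ |z.re * M| + |1| := abs_sub _ _
        _ = _ := by rw [abs_mul, abs_one, mul_comm]
    calc |z.re| ^ 2 * ‖Complex.exp (ω * Complex.I) - 1 - ω * Complex.I‖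
        ≤ |z.re| ^ 2 * (3 * ω ^ 2) := by gcongr
      _ = 3 * t ^ 2 * |z.re * (M - z.re⁻¹)| ^ 2 := by
          rw [hω, sq_abs, sq_abs]; ring
      _ ≤ _ := by gcongr

variable {H : Type*} [NormedAddCommGroup H] [InnerProductSpace ℂ H] [CompleteSpace H]

lemma IsSelfAdjoint.denseRange_of_injective {K : H →L[ℂ] H} (hK : IsSelfAdjoint K)
    (hinj : Function.Injective K) : DenseRange K := by
  have h1 : (LinearMap.range K.toLinearMap)ᗮ = ⊥ := by
    have := K.orthogonal_range
    rw [ContinuousLinearMap.isSelfAdjoint_iff'.1 hK] at this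
    rw [this]
    exact LinearMap.ker_eq_bot.2 hinj
  have h2 := (Submodule.topologicalClosure_eq_top_iff).2 h1
  exact (Submodule.dense_iff_topologicalClosure_eq_top).2 h2

lemma IsSelfAdjoint.cfc_re_eq {K : H →L[ℂ] H} (hK : IsSelfAdjoint K) :
    cfc (fun z : ℂ => (z.re : ℂ)) K = K := by
  have hn : IsStarNormal K := hK.isStarNormal
  conv_rhs => rw [← cfc_id' ℂ K]
  exact cfc_congr fun z hz => (hK.mem_spectrum_eq_re hz).symm

/-- The functions `|phase|²` and `x²` coincide on the real spectrum, so the two operators `A` have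
the same `A* A`. -/
lemma norm_cfc_phase_apply {K : H →L[ℂ] H} (hK : IsSelfAdjoint K) (M t : ℝ) (f : H) :
    ‖cfc (phase M t) K f‖ = ‖K f‖ := by
  have hn : IsStarNormal K := hK.isStarNormal
  have hc := (continuous_phase M t).continuousOn (s := spectrum ℂ K)
  have e1 : star (cfc (phase M t) K) * cfc (phase M t) K = star K * K := by
    rw [← cfc_star, ← cfc_mul _ _ K (by fun_prop) hc, hK.star_eq]
    conv_rhs => rw [← hK.cfc_re_eq, ← cfc_mul _ _ K (by fun_prop) (by fun_prop)]
    refine cfc_congr fun z _ => ?_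
    have h1 : star (phase M t z) * phase M t z = ((‖phase M t z‖ : ℝ) : ℂ) ^ 2 := by
      rw [mul_comm]; exact Complex.mul_conj' _
    simp only [h1, norm_phase]
    rw [← Complex.ofReal_pow, sq_abs]; push_cast; ring
  have key : ∀ A : H →L[ℂ] H, ‖A f‖ ^ 2 = RCLike.re ⟪(star A * A) f, f⟫_ℂ := by
    intro A
    rw [ContinuousLinearMap.star_eq_adjoint]
    exact A.apply_norm_sq_eq_inner_adjoint_left f
  have : ‖cfc (phase M t) K f‖ ^ 2 = ‖K f‖ ^ 2 := by rw [key, key, e1]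
  exact (sq_eq_sq₀ (norm_nonneg _) (norm_nonneg _)).1 this

/-- The operator `exp (i t (M - K⁻¹))`. -/
noncomputable def expInverse (K : H →L[ℂ] H) (M t : ℝ) : H →L[ℂ] H :=
  -- This is `K f ↦ phase(K) f`, which preserves norms on the dense range of `K`, extended by
  -- continuity.
  (cfc (phase M t) K).toLinearMap.extendOfNorm K.toLinearMap

section expInverse

variable {K : H →L[ℂ] H} (hK : IsSelfAdjoint K) (hinj : Function.Injective K) (M : ℝ)

lemma norm_apply_le_of_mem_spectrum {z : ℂ} (hz : z ∈ spectrum ℂ K) : |z.re| ≤ ‖K‖ := by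
  rcases subsingleton_or_nontrivial (H →L[ℂ] H) with h | h
  · simp [spectrum.of_subsingleton] at hz
  · exact (Complex.abs_re_le_norm z).trans (spectrum.norm_le_norm_of_mem hz)

include hK hinj

lemma expInverse_apply (t : ℝ) (f : H) : expInverse K M t (K f) = cfc (phase M t) K f :=
  LinearMap.extendOfNorm_eq (f := (cfc (phase M t) K).toLinearMap) (e := K.toLinearMap)
    (hK.denseRange_of_injective hinj)
    ⟨1, fun x => by simpa using (norm_cfc_phase_apply hK M t x).le⟩ f

lemma norm_expInverse (t : ℝ) (f : H) : ‖expInverse K M t f‖ = ‖f‖ := by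
  have hd := hK.denseRange_of_injective hinj
  refine hd.induction_on (p := fun f => ‖expInverse K M t f‖ = ‖f‖) f
    (isClosed_eq (by fun_prop) (by fun_prop)) fun a => ?_
  rw [expInverse_apply hK hinj, norm_cfc_phase_apply hK]

lemma eq_of_comp_eq {A B : H →L[ℂ] H} (h : ∀ f, A (K f) = B (K f)) : A = B := by
  ext f
  have hd := hK.denseRange_of_injective hinj
  exact hd.induction_on (p := fun f => A f = B f) f (isClosed_eq (by fun_prop) (by fun_prop)) h

omit hinj in
lemma cfc_phase_comm (t : ℝ) (f : H) : cfc (phase M t) K (K f) = K (cfc (phase M t) K f) := by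
  have : Commute (cfc (phase M t) K) K := by
    conv_rhs => rw [← hK.cfc_re_eq]
    exact cfc_commute_cfc _ _ _
  exact DFunLike.congr_fun this.eq f

lemma expInverse_comm (t : ℝ) (f : H) : expInverse K M t (K f) = K (expInverse K M t f) := by
  have : expInverse K M t ∘L K = K ∘L expInverse K M t := by
    refine eq_of_comp_eq hK hinj fun f => ?_
    simp only [ContinuousLinearMap.comp_apply]
    rw [expInverse_apply hK hinj, expInverse_apply hK hinj, cfc_phase_comm hK]
  exact DFunLike.congr_fun this f

lemma expInverse_zero : expInverse K M 0 = 1 := by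
  refine eq_of_comp_eq hK hinj fun f => ?_
  rw [expInverse_apply hK hinj]
  simp_rw [funext (phase_zero M), hK.cfc_re_eq]
  rfl

/-- The functional calculus gives the group law only after composition with `K` twice; the dense
range of `K` is then cancelled twice. -/
lemma expInverse_add (s t : ℝ) :
    expInverse K M (s + t) = expInverse K M s ∘L expInverse K M t := by
  have hn : IsStarNormal K := hK.isStarNormal
  have hc := fun t => (continuous_phase M t).continuousOn (s := spectrum ℂ K)
  have e1 : K * cfc (phase M (s + t)) K = cfc (phase M s) K * cfc (phase M t) K := by
    conv_lhs => enter [1]; rw [← hK.cfc_re_eq]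
    rw [← cfc_mul _ _ K (by fun_prop) (hc _), ← cfc_mul _ _ K (hc _) (hc _)]
    exact cfc_congr fun z _ => re_mul_phase_add M s t z
  refine eq_of_comp_eq hK hinj fun f => ?_
  have : expInverse K M (s + t) ∘L K = (expInverse K M s ∘L expInverse K M t) ∘L K := by
    refine eq_of_comp_eq hK hinj fun f => ?_
    simp only [ContinuousLinearMap.comp_apply]
    rw [expInverse_comm hK hinj M t (K f), expInverse_apply hK hinj, expInverse_apply hK hinj,
      expInverse_apply hK hinj, cfc_phase_comm hK]
    exact DFunLike.congr_fun e1 f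
  exact DFunLike.congr_fun this f

omit hinj in
lemma norm_cfc_phase_sub_le (t : ℝ) : ‖cfc (phase M t) K - K‖ ≤ |t| * (|M| * ‖K‖ + 1) := by
  have hn : IsStarNormal K := hK.isStarNormal
  have hc := (continuous_phase M t).continuousOn (s := spectrum ℂ K)
  have e1 : cfc (phase M t) K - K = cfc (fun z => phase M t z - z.re) K := by
    rw [cfc_sub _ _ K hc (by fun_prop), hK.cfc_re_eq]
  rw [e1]
  refine norm_cfc_le (by positivity) fun z hz => (norm_phase_sub_le M t z).trans ?_
  gcongr
  exact norm_apply_le_of_mem_spectrum hz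

omit hinj in
lemma norm_mul_cfc_phase_sub_sub_le (t : ℝ) :
    ‖K * (cfc (phase M t) K - K) - (t : ℂ) • (Complex.I • (((M : ℂ) • K - 1) * K))‖
      ≤ 3 * t ^ 2 * (|M| * ‖K‖ + 1) ^ 2 := by
  have hn : IsStarNormal K := hK.isStarNormal
  have hc := (continuous_phase M t).continuousOn (s := spectrum ℂ K)
  have e1 : K * (cfc (phase M t) K - K) - (t : ℂ) • (Complex.I • (((M : ℂ) • K - 1) * K))
      = cfc (fun z => z.re * (phase M t z - z.re)
          - t * (Complex.I * ((M * z.re - 1) * z.re))) K := by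
    rw [cfc_sub _ _ K (by fun_prop) (by fun_prop), cfc_mul _ _ K (by fun_prop) (by fun_prop),
      cfc_sub _ _ K (by fun_prop) (by fun_prop), cfc_const_mul _ _ K (by fun_prop),
      cfc_const_mul _ _ K (by fun_prop), cfc_mul _ _ K (by fun_prop) (by fun_prop),
      cfc_sub _ _ K (by fun_prop) (by fun_prop), cfc_const_mul _ _ K (by fun_prop),
      hK.cfc_re_eq, cfc_const_one ℂ K]
  rw [e1]
  refine norm_cfc_le (by positivity) fun z hz => (norm_re_mul_phase_sub_sub_le M t z).trans ?_
  gcongr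
  exact norm_apply_le_of_mem_spectrum hz

lemma continuous_expInverse (f : H) : Continuous fun t => expInverse K M t f := by
  have hd := hK.denseRange_of_injective hinj
  have h0 : ∀ f, Tendsto (fun t => expInverse K M t f) (𝓝 0) (𝓝 ((1 : H →L[ℂ] H) f)) := by
    refine tendsto_apply_of_denseRange (C := 1)
      (fun t f => by rw [norm_expInverse hK hinj, one_mul]) hd fun b => ?_
    rw [one_apply_eq_self, tendsto_iff_norm_sub_tendsto_zero]
    refine squeeze_zero (g := fun t : ℝ => |t| * (|M| * ‖K‖ + 1) * ‖b‖)
      (fun _ => norm_nonneg _) (fun t => ?_) ?_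
    · rw [expInverse_apply hK hinj, ← sub_apply]
      exact (ContinuousLinearMap.le_opNorm _ _).trans
        (mul_le_mul_of_nonneg_right (norm_cfc_phase_sub_le hK M t) (norm_nonneg _))
    · have : Continuous fun t : ℝ => |t| * (|M| * ‖K‖ + 1) * ‖b‖ := by fun_prop
      simpa using this.tendsto 0
  rw [continuous_iff_continuousAt]
  intro t
  have h1 : Tendsto (fun s => expInverse K M (s - t) (expInverse K M t f)) (𝓝 t)
      (𝓝 (expInverse K M t f)) := by
    have : Tendsto (fun s : ℝ => s - t) (𝓝 t) (𝓝 0) := by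
      have : Continuous fun s : ℝ => s - t := by fun_prop
      simpa using this.tendsto t
    exact (h0 _).comp this
  refine h1.congr fun s => ?_
  rw [← ContinuousLinearMap.comp_apply, ← expInverse_add hK hinj, sub_add_cancel]

/-- The difference quotients are uniformly bounded by the first-order estimate, and on the range of
`K` they converge by the second-order one; density does the rest. -/
lemma tendsto_cfc_phase_slope (y : H) :
    Tendsto (fun t : ℝ => (t : ℂ)⁻¹ • (cfc (phase M t) K y - K y)) (𝓝[≠] 0)
      (𝓝 (Complex.I • ((M : ℂ) • K y - y))) := by
  have hd := hK.denseRange_of_injective hinj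
  refine tendsto_apply_of_denseRange (A := fun t : ℝ => (t : ℂ)⁻¹ • (cfc (phase M t) K - K))
    (B := Complex.I • ((M : ℂ) • K - 1)) (C := |M| * ‖K‖ + 1) (fun t x => ?_) hd (fun b => ?_) y
  · rcases eq_or_ne t 0 with rfl | ht
    · simp; positivity
    · refine (ContinuousLinearMap.le_opNorm _ _).trans ?_
      gcongr
      rw [norm_smul, norm_inv, Complex.norm_real, Real.norm_eq_abs, inv_mul_le_iff₀ (by positivity)]
      exact norm_cfc_phase_sub_le hK M t
  · rw [tendsto_iff_norm_sub_tendsto_zero]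
    refine squeeze_zero' (g := fun t : ℝ => 3 * |t| * (|M| * ‖K‖ + 1) ^ 2 * ‖b‖)
      (Eventually.of_forall fun _ => norm_nonneg _) ?_ ?_
    · filter_upwards [self_mem_nhdsWithin] with t ht
      have ht' : (t : ℂ) ≠ 0 := by exact_mod_cast ht
      have ht0 : 0 < |t| := abs_pos.2 ht
      set Q := K * (cfc (phase M t) K - K) - (t : ℂ) • (Complex.I • (((M : ℂ) • K - 1) * K)) with hQ
      have e1 : ((t : ℂ)⁻¹ • (cfc (phase M t) K - K)) (K b)
          - (Complex.I • ((M : ℂ) • K - 1)) (K b) = (t : ℂ)⁻¹ • Q b := by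
        have h2 := cfc_phase_comm hK M t b
        have h3 : (K * (cfc (phase M t) K - K)) b = K (cfc (phase M t) K b) - K (K b) := by
          rw [← map_sub]; rfl
        have h4 : (((M : ℂ) • K - 1) * K) b = ((M : ℂ) • K - 1) (K b) := rfl
        rw [hQ, sub_apply, smul_apply, smul_apply, smul_apply, smul_apply, sub_apply, h3, h4, h2,
          smul_sub _ _ ((t : ℂ) • _), inv_smul_smul₀ ht']
      rw [e1, norm_smul, norm_inv, Complex.norm_real, Real.norm_eq_abs, inv_mul_le_iff₀ ht0]
      calc ‖Q b‖ ≤ ‖Q‖ * ‖b‖ := Q.le_opNorm b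
        _ ≤ 3 * t ^ 2 * (|M| * ‖K‖ + 1) ^ 2 * ‖b‖ := by
            gcongr; exact norm_mul_cfc_phase_sub_sub_le hK M t
        _ = _ := by rw [← sq_abs]; ring
    · have : Continuous fun t : ℝ => 3 * |t| * (|M| * ‖K‖ + 1) ^ 2 * ‖b‖ := by fun_prop
      have h3 := this.tendsto 0
      simp only [abs_zero, mul_zero, zero_mul] at h3
      exact h3.mono_left nhdsWithin_le_nhds

/-- The generator is exactly `i (M - K⁻¹)`, with domain the range of `K`. If the quotients at `f`
converge to `h`, applying `K` to them gives `K h = i (M K f - f)`, which exhibits `f` as `K (M f + i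
h)`. -/
lemma tendsto_expInverse_slope_iff (f h : H) :
    Tendsto (fun t : ℝ => (t : ℂ)⁻¹ • (expInverse K M t f - f)) (𝓝[≠] 0) (𝓝 h) ↔
      ∃ y, f = K y ∧ h = Complex.I • ((M : ℂ) • f - y) := by
  constructor
  · intro hf
    refine ⟨(M : ℂ) • f + Complex.I • h, ?_, ?_⟩
    · have h1 := (K.continuous.tendsto h).comp hf
      have h2 := tendsto_cfc_phase_slope hK hinj M f
      have h3 : K h = Complex.I • ((M : ℂ) • K f - f) := by
        refine tendsto_nhds_unique h1 (h2.congr fun t => ?_)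
        simp only [Function.comp, map_smul, map_sub]
        rw [← expInverse_comm hK hinj, expInverse_apply hK hinj]
      rw [map_add, map_smul, map_smul, h3, smul_smul, Complex.I_mul_I]
      module
    · rw [sub_add_cancel_left, smul_neg, smul_smul, Complex.I_mul_I, neg_one_smul, neg_neg]
  · rintro ⟨y, rfl, rfl⟩
    refine (tendsto_cfc_phase_slope hK hinj M y).congr fun t => ?_
    rw [expInverse_apply hK hinj]

end expInverse

/-! ### Restriction of the group to the form domain. -/

section FormDomain

variable {E : Type*} [NormedAddCommGroup E] [InnerProductSpace ℂ E] [CompleteSpace E]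
  {J : E →L[ℂ] H} {S R : E →L[ℂ] E} {c : ℝ}

/-- The operator on `H` associated with the inverse `R` of the operator of a form with form
domain `E`. -/
noncomputable def formInverse (J : E →L[ℂ] H) (R : E →L[ℂ] E) : H →L[ℂ] H :=
  J ∘L R ∘L J.adjoint

lemma inner_inverse_apply (hS : IsSelfAdjoint S) (hSR : S ∘L R = 1) (x y : E) :
    ⟪R x, y⟫_ℂ = ⟪x, R y⟫_ℂ := by
  have h1 : ∀ x, S (R x) = x := fun x => DFunLike.congr_fun hSR x
  conv_lhs => rw [← h1 y]
  rw [← ContinuousLinearMap.adjoint_inner_left, ContinuousLinearMap.isSelfAdjoint_iff'.1 hS, h1]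

lemma isSelfAdjoint_formInverse (hS : IsSelfAdjoint S) (hSR : S ∘L R = 1) :
    IsSelfAdjoint (formInverse J R) := by
  rw [ContinuousLinearMap.isSelfAdjoint_iff_isSymmetric]
  intro f g
  change ⟪J (R (J.adjoint f)), g⟫_ℂ = ⟪f, J (R (J.adjoint g))⟫_ℂ
  rw [← ContinuousLinearMap.adjoint_inner_right, inner_inverse_apply hS hSR,
    ContinuousLinearMap.adjoint_inner_left]

lemma inner_formInverse (hSR : S ∘L R = 1) (f : H) :
    ⟪f, formInverse J R f⟫_ℂ = ⟪S (R (J.adjoint f)), R (J.adjoint f)⟫_ℂ := by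
  have h1 : ∀ x, S (R x) = x := fun x => DFunLike.congr_fun hSR x
  rw [h1, ContinuousLinearMap.adjoint_inner_left]
  rfl

/-- The quadratic form of `J R J*` at `f` is the form energy of `R J* f`, so by coercivity the
kernel consists of vectors orthogonal to the dense range of `J`. -/
lemma injective_formInverse (hSR : S ∘L R = 1) (hJ : DenseRange J)
    (hc : 0 < c) (hcoer : ∀ x, c * ‖x‖ ^ 2 ≤ RCLike.re ⟪S x, x⟫_ℂ) :
    Function.Injective (formInverse J R) := by
  rw [injective_iff_map_eq_zero]
  intro f hf
  have h1 : ∀ x, S (R x) = x := fun x => DFunLike.congr_fun hSR x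
  have h2 := hcoer (R (J.adjoint f))
  rw [← inner_formInverse hSR, hf, inner_zero_right, map_zero] at h2
  have h3 : R (J.adjoint f) = 0 := by
    have : ‖R (J.adjoint f)‖ ^ 2 ≤ 0 := by nlinarith
    simpa using this
  have h4 : J.adjoint f = 0 := by rw [← h1 (J.adjoint f), h3, map_zero]
  have h5 : ∀ g, ⟪f, g⟫_ℂ = 0 := fun g =>
    hJ.induction_on (p := fun g => ⟪f, g⟫_ℂ = 0) g (isClosed_eq (by fun_prop) (by fun_prop))
      fun x => by rw [← ContinuousLinearMap.adjoint_inner_left, h4, inner_zero_left]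
  exact inner_self_eq_zero.1 (h5 f)

lemma denseRange_inverse_comp_adjoint (hRS : R ∘L S = 1) (hJ : Function.Injective J) :
    DenseRange (R ∘L J.adjoint) := by
  have h1 : DenseRange J.adjoint := by
    have h1 : (LinearMap.range J.adjoint.toLinearMap)ᗮ = ⊥ := by
      rw [ContinuousLinearMap.orthogonal_range, ContinuousLinearMap.adjoint_adjoint]
      exact LinearMap.ker_eq_bot.2 hJ
    have h2 := (Submodule.topologicalClosure_eq_top_iff).2 h1
    exact (Submodule.dense_iff_topologicalClosure_eq_top).2 h2
  have h2 : Function.Surjective R := fun x => ⟨S x, DFunLike.congr_fun hRS x⟩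
  exact h2.denseRange.comp h1 R.continuous

/-- The unitary group of a closed form restricts to a bounded strongly continuous group on the form
domain. -/
theorem exists_group_on_formDomain (hS : IsSelfAdjoint S) (hSR : S ∘L R = 1) (hRS : R ∘L S = 1)
    (hJ : Function.Injective J) (hJd : DenseRange J)
    (hc : 0 < c) (hcoer : ∀ x, c * ‖x‖ ^ 2 ≤ RCLike.re ⟪S x, x⟫_ℂ) (M : ℝ) :
    ∃ (V : ℝ → E →L[ℂ] E) (C : ℝ), (∀ t x, J (V t x) = expInverse (formInverse J R) M t (J x)) ∧
      (∀ t x, ‖V t x‖ ≤ C * ‖x‖) ∧ ∀ x, Continuous fun t => V t x := by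
  set K := formInverse J R with hKdef
  have hK : IsSelfAdjoint K := isSelfAdjoint_formInverse hS hSR
  have hinj : Function.Injective K := injective_formInverse hSR hJd hc hcoer
  set D := R ∘L J.adjoint with hD
  have hDd : DenseRange D := denseRange_inverse_comp_adjoint hRS hJ
  set U := expInverse K M with hU
  set C := √(‖S‖ / c) with hC
  -- Conservation of energy: since `U t` is isometric and commutes with `K`, the form energy `⟨f, K
  -- f⟩` of `D f` is invariant. Coercivity and boundedness of `S` compare this energy with the
  -- squared norm of `E`, up to the ratio `‖S‖ / c`.
  have hbound : ∀ t f, ‖D (U t f)‖ ≤ C * ‖D f‖ := by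
    intro t f
    have h1 : ⟪S (D (U t f)), D (U t f)⟫_ℂ = ⟪S (D f), D f⟫_ℂ := by
      have e1 := inner_formInverse (J := J) hSR (U t f)
      have e2 := inner_formInverse (J := J) hSR f
      have e3 : ⟪U t f, U t (K f)⟫_ℂ = ⟪f, K f⟫_ℂ :=
        (LinearMap.norm_map_iff_inner_map_map (U t)).1 (norm_expInverse hK hinj M t) f (K f)
      rw [← hKdef, ← expInverse_comm hK hinj, e3, e2] at e1
      exact e1.symm
    have h2 := hcoer (D (U t f))
    rw [h1] at h2
    have h3 : RCLike.re ⟪S (D f), D f⟫_ℂ ≤ ‖S‖ * ‖D f‖ ^ 2 :=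
      (re_inner_le_norm _ _).trans (by nlinarith [S.le_opNorm (D f), norm_nonneg (D f)])
    have h4 : ‖D (U t f)‖ ^ 2 ≤ (C * ‖D f‖) ^ 2 := by
      rw [mul_pow, hC, Real.sq_sqrt (by positivity), div_mul_eq_mul_div, le_div_iff₀ hc]
      linarith
    exact (sq_le_sq₀ (norm_nonneg _) (by positivity)).1 h4
  -- The restricted group is `D f ↦ D (U t f)`, extended from the dense range of `D`; it is
  -- intertwined with `U` because `J D = K`.
  set V : ℝ → E →L[ℂ] E := fun t =>
    (D ∘L U t).toLinearMap.extendOfNorm D.toLinearMap with hV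
  have hVD : ∀ t f, V t (D f) = D (U t f) := fun t f =>
    LinearMap.extendOfNorm_eq (f := (D ∘L U t).toLinearMap) (e := D.toLinearMap) hDd
      ⟨C, hbound t⟩ f
  have hVb : ∀ t x, ‖V t x‖ ≤ C * ‖x‖ := fun t x =>
    LinearMap.norm_extendOfNorm_apply_le (f := (D ∘L U t).toLinearMap) (e := D.toLinearMap) hDd
      C (hbound t) x
  refine ⟨V, C, fun t x => ?_, hVb, fun x => ?_⟩
  · refine hDd.induction_on (p := fun x => J (V t x) = U t (J x)) x
      (isClosed_eq (by fun_prop) (by fun_prop)) fun f => ?_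
    rw [hVD]
    exact (expInverse_comm hK hinj M t f).symm
  · rw [continuous_iff_continuousAt]
    intro t
    refine tendsto_apply_of_denseRange hVb hDd (fun f => ?_) x
    simp_rw [hVD]
    exact (D.continuous.comp (continuous_expInverse hK hinj M f)).tendsto t

end FormDomain

end UnitaryGroup

/-! ### Mild equations with a time-changed group -/

/-- `V` is a strongly continuous group of operators with norms at most `C`. -/
structure IsBoundedGroup {E : Type*} [NormedAddCommGroup E] [NormedSpace ℂ E]
    (V : ℝ → E →L[ℂ] E) (C : ℝ≥0) : Prop where
  zero : V 0 = 1
  add : ∀ s t, V (s + t) = V s ∘L V t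
  bound : ∀ t x, ‖V t x‖ ≤ C * ‖x‖
  continuous : ∀ x, Continuous fun t => V t x

namespace IsBoundedGroup

variable {E : Type*} [NormedAddCommGroup E] [NormedSpace ℂ E] {V : ℝ → E →L[ℂ] E} {C : ℝ≥0}

lemma add_apply (hV : IsBoundedGroup V C) (s t : ℝ) (x : E) : V (s + t) x = V s (V t x) := by
  rw [hV.add]; rfl

lemma apply_neg_apply (hV : IsBoundedGroup V C) (t : ℝ) (x : E) : V t (V (-t) x) = x := by
  rw [← hV.add_apply, add_neg_cancel, hV.zero]; rfl

lemma neg_apply_apply (hV : IsBoundedGroup V C) (t : ℝ) (x : E) : V (-t) (V t x) = x := by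
  rw [← hV.add_apply, neg_add_cancel, hV.zero]; rfl

lemma lipschitzWith (hV : IsBoundedGroup V C) (t : ℝ) : LipschitzWith C (V t) :=
  LipschitzWith.of_dist_le_mul fun x y => by
    rw [dist_eq_norm, dist_eq_norm, ← map_sub]; exact hV.bound t _

/-- Strong continuity is upgraded to joint continuity by the uniform Lipschitz bound. -/
lemma continuous_uncurry (hV : IsBoundedGroup V C) : Continuous fun p : ℝ × E => V p.1 p.2 :=
  continuous_prod_of_continuous_lipschitzWith' _ C hV.lipschitzWith hV.continuous

lemma continuous_apply {Y : Type*} [TopologicalSpace Y] (hV : IsBoundedGroup V C) {τ : Y → ℝ}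
    {x : Y → E} (hτ : Continuous τ) (hx : Continuous x) : Continuous fun y => V (τ y) (x y) :=
  hV.continuous_uncurry.comp (hτ.prodMk hx)

end IsBoundedGroup

section MildEquation

variable {E : Type*} [NormedAddCommGroup E] [NormedSpace ℂ E]

/-- `u` solves `u(t) = V(n(t) - n(0)) x₀ + i ∫₀ᵗ V(n(t) - n(s)) F(u(s)) ds` on `[0,T]`. -/
def IsMild (V : ℝ → E →L[ℂ] E) (F : E → E) {T : ℝ} (hT : 0 < T) (n : C(Icc 0 T, ℝ)) (x₀ : E)
    (u : Icc 0 T → E) : Prop :=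
  ∀ t : Icc 0 T, u t = V (n t - n ⟨0, le_rfl, hT.le⟩) x₀ +
    Complex.I • ∫ s in (0 : ℝ)..t, V (n t - n (projIcc 0 T hT.le s)) (F (u (projIcc 0 T hT.le s)))

/-- The increment `n(t) - n(0)`, extended to all real `t`. -/
noncomputable def clockIncrement {T : ℝ} (hT : 0 < T) (n : C(Icc 0 T, ℝ)) (t : ℝ) : ℝ :=
  n (projIcc 0 T hT.le t) - n ⟨0, le_rfl, hT.le⟩

/-- The vector field of the mild equation in the moving frame. -/
noncomputable def rotatedField (V : ℝ → E →L[ℂ] E) (F : E → E) {T : ℝ} (hT : 0 < T)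
    (n : C(Icc 0 T, ℝ)) (t : ℝ) (x : E) : E :=
  Complex.I • V (-clockIncrement hT n t) (F (V (clockIncrement hT n t) x))

/-- `α` is an integral curve of the rotated field on `[0,T]` starting from `x₀`. -/
def IsRotatedCurve (V : ℝ → E →L[ℂ] E) (F : E → E) {T : ℝ} (hT : 0 < T)
    (n : C(Icc 0 T, ℝ)) (x₀ : E) (α : ℝ → E) : Prop :=
  α 0 = x₀ ∧
    ∀ t ∈ Icc 0 T, HasDerivWithinAt α (rotatedField V F hT n t (α t)) (Icc 0 T) t

variable {V : ℝ → E →L[ℂ] E} {C K : ℝ≥0} {F : E → E} {T : ℝ} {hT : 0 < T} {n : C(Icc 0 T, ℝ)}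
  {x₀ : E}

lemma continuous_clockIncrement : Continuous (clockIncrement hT n) := by
  unfold clockIncrement
  exact (n.continuous.comp continuous_projIcc).sub continuous_const

lemma lipschitzWith_rotatedField (hV : IsBoundedGroup V C) (hF : LipschitzWith K F) (t : ℝ) :
    LipschitzWith (C * (K * C)) (rotatedField V F hT n t) := by
  have h1 := (hV.lipschitzWith (-clockIncrement hT n t)).comp
    (hF.comp (hV.lipschitzWith (clockIncrement hT n t)))
  refine LipschitzWith.of_dist_le_mul fun x y => ?_
  have h2 := h1.dist_le_mul x y
  simp only [rotatedField, dist_eq_norm, ← smul_sub, norm_smul, Complex.norm_I, one_mul]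
  simpa only [dist_eq_norm, Function.comp] using h2

lemma continuous_rotatedField_comp (hV : IsBoundedGroup V C) (hF : Continuous F) {α : ℝ → E}
    (hα : Continuous α) : Continuous fun t => rotatedField V F hT n t (α t) :=
  (hV.continuous_apply continuous_clockIncrement.neg
    (hF.comp (hV.continuous_apply continuous_clockIncrement hα))).const_smul _

lemma IsRotatedCurve.continuousOn {α : ℝ → E} (h : IsRotatedCurve V F hT n x₀ α) :
    ContinuousOn α (Icc 0 T) := fun t ht => (h.2 t ht).continuousWithinAt

lemma IsRotatedCurve.hasDerivWithinAt_Ici {α : ℝ → E} (h : IsRotatedCurve V F hT n x₀ α) {t : ℝ}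
    (ht : t ∈ Ico 0 T) : HasDerivWithinAt α (rotatedField V F hT n t (α t)) (Ici t) t := by
  refine (h.2 t ⟨ht.1, ht.2.le⟩).mono_of_mem_nhdsWithin ?_
  filter_upwards [Ico_mem_nhdsGE ht.2] with s hs using ⟨ht.1.trans hs.1, hs.2.le⟩

/-- In the moving frame, the integral equation is the equation of an integral curve. -/
lemma isMild_iff_eq [CompleteSpace E] (hV : IsBoundedGroup V C) (hF : Continuous F)
    (u : C(Icc 0 T, E)) :
    IsMild V F hT n x₀ u ↔ ∀ t : Icc 0 T, V (-clockIncrement hT n t) (u t) =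
      x₀ + ∫ s in (0 : ℝ)..t,
        Complex.I • V (-clockIncrement hT n s) (F (u (projIcc 0 T hT.le s))) := by
  refine forall_congr' fun t => ?_
  set ν := clockIncrement hT n with hν
  have hνt : n t - n ⟨0, le_rfl, hT.le⟩ = ν t := by simp [hν, clockIncrement]
  have hνs : ∀ s, n t - n (projIcc 0 T hT.le s) = ν t + -ν s := fun s => by
    simp only [hν, clockIncrement, projIcc_val]; ring
  have hcont : Continuous fun s => Complex.I • V (-ν s) (F (u (projIcc 0 T hT.le s))) :=
    (hV.continuous_apply continuous_clockIncrement.neg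
      (hF.comp (u.continuous.comp continuous_projIcc))).const_smul _
  -- By the group law, `V(n(t) - n(s)) = V(ν(t)) V(-ν(s))`, and the first factor does not depend on
  -- `s`, so it comes out of the integral.
  have e1 : V (n t - n ⟨0, le_rfl, hT.le⟩) x₀ + Complex.I • ∫ s in (0 : ℝ)..t,
      V (n t - n (projIcc 0 T hT.le s)) (F (u (projIcc 0 T hT.le s)))
      = V (ν t) (x₀ + ∫ s in (0 : ℝ)..t,
        Complex.I • V (-ν s) (F (u (projIcc 0 T hT.le s)))) := by
    rw [map_add, hνt, ← ContinuousLinearMap.intervalIntegral_comp_comm _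
      (hcont.intervalIntegrable _ _), ← intervalIntegral.integral_smul]
    simp_rw [hνs, hV.add_apply, map_smul]
  rw [e1]
  constructor
  · intro h; rw [h, hV.neg_apply_apply]
  · intro h; rw [← h, hV.apply_neg_apply]

lemma IsMild.isRotatedCurve [CompleteSpace E] (hV : IsBoundedGroup V C) (hF : Continuous F)
    {u : C(Icc 0 T, E)} (hu : IsMild V F hT n x₀ u) :
    IsRotatedCurve V F hT n x₀
      (fun t => V (-clockIncrement hT n t) (u (projIcc 0 T hT.le t))) := by
  rw [isMild_iff_eq hV hF] at hu
  set ν := clockIncrement hT n with hν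
  set g := fun s => Complex.I • V (-ν s) (F (u (projIcc 0 T hT.le s))) with hg
  have hcont : Continuous g :=
    (hV.continuous_apply continuous_clockIncrement.neg
      (hF.comp (u.continuous.comp continuous_projIcc))).const_smul _
  have e1 : ∀ t ∈ Icc 0 T, V (-ν t) (u (projIcc 0 T hT.le t)) = x₀ + ∫ s in (0 : ℝ)..t, g s := by
    intro t ht
    have := hu ⟨t, ht⟩
    rwa [projIcc_of_mem _ ht]
  refine ⟨by simpa using e1 0 ⟨le_rfl, hT.le⟩, fun t ht => ?_⟩
  have h1 : HasDerivAt (fun t => x₀ + ∫ s in (0 : ℝ)..t, g s) (g t) t :=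
    (intervalIntegral.integral_hasDerivAt_right (hcont.intervalIntegrable _ _)
      hcont.aestronglyMeasurable.stronglyMeasurableAtFilter hcont.continuousAt).const_add _
  have h2 : g t = rotatedField V F hT n t (V (-ν t) (u (projIcc 0 T hT.le t))) := by
    simp only [hg, rotatedField, ← hν, hV.apply_neg_apply]
  rw [← h2]
  exact h1.hasDerivWithinAt.congr e1 (e1 t ht)

lemma IsRotatedCurve.isMild [CompleteSpace E] (hV : IsBoundedGroup V C) (hF : Continuous F)
    {α : ℝ → E} (hα : IsRotatedCurve V F hT n x₀ α) (u : C(Icc 0 T, E))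
    (hu : ∀ t : Icc 0 T, u t = V (clockIncrement hT n t) (α t)) : IsMild V F hT n x₀ u := by
  rw [isMild_iff_eq hV hF]
  intro t
  rw [hu, hV.neg_apply_apply]
  have hc := hα.continuousOn
  have hc' : ContinuousOn (fun s => rotatedField V F hT n s (α s)) (Icc 0 T) := by
    have h1 : Continuous fun s => α (projIcc 0 T hT.le s) :=
      (continuousOn_iff_continuous_domRestrict.1 hc).comp continuous_projIcc
    refine (continuous_rotatedField_comp (hT := hT) (n := n) hV hF h1).continuousOn.congr
      fun s hs => ?_
    simp only [projIcc_of_mem _ hs]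
  have h1 : ∫ s in (0 : ℝ)..t, rotatedField V F hT n s (α s) = α t - α 0 := by
    have hsub : Icc 0 (t : ℝ) ⊆ Icc 0 T := Icc_subset_Icc_right t.2.2
    refine intervalIntegral.integral_eq_sub_of_hasDeriv_right_of_le t.2.1 (hc.mono hsub)
      (fun s hs => ?_) ?_
    · exact (hα.hasDerivWithinAt_Ici ⟨hs.1.le, hs.2.trans_le t.2.2⟩).mono Ioi_subset_Ici_self
    · exact (hc'.mono (by rw [uIcc_of_le t.2.1]; exact hsub)).intervalIntegrable
  have h2 : ∫ s in (0 : ℝ)..t,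
        Complex.I • V (-clockIncrement hT n s) (F (u (projIcc 0 T hT.le s)))
      = ∫ s in (0 : ℝ)..t, rotatedField V F hT n s (α s) := by
    refine intervalIntegral.integral_congr fun s hs => ?_
    rw [uIcc_of_le t.2.1] at hs
    have hs' : s ∈ Icc 0 T := ⟨hs.1, hs.2.trans t.2.2⟩
    simp only [rotatedField, hu, projIcc_of_mem _ hs']
  rw [h2, h1, hα.1, add_sub_cancel]

lemma IsRotatedCurve.eqOn (hV : IsBoundedGroup V C) (hF : LipschitzWith K F) {α γ : ℝ → E}
    (hα : IsRotatedCurve V F hT n x₀ α) (hγ : IsRotatedCurve V F hT n x₀ γ) :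
    EqOn α γ (Icc 0 T) := by
  intro t ht
  have := dist_le_of_trajectories_ODE (δ := 0) (v := rotatedField V F hT n)
    (lipschitzWith_rotatedField hV hF) hα.continuousOn (fun t ht => hα.hasDerivWithinAt_Ici ht)
    hγ.continuousOn (fun t ht => hγ.hasDerivWithinAt_Ici ht) (by rw [hα.1, hγ.1, dist_self]) t ht
  rw [zero_mul] at this
  exact dist_le_zero.1 this

/-- Uniqueness for the mild equation. -/
theorem IsMild.unique [CompleteSpace E] (hV : IsBoundedGroup V C) (hF : LipschitzWith K F)
    {u w : C(Icc 0 T, E)} (hu : IsMild V F hT n x₀ u) (hw : IsMild V F hT n x₀ w) : u = w := by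
  ext t
  have h := (hu.isRotatedCurve hV hF.continuous).eqOn hV hF (hw.isRotatedCurve hV hF.continuous) t.2
  simp only [projIcc_val] at h
  rw [← hV.apply_neg_apply (clockIncrement hT n t) (u t), h, hV.apply_neg_apply]

/-- Only the linear growth constant enters, not the Lipschitz constant. The bound therefore survives
a cutoff of the nonlinearity, whose Lipschitz constant depends on the radius of the cutoff. -/
lemma IsRotatedCurve.norm_le (hV : IsBoundedGroup V C) {c : ℝ} (hc : ∀ x, ‖F x‖ ≤ c * ‖x‖)
    (hc0 : 0 ≤ c) {α : ℝ → E} (hα : IsRotatedCurve V F hT n x₀ α) {t : ℝ} (ht : t ∈ Icc 0 T) :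
    ‖α t‖ ≤ ‖x₀‖ * Real.exp (C * (c * C) * T) := by
  have h1 := norm_le_gronwallBound_of_norm_deriv_right_le (δ := ‖x₀‖) (K := C * (c * C)) (ε := 0)
    hα.continuousOn (fun t ht => hα.hasDerivWithinAt_Ici ht) (by rw [hα.1]) (fun t _ => ?_) t ht
  · rw [gronwallBound_ε0, sub_zero] at h1
    refine h1.trans ?_
    gcongr
    exact ht.2
  · rw [add_zero, rotatedField, norm_smul, Complex.norm_I, one_mul]
    calc _ ≤ C * ‖F (V (clockIncrement hT n t) (α t))‖ := hV.bound _ _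
      _ ≤ C * (c * (C * ‖α t‖)) := by
          gcongr
          exact (hc _).trans (mul_le_mul_of_nonneg_left (hV.bound _ _) hc0)
      _ = _ := by ring

lemma exists_isRotatedCurve [CompleteSpace E] (hV : IsBoundedGroup V C) (hF : LipschitzWith K F)
    {B : ℝ≥0} (hB : ∀ x, ‖F x‖ ≤ B) (hT : 0 < T) (n : C(Icc 0 T, ℝ)) (x₀ : E) :
    ∃ α, IsRotatedCurve V F hT n x₀ α := by
  -- The field has norm at most `C B`, so in time `T` a curve cannot leave the ball of radius `C B
  -- T`; one Picard-Lindelöf step covers the whole interval.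
  have hPL : IsPicardLindelof (rotatedField V F hT n) (tmin := 0) (tmax := T)
      ⟨0, le_rfl, hT.le⟩ x₀ (C * B * ⟨T, hT.le⟩) 0 (C * B) (C * (K * C)) :=
    { lipschitzOnWith := fun t _ => (lipschitzWith_rotatedField hV hF t).lipschitzOnWith
      continuousOn := fun x _ =>
        (continuous_rotatedField_comp hV hF.continuous continuous_const).continuousOn
      norm_le := fun t _ x _ => by
        rw [rotatedField, norm_smul, Complex.norm_I, one_mul]
        exact (hV.bound _ _).trans (by push_cast; gcongr; exact hB _)
      mul_max_le := by
        simp only [sub_zero, sub_self, max_eq_left hT.le]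
        simp only [NNReal.coe_mul, NNReal.coe_zero, sub_zero]
        exact le_rfl }
  exact hPL.exists_eq_forall_mem_Icc_hasDerivWithinAt₀

/-- Global existence and continuous dependence on the clock `n` for the mild equation. -/
theorem exists_continuous_isMild [CompleteSpace E] (hV : IsBoundedGroup V C)
    (hF : LipschitzWith K F) {B : ℝ≥0} (hB : ∀ x, ‖F x‖ ≤ B) {c : ℝ} (hc0 : 0 ≤ c)
    (hc : ∀ x, ‖F x‖ ≤ c * ‖x‖) (hT : 0 < T) (x₀ : E) :
    ∃ Φ : C(Icc 0 T, ℝ) → C(Icc 0 T, E), Continuous Φ ∧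
      ∀ n, IsMild V F hT n x₀ (Φ n) ∧ ∀ t, ‖Φ n t‖ ≤ C * (‖x₀‖ * Real.exp (C * (c * C) * T)) := by
  choose α hα using fun n => exists_isRotatedCurve hV hF hB hT n x₀
  let W : C(Icc 0 T, ℝ) → C(Icc 0 T, E) := fun n =>
    ⟨fun t => α n t, continuousOn_iff_continuous_domRestrict.1 (hα n).continuousOn⟩
  have hν : Continuous fun p : C(Icc 0 T, ℝ) × Icc 0 T => clockIncrement hT p.1 p.2 := by
    simp only [clockIncrement, projIcc_val]
    fun_prop
  have hW : Continuous W := by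
    rw [continuous_iff_continuousAt]
    intro n₀
    -- The field depends on the clock only strongly continuously, so fields are compared along the
    -- one fixed curve `W n₀`. Compactness of `[0,T]` makes this comparison uniform in time.
    let D : C(Icc 0 T, ℝ) → C(Icc 0 T, E) := fun n =>
      ⟨fun t => rotatedField V F hT n t (W n₀ t),
        (hV.continuous_apply (continuous_clockIncrement.comp continuous_subtype_val).neg
          (hF.continuous.comp (hV.continuous_apply
            (continuous_clockIncrement.comp continuous_subtype_val)
            (W n₀).continuous))).const_smul _⟩
    have hD : Continuous D := by
      refine ContinuousMap.continuous_of_continuous_uncurry _ ?_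
      change Continuous fun p : C(Icc 0 T, ℝ) × Icc 0 T =>
        Complex.I • V (-clockIncrement hT p.1 p.2)
          (F (V (clockIncrement hT p.1 p.2) (W n₀ p.2)))
      exact (hV.continuous_apply hν.neg (hF.continuous.comp (hV.continuous_apply hν
        ((W n₀).continuous.comp continuous_snd)))).const_smul _
    -- The curve for `n₀` solves the equation for `n` up to the defect `dist (D n₀) (D n)`, and
    -- Gronwall applies.
    have hdist : ∀ n, dist (W n) (W n₀)
        ≤ gronwallBound 0 (C * (K * C) : ℝ≥0) (0 + dist (D n₀) (D n)) T := by
      intro n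
      have key : ∀ t : Icc 0 T, dist (W n t) (W n₀ t)
          ≤ gronwallBound 0 (C * (K * C) : ℝ≥0) (0 + dist (D n₀) (D n)) (t - 0) := fun t =>
        dist_le_of_approx_trajectories_ODE (lipschitzWith_rotatedField hV hF)
          (hα n).continuousOn (fun t ht => (hα n).hasDerivWithinAt_Ici ht)
          (fun t _ => by rw [dist_self]) (hα n₀).continuousOn
          (fun t ht => (hα n₀).hasDerivWithinAt_Ici ht)
          (fun t ht => ContinuousMap.dist_apply_le_dist (f := D n₀) (g := D n)
            ⟨t, ht.1, ht.2.le⟩) (by rw [(hα n).1, (hα n₀).1, dist_self]) t t.2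
      have hmono := gronwallBound_mono (δ := 0) (K := (C * (K * C) : ℝ≥0))
        (ε := 0 + dist (D n₀) (D n)) le_rfl (by positivity) (by positivity)
      have : Nonempty (Icc 0 T) := ⟨⟨0, le_rfl, hT.le⟩⟩
      exact (ContinuousMap.dist_le_iff_of_nonempty).2 fun t =>
        (key t).trans (hmono (by rw [sub_zero]; exact t.2.2))
    rw [ContinuousAt, tendsto_iff_dist_tendsto_zero]
    refine squeeze_zero (fun _ => dist_nonneg) hdist ?_
    have h1 : Continuous fun n => gronwallBound 0 (C * (K * C) : ℝ≥0)
        (0 + dist (D n₀) (D n)) T :=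
      (gronwallBound_continuous_ε _ _ _).comp (continuous_const.add (continuous_const.dist hD))
    have h2 := h1.tendsto n₀
    simpa only [dist_self, add_zero, gronwallBound_ε0_δ0] using h2
  let Φ : C(Icc 0 T, ℝ) → C(Icc 0 T, E) := fun n =>
    ⟨fun t => V (clockIncrement hT n t) (W n t),
      hV.continuous_apply (continuous_clockIncrement.comp continuous_subtype_val)
        (W n).continuous⟩
  refine ⟨Φ, ?_, fun n => ⟨(hα n).isMild hV hF.continuous _ fun t => rfl, fun t => ?_⟩⟩
  · refine ContinuousMap.continuous_of_continuous_uncurry _ ?_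
    change Continuous fun p : C(Icc 0 T, ℝ) × Icc 0 T => V (clockIncrement hT p.1 p.2) (W p.1 p.2)
    refine hV.continuous_apply hν ?_
    have : Continuous fun p : C(Icc 0 T, E) × Icc 0 T => p.1 p.2 := by fun_prop
    exact this.comp ((hW.comp continuous_fst).prodMk continuous_snd)
  · exact (hV.bound _ _).trans (mul_le_mul_of_nonneg_left ((hα n).norm_le hV hc hc0 t.2) C.2)

end MildEquation

/-! ### Locally Lipschitz nonlinearities in a smaller space. -/

section Intertwined

variable {E H : Type*} [NormedAddCommGroup E] [NormedSpace ℂ E] [NormedAddCommGroup H]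
  [NormedSpace ℂ H]

/-- The cutoff function that is `1` on `[0, ρ]` and `0` on `[ρ + 1, ∞)`. -/
noncomputable def cutoff (ρ s : ℝ) : ℝ := max 0 (min 1 (ρ + 1 - s))

lemma cutoff_nonneg (ρ s : ℝ) : 0 ≤ cutoff ρ s := le_max_left _ _

lemma cutoff_le_one (ρ s : ℝ) : cutoff ρ s ≤ 1 := max_le zero_le_one (min_le_left _ _)

lemma cutoff_eq_one {ρ s : ℝ} (h : s ≤ ρ) : cutoff ρ s = 1 := by
  rw [cutoff, min_eq_left (by linarith), max_eq_right zero_le_one]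

lemma cutoff_eq_zero {ρ s : ℝ} (h : ρ + 1 ≤ s) : cutoff ρ s = 0 :=
  max_eq_left ((min_le_right _ _).trans (by linarith))

lemma abs_cutoff_sub_le (ρ s t : ℝ) : |cutoff ρ s - cutoff ρ t| ≤ |s - t| := by
  have h1 : LipschitzWith 1 fun s : ℝ => ρ + 1 - s :=
    LipschitzWith.of_dist_le_mul fun x y => by
      rw [NNReal.coe_one, one_mul, Real.dist_eq, Real.dist_eq, sub_sub_sub_cancel_left, abs_sub_comm]
  simpa [cutoff, Real.dist_eq] using ((h1.const_min 1).const_max 0).dist_le_mul s t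

/-- A locally Lipschitz map of linear growth becomes bounded and globally Lipschitz when it is
cut off. -/
lemma lipschitzWith_cutoff_smul {N : E → E} {c ρ : ℝ≥0}
    (hN : ∀ u w, ‖N u - N w‖ ≤ c * (1 + ‖w‖) * ‖u - w‖) (hc : ∀ u, ‖N u‖ ≤ c * ‖u‖) :
    LipschitzWith (c * (2 * ρ + 3)) fun u => ((cutoff ρ ‖u‖ : ℝ) : ℂ) • N u := by
  -- It is enough that one of the two points is in the ball of radius `ρ + 1`. The difference of `N`
  -- contributes `c (ρ + 2)` to the constant, that of the cutoff `c (ρ + 1)`.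
  have key : ∀ u w : E, ‖w‖ ≤ ρ + 1 →
      ‖((cutoff ρ ‖u‖ : ℝ) : ℂ) • N u - ((cutoff ρ ‖w‖ : ℝ) : ℂ) • N w‖
        ≤ c * (2 * ρ + 3) * ‖u - w‖ := by
    intro u w hw
    have h1 : ((cutoff ρ ‖u‖ : ℝ) : ℂ) • N u - ((cutoff ρ ‖w‖ : ℝ) : ℂ) • N w
        = ((cutoff ρ ‖u‖ : ℝ) : ℂ) • (N u - N w)
          + ((cutoff ρ ‖u‖ - cutoff ρ ‖w‖ : ℝ) : ℂ) • N w := by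
      push_cast; module
    have h2 : ‖((cutoff ρ ‖u‖ : ℝ) : ℂ) • (N u - N w)‖ ≤ c * (1 + (ρ + 1)) * ‖u - w‖ := by
      rw [norm_smul, Complex.norm_real, Real.norm_eq_abs, abs_of_nonneg (cutoff_nonneg _ _)]
      calc _ ≤ 1 * ‖N u - N w‖ := by gcongr; exact cutoff_le_one _ _
        _ ≤ c * (1 + ‖w‖) * ‖u - w‖ := by rw [one_mul]; exact hN u w
        _ ≤ _ := by gcongr
    have h3 : ‖((cutoff ρ ‖u‖ - cutoff ρ ‖w‖ : ℝ) : ℂ) • N w‖ ≤ ‖u - w‖ * (c * (ρ + 1)) := by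
      rw [norm_smul, Complex.norm_real, Real.norm_eq_abs]
      gcongr
      · exact (abs_cutoff_sub_le _ _ _).trans (abs_norm_sub_norm_le u w)
      · exact (hc w).trans (by gcongr)
    rw [h1]
    refine (norm_add_le _ _).trans ((add_le_add h2 h3).trans (le_of_eq (by ring)))
  refine LipschitzWith.of_dist_le_mul fun u w => ?_
  rw [dist_eq_norm, dist_eq_norm]
  push_cast
  rcases le_total ‖w‖ (ρ + 1) with hw | hw
  · exact key u w hw
  rcases le_total ‖u‖ (ρ + 1) with hu | hu
  · rw [norm_sub_rev, norm_sub_rev u]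
    exact key w u hu
  · rw [cutoff_eq_zero hw, cutoff_eq_zero hu]
    simp only [Complex.ofReal_zero, zero_smul, sub_zero, norm_zero]
    positivity

lemma norm_cutoff_smul_le {N : E → E} {c ρ : ℝ≥0} (hc : ∀ u, ‖N u‖ ≤ c * ‖u‖) (u : E) :
    ‖((cutoff ρ ‖u‖ : ℝ) : ℂ) • N u‖ ≤ c * ‖u‖ ∧
      ‖((cutoff ρ ‖u‖ : ℝ) : ℂ) • N u‖ ≤ (c * (ρ + 1) : ℝ≥0) := by
  rw [norm_smul, Complex.norm_real, Real.norm_eq_abs, abs_of_nonneg (cutoff_nonneg _ _)]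
  have h1 : cutoff ρ ‖u‖ * ‖N u‖ ≤ c * ‖u‖ :=
    (mul_le_of_le_one_left (norm_nonneg _) (cutoff_le_one _ _)).trans (hc u)
  refine ⟨h1, ?_⟩
  push_cast
  rcases le_total ‖u‖ (ρ + 1) with hu | hu
  · exact h1.trans (by gcongr)
  · rw [cutoff_eq_zero hu, zero_mul]; positivity

variable {V : ℝ → E →L[ℂ] E} {U : ℝ → H →L[ℂ] H} {C C' : ℝ≥0} {J : E →L[ℂ] H} {T : ℝ}

/-- Intertwining operators map mild solutions to mild solutions. -/
lemma IsMild.map [CompleteSpace E] [CompleteSpace H] (hV : IsBoundedGroup V C)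
    (hJ : ∀ t x, J (V t x) = U t (J x))
    {N : E → E} (hN : Continuous N) {N' : H → H} {hT : 0 < T} {n : C(Icc 0 T, ℝ)} {x₀ : E}
    {u : C(Icc 0 T, E)} (hJN : ∀ t, J (N (u t)) = N' (J (u t))) (hu : IsMild V N hT n x₀ u) :
    IsMild U N' hT n (J x₀) fun t => J (u t) := by
  intro t
  change J (u t) = _
  rw [hu t, map_add, hJ, map_smul, ← ContinuousLinearMap.intervalIntegral_comp_comm]
  · simp only [hJ, hJN]
  · refine Continuous.intervalIntegrable ?_ _ _
    exact hV.continuous_apply (continuous_const.sub (n.continuous.comp continuous_projIcc))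
      (hN.comp (u.continuous.comp continuous_projIcc))

/-- Well-posedness, in a space `E` that is mapped to `H` by an intertwining operator, of a mild
equation whose nonlinearity is Lipschitz in `H` and locally Lipschitz in `E`. -/
theorem exists_continuous_isMild_iff [CompleteSpace E] [CompleteSpace H]
    (hV : IsBoundedGroup V C) (hU : IsBoundedGroup U C') (hJ : ∀ t x, J (V t x) = U t (J x))
    {N : E → E} {c : ℝ≥0} (hN : ∀ u w, ‖N u - N w‖ ≤ c * (1 + ‖w‖) * ‖u - w‖)
    (hc : ∀ u, ‖N u‖ ≤ c * ‖u‖) {N' : H → H} {K : ℝ≥0} (hN' : LipschitzWith K N')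
    (hJN : ∀ u, J (N u) = N' (J u)) (hT : 0 < T) (x₀ : E) :
    ∃ Φ : C(Icc 0 T, ℝ) → C(Icc 0 T, E), Continuous Φ ∧
      ∀ (n : C(Icc 0 T, ℝ)) (w : C(Icc 0 T, H)),
        IsMild U N' hT n (J x₀) w ↔ ∀ t, w t = J (Φ n t) := by
  -- The radius is the a priori bound, which is the same for the cut-off nonlinearity; its solutions
  -- stay where the cutoff equals `1` and thus solve the original equation.
  obtain ⟨ρ, hρ⟩ : ∃ ρ : ℝ≥0, (ρ : ℝ) = C * (‖x₀‖ * Real.exp (C * (c * C) * T)) :=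
    ⟨⟨_, by positivity⟩, rfl⟩
  have hlip := lipschitzWith_cutoff_smul (ρ := ρ) hN hc
  obtain ⟨Φ, hΦ, hmild⟩ := exists_continuous_isMild hV hlip
    (fun u => (norm_cutoff_smul_le hc u).2) c.2 (fun u => (norm_cutoff_smul_le hc u).1) hT x₀
  refine ⟨Φ, hΦ, fun n w => ?_⟩
  have h1 : IsMild U N' hT n (J x₀) ((J : C(E, H)).comp (Φ n)) := by
    refine (hmild n).1.map hV hJ hlip.continuous fun t => ?_
    rw [cutoff_eq_one (hρ ▸ (hmild n).2 t), Complex.ofReal_one, one_smul, hJN]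
  constructor
  · intro hw t
    rw [hw.unique hU hN' h1]
    rfl
  · intro hw
    rwa [show w = (J : C(E, H)).comp (Φ n) from ContinuousMap.ext hw]

end Intertwined

/-! ### Absolutely continuous functions on the line -/

section LineCalculus

/-- Serves to dominate a complex primitive by the real primitive of the norm, and a Lipschitz
function of a primitive by that primitive. -/
lemma AbsolutelyContinuousOnInterval.of_dist_le {Y Z : Type*} [PseudoMetricSpace Y]
    [PseudoMetricSpace Z] {f : ℝ → Y} {g : ℝ → Z} {a b K : ℝ}
    (hg : AbsolutelyContinuousOnInterval g a b)
    (h : ∀ x y, dist (f x) (f y) ≤ K * dist (g x) (g y)) :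
    AbsolutelyContinuousOnInterval f a b := by
  have h1 : Tendsto (fun E : ℕ × (ℕ → ℝ × ℝ) => K * ∑ i ∈ Finset.range E.1,
      dist (g (E.2 i).1) (g (E.2 i).2))
      (AbsolutelyContinuousOnInterval.totalLengthFilter ⊓
        𝓟 (AbsolutelyContinuousOnInterval.disjWithin a b)) (𝓝 0) := by
    simpa using Tendsto.const_mul K hg
  refine squeeze_zero (fun E => Finset.sum_nonneg fun _ _ => dist_nonneg) (fun E => ?_) h1
  rw [Finset.mul_sum]
  exact Finset.sum_le_sum fun i _ => h _ _

lemma MeasureTheory.LocallyIntegrable.intervalIntegrable {h : ℝ → ℂ} (hh : LocallyIntegrable h)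
    (a b : ℝ) : IntervalIntegrable h volume a b :=
  intervalIntegrable_iff.2
    ((hh.integrableOn_isCompact isCompact_uIcc).mono_set uIoc_subset_uIcc)

lemma absolutelyContinuousOnInterval_primitive {h : ℝ → ℂ} (hh : LocallyIntegrable h) (c : ℂ)
    (a b : ℝ) : AbsolutelyContinuousOnInterval (fun x => c + ∫ t in (0 : ℝ)..x, h t) a b := by
  have hi := hh.intervalIntegrable
  refine ((hi a b).norm.absolutelyContinuousOnInterval_intervalIntegral
    (c := a) left_mem_uIcc).of_dist_le (K := 1) fun x y => ?_
  rw [dist_add_left, one_mul, dist_eq_norm, dist_eq_norm,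
    intervalIntegral.integral_interval_sub_left (hi _ _) (hi _ _),
    intervalIntegral.integral_interval_sub_left (hi _ _).norm (hi _ _).norm]
  exact intervalIntegral.norm_integral_le_abs_integral_norm

lemma ae_hasDerivAt_primitive {h : ℝ → ℂ} (hh : LocallyIntegrable h) (c : ℂ) :
    ∀ᵐ x, HasDerivAt (fun x => c + ∫ t in (0 : ℝ)..x, h t) (h x) x := by
  filter_upwards [_root_.LocallyIntegrable.ae_hasDerivAt_integral hh] with x hx using (hx 0).const_add c

lemma continuous_primitive_add {h : ℝ → ℂ} (hh : LocallyIntegrable h) (c : ℂ) :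
    Continuous (fun x => c + ∫ t in (0 : ℝ)..x, h t) :=
  continuous_const.add (intervalIntegral.continuous_primitive hh.intervalIntegrable 0)

/-- The fundamental theorem of calculus for complex absolutely continuous functions. -/
lemma AbsolutelyContinuousOnInterval.integral_eq_sub_of_ae_hasDerivAt {f f' : ℝ → ℂ} {a b : ℝ}
    (hf : AbsolutelyContinuousOnInterval f a b) (hf' : LocallyIntegrable f')
    (hd : ∀ᵐ x, HasDerivAt f (f' x) x) : ∫ x in a..b, f' x = f b - f a := by
  -- The difference of `f` and a primitive of `f'` is absolutely continuous with derivative zero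
  -- almost everywhere, hence constant.
  have h1 := hf.sub (absolutelyContinuousOnInterval_primitive hf' 0 a b)
  obtain ⟨C, hC⟩ := h1.const_of_ae_hasDerivAt_zero (by
    filter_upwards [hd, ae_hasDerivAt_primitive hf' 0] with x hx hx' _
    have := hx.sub hx'
    rwa [sub_self] at this)
  have ha := hC a left_mem_uIcc
  have hb := hC b right_mem_uIcc
  simp only [Pi.sub_apply, zero_add] at ha hb
  rw [← intervalIntegral.integral_interval_sub_left (hf'.intervalIntegrable 0 b)
    (hf'.intervalIntegrable 0 a)]
  linear_combination ha - hb

/-- Integration by parts for primitives of locally integrable functions. -/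
lemma integral_mul_add_mul_primitive {h k : ℝ → ℂ} (hh : LocallyIntegrable h)
    (hk : LocallyIntegrable k) {c d : ℂ} {p q : ℝ → ℂ}
    (hp : ∀ x, p x = c + ∫ t in (0 : ℝ)..x, h t) (hq : ∀ x, q x = d + ∫ t in (0 : ℝ)..x, k t)
    (a b : ℝ) : ∫ x in a..b, (h x * q x + p x * k x) = p b * q b - p a * q a := by
  obtain rfl : p = fun x => c + ∫ t in (0 : ℝ)..x, h t := funext hp
  obtain rfl : q = fun x => d + ∫ t in (0 : ℝ)..x, k t := funext hq
  have hpc := continuous_primitive_add hh c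
  have hqc := continuous_primitive_add hk d
  refine AbsolutelyContinuousOnInterval.integral_eq_sub_of_ae_hasDerivAt
    (f := fun x => (c + ∫ t in (0 : ℝ)..x, h t) * (d + ∫ t in (0 : ℝ)..x, k t))
    ((absolutelyContinuousOnInterval_primitive hh c a b).smul
    (absolutelyContinuousOnInterval_primitive hk d a b)) ?_ ?_
  · refine LocallyIntegrable.add ?_ ?_
    · simp_rw [mul_comm (h _)]
      exact (locallyIntegrableOn_univ.1 ((locallyIntegrableOn_univ.2 hh).continuousOn_mul
        hqc.continuousOn isOpen_univ.isLocallyClosed))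
    · exact (locallyIntegrableOn_univ.1 ((locallyIntegrableOn_univ.2 hk).continuousOn_mul
        hpc.continuousOn isOpen_univ.isLocallyClosed))
  · filter_upwards [ae_hasDerivAt_primitive hh c, ae_hasDerivAt_primitive hk d] with x h1 h2
    exact h1.mul h2

lemma locallyIntegrable_fderiv_apply {F : ℂ → ℂ} {K : ℝ≥0} (hF : LipschitzWith K F)
    {h : ℝ → ℂ} (hh : LocallyIntegrable h) {p : ℝ → ℂ} (hp : Continuous p) :
    LocallyIntegrable fun x => fderiv ℝ F (p x) (h x) := by
  refine (hh.smul (K : ℝ)).mono ?_ (Eventually.of_forall fun x => ?_)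
  · have h1 : AEStronglyMeasurable (fun x => fderiv ℝ F (p x)) volume :=
      ((measurable_fderiv ℝ F).comp hp.measurable).aestronglyMeasurable
    exact (ContinuousLinearMap.apply ℝ ℂ).aestronglyMeasurable_comp₂
      hh.aestronglyMeasurable h1
  · refine ((fderiv ℝ F (p x)).le_opNorm _).trans ?_
    rw [Pi.smul_apply, norm_smul, Real.norm_eq_abs, abs_of_nonneg K.coe_nonneg]
    gcongr
    exact norm_fderiv_le_of_lipschitz ℝ hF

/-- The chain rule for primitives of locally integrable functions. -/
lemma comp_primitive_eq {F : ℂ → ℂ} {K : ℝ≥0} (hF : LipschitzWith K F)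
    (hFd : Differentiable ℝ F) {h : ℝ → ℂ} (hh : LocallyIntegrable h) {c : ℂ} {p : ℝ → ℂ}
    (hp : ∀ x, p x = c + ∫ t in (0 : ℝ)..x, h t) (x : ℝ) :
    F (p x) = F (p 0) + ∫ t in (0 : ℝ)..x, fderiv ℝ F (p t) (h t) := by
  obtain rfl : p = fun x => c + ∫ t in (0 : ℝ)..x, h t := funext hp
  have := AbsolutelyContinuousOnInterval.integral_eq_sub_of_ae_hasDerivAt
    (f := fun x => F (c + ∫ t in (0 : ℝ)..x, h t)) (a := 0) (b := x)
    ((absolutelyContinuousOnInterval_primitive hh c 0 x).of_dist_le fun _ _ => hF.dist_le_mul _ _)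
    (locallyIntegrable_fderiv_apply hF hh (continuous_primitive_add hh c)) (by
      filter_upwards [ae_hasDerivAt_primitive hh c] with y hy
      exact (hFd _).hasFDerivAt.comp_hasDerivAt y hy)
  rw [this, add_sub_cancel]

/-- Primitives of locally integrable functions are weakly differentiable. -/
lemma integral_deriv_smul_primitive {h : ℝ → ℂ} (hh : LocallyIntegrable h) {c : ℂ} {p : ℝ → ℂ}
    (hp : ∀ x, p x = c + ∫ t in (0 : ℝ)..x, h t) {φ : ℝ → ℝ} (hφ : ContDiff ℝ (⊤ : ℕ∞) φ)
    (hc : HasCompactSupport φ) : ∫ x, deriv φ x • p x = -∫ x, φ x • h x := by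
  have hdc : Continuous (deriv φ) := hφ.continuous_deriv (by simp)
  have hpc : Continuous p := by
    rw [funext hp]; exact continuous_primitive_add hh c
  obtain ⟨r, hr⟩ := hc.isCompact.isBounded.subset_ball (0 : ℝ)
  rw [Real.ball_eq_Ioo, zero_sub, zero_add] at hr
  have hr' : Ioo (-r) r ⊆ Ioc (-r) r := Ioo_subset_Ioc_self
  have hφa : φ (-r) = 0 := image_eq_zero_of_notMem_tsupport fun h => by simpa using hr h
  have hφb : φ r = 0 := image_eq_zero_of_notMem_tsupport fun h => by simpa using hr h
  have hs1 : Function.support (fun x => deriv φ x • p x) ⊆ Ioc (-r) r := fun x hx =>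
    hr' (hr ((support_deriv_subset (f := φ)) (left_ne_zero_of_smul hx)))
  have hs2 : Function.support (fun x => φ x • h x) ⊆ Ioc (-r) r := fun x hx =>
    hr' (hr (subset_tsupport _ (left_ne_zero_of_smul hx)))
  rw [← intervalIntegral.integral_eq_integral_of_support_subset hs1,
    ← intervalIntegral.integral_eq_integral_of_support_subset hs2]
  have hdl : LocallyIntegrable (fun x => ((deriv φ x : ℝ) : ℂ)) :=
    (Complex.continuous_ofReal.comp hdc).locallyIntegrable
  have key := integral_mul_add_mul_primitive hdl hh (c := (φ 0 : ℂ)) (p := fun x => (φ x : ℂ))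
    (fun x => by
      rw [intervalIntegral.integral_ofReal, intervalIntegral.integral_deriv_eq_sub
        (fun x _ => hφ.differentiable (by simp) x) (hdc.intervalIntegrable _ _)]
      push_cast; ring) hp (-r) r
  have hi1 : IntervalIntegrable (fun x => ((deriv φ x : ℝ) : ℂ) * p x) volume (-r) r :=
    ((Complex.continuous_ofReal.comp hdc).mul hpc).intervalIntegrable _ _
  have hi2 : IntervalIntegrable (fun x => ((φ x : ℝ) : ℂ) * h x) volume (-r) r :=
    (hh.intervalIntegrable _ _).continuousOn_mul
      (Complex.continuous_ofReal.comp hφ.continuous).continuousOn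
  rw [intervalIntegral.integral_add hi1 hi2, hφa, hφb] at key
  simp only [Complex.ofReal_zero, zero_mul, sub_self, Complex.real_smul] at key ⊢
  exact eq_neg_of_add_eq_zero_left key

/-- The lemma of du Bois-Reymond. -/
lemma exists_ae_eq_const_of_integral_deriv_smul_eq_zero {S : Set ℝ} (hS : IsOpen S)
    (hSo : S.OrdConnected) (hSn : S.Nonempty) {h : ℝ → ℂ} (hh : LocallyIntegrable h)
    (h0 : ∀ φ : ℝ → ℝ, ContDiff ℝ (⊤ : ℕ∞) φ → HasCompactSupport φ → tsupport φ ⊆ S →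
      ∫ x, deriv φ x • h x = 0) : ∃ c, ∀ᵐ x, x ∈ S → h x = c := by
  obtain ⟨x₀, hx₀⟩ := hSn
  obtain ⟨ε, hε, hεS⟩ := Metric.nhds_basis_closedBall.mem_iff.1 (hS.mem_nhds hx₀)
  let bump : ContDiffBump x₀ := ⟨ε / 2, ε, by positivity, by linarith⟩
  set η : ℝ → ℝ := bump.normed volume with hη
  have hηs : ContDiff ℝ (⊤ : ℕ∞) η := bump.contDiff_normed
  have hηc : HasCompactSupport η := bump.hasCompactSupport_normed
  have hηS : tsupport η ⊆ S := by
    rw [hη, bump.tsupport_normed_eq]; exact hεS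
  have hη1 : ∫ x, η x = 1 := bump.integral_normed
  set c := ∫ x, η x • h x with hc
  have hint : ∀ φ : ℝ → ℝ, Continuous φ → HasCompactSupport φ → ∀ k : ℝ → ℂ, LocallyIntegrable k →
      Integrable (fun x => φ x • k x) := fun φ hφ hφc k hk =>
    hk.integrable_smul_left_of_hasCompactSupport hφ hφc
  refine ⟨c, ?_⟩
  have key := hS.ae_eq_zero_of_integral_contDiff_smul_eq_zero (f := fun x => h x - c)
    (μ := volume) ((hh.sub (locallyIntegrable_const c)).locallyIntegrableOn S) ?_
  · filter_upwards [key] with x hx hxS using sub_eq_zero.1 (hx hxS)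
  intro ψ hψ hψc hψS
  set m := ∫ x, ψ x with hm
  -- Subtracting `m η` gives `χ` integral zero, so `χ` is the derivative of a test function, and the
  -- hypothesis identifies `∫ ψ h` with `m c`.
  set χ : ℝ → ℝ := fun x => ψ x - m * η x with hχ
  have hχs : ContDiff ℝ (⊤ : ℕ∞) χ := hψ.sub (contDiff_const.mul hηs)
  -- The primitive of `χ` is supported in the convex hull of `Q`, which stays in `S` because `S` is
  -- an interval. The point `x₀` makes `Q` visibly nonempty.
  set Q := tsupport ψ ∪ tsupport η ∪ {x₀} with hQ
  have hQc : IsCompact Q := (hψc.isCompact.union hηc.isCompact).union isCompact_singleton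
  have hQS : Q ⊆ S := union_subset (union_subset hψS hηS) (singleton_subset_iff.2 hx₀)
  have hQn : Q.Nonempty := ⟨x₀, Or.inr rfl⟩
  set a := sInf Q
  set b := sSup Q
  have haQ : a ∈ Q := hQc.sInf_mem hQn
  have hbQ : b ∈ Q := hQc.sSup_mem hQn
  have hab : Icc a b ⊆ S := hSo.out (hQS haQ) (hQS hbQ)
  have hQab : Q ⊆ Icc a b := fun x hx => ⟨csInf_le hQc.bddBelow hx, le_csSup hQc.bddAbove hx⟩
  have hχ0 : ∀ x, x ∉ Q → χ x = 0 := by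
    intro x hx
    have h1 : ψ x = 0 := image_eq_zero_of_notMem_tsupport fun h => hx (Or.inl (Or.inl h))
    have h2 : η x = 0 := image_eq_zero_of_notMem_tsupport fun h => hx (Or.inl (Or.inr h))
    simp [hχ, h1, h2]
  have hψi : Integrable ψ := hψ.continuous.integrable_of_hasCompactSupport hψc
  have hηi : Integrable η := hηs.continuous.integrable_of_hasCompactSupport hηc
  have hχi : ∫ x, χ x = 0 := by
    rw [integral_sub hψi (hηi.const_mul m), integral_const_mul, hη1, mul_one, hm, sub_self]
  -- The lower limit `a - 1` instead of `a` keeps the support of `χ` inside the half-open interval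
  -- of integration.
  set φ : ℝ → ℝ := fun x => ∫ t in (a - 1)..x, χ t with hφ
  have hφd : ∀ x, HasDerivAt φ (χ x) x := fun x =>
    intervalIntegral.integral_hasDerivAt_right (hχs.continuous.intervalIntegrable _ _)
      hχs.continuous.aestronglyMeasurable.stronglyMeasurableAtFilter hχs.continuous.continuousAt
  have hφ' : deriv φ = χ := funext fun x => (hφd x).deriv
  have hφs : ContDiff ℝ (⊤ : ℕ∞) φ := by
    refine contDiff_infty_iff_deriv.2 ⟨fun x => (hφd x).differentiableAt, ?_⟩
    rw [hφ']; exact hχs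
  have hφ0 : ∀ x, x ∉ Icc a b → φ x = 0 := by
    intro x hx
    rcases lt_or_ge x a with h | h
    · refine intervalIntegral.integral_zero_ae (Eventually.of_forall fun t ht => hχ0 t fun htQ => ?_)
      have h1 := (hQab htQ).1
      have h2 := (uIoc_subset_uIcc ht)
      rw [mem_uIcc] at h2
      rcases h2 with h2 | h2 <;> linarith [h2.1, h2.2]
    · have hxb : b < x := lt_of_not_ge fun h' => hx ⟨h, h'⟩
      rw [hφ]
      simp only
      rw [intervalIntegral.integral_eq_integral_of_support_subset, hχi]
      intro t ht
      have htQ : t ∈ Q := by by_contra h'; exact ht (hχ0 t h')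
      exact ⟨by linarith [(hQab htQ).1], (hQab htQ).2.trans hxb.le⟩
  have hφsupp : tsupport φ ⊆ Icc a b :=
    closure_minimal (fun x hx => by by_contra h'; exact hx (hφ0 x h')) isClosed_Icc
  have hφc : HasCompactSupport φ := isCompact_Icc.of_isClosed_subset (isClosed_tsupport _) hφsupp
  have h1 := h0 φ hφs hφc (hφsupp.trans hab)
  rw [hφ'] at h1
  have e1 : ∫ x, χ x • h x = (∫ x, ψ x • h x) - (m : ℝ) • c := by
    simp only [hχ, sub_smul, mul_smul]
    rw [integral_sub (hint ψ hψ.continuous hψc h hh), integral_smul]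
    exact (hint η hηs.continuous hηc h hh).smul m
  have e2 : ∫ x, ψ x • (h x - c) = (∫ x, ψ x • h x) - (m : ℝ) • c := by
    simp only [smul_sub]
    rw [integral_sub (hint ψ hψ.continuous hψc h hh) (hψi.smul_const c), integral_smul_const]
  rw [e2, ← e1, h1]

end LineCalculus

/-! ### Sobolev functions on the edges -/

namespace MetricGraph

variable {V I X : Type*} {G : MetricGraph V I X} {e : I ⊕ X}

lemma isOpen_edgeInterior (e : I ⊕ X) : IsOpen (G.edgeInterior e) := by
  cases e
  · exact isOpen_Ioo
  · exact isOpen_Ioi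

lemma ordConnected_edgeInterior (e : I ⊕ X) : (G.edgeInterior e).OrdConnected := by
  cases e
  · exact ordConnected_Ioo
  · exact ordConnected_Ioi

lemma nonempty_edgeInterior (e : I ⊕ X) : (G.edgeInterior e).Nonempty := by
  cases e with
  | inl i => exact nonempty_Ioo.2 (G.length_pos i)
  | inr x => exact nonempty_Ioi

lemma pos_of_mem_edgeInterior {x : ℝ} (hx : x ∈ G.edgeInterior e) : 0 < x := by
  cases e with
  | inl i => exact hx.1
  | inr y => exact hx

lemma Ioc_subset_edgeInterior {x : ℝ} (hx : x ∈ G.edgeInterior e) :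
    Ioc 0 x ⊆ G.edgeInterior e := by
  cases e with
  | inl i => exact fun y hy => ⟨hy.1, hy.2.trans_lt hx.2⟩
  | inr z => exact fun y hy => hy.1

lemma endPoint_mem_edgeClosed (h : (I ⊕ X) ⊕ I) : G.endPoint h ∈ G.edgeClosed (endEdge h) := by
  rcases h with (i | x) | i
  · exact ⟨le_rfl, (G.length_pos i).le⟩
  · exact le_refl (0 : ℝ)
  · exact ⟨(G.length_pos i).le, le_rfl⟩

lemma endPoint_notMem_edgeInterior (h : (I ⊕ X) ⊕ I) :
    G.endPoint h ∉ G.edgeInterior (endEdge h) := by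
  rcases h with (i | x) | i <;> simp [endPoint, endEdge, edgeInterior]

lemma edgeMeasure_eq_restrict_edgeClosed (e : I ⊕ X) :
    G.edgeMeasure e = volume.restrict (G.edgeClosed e) := by
  cases e
  · exact Measure.restrict_congr_set Ioo_ae_eq_Icc
  · exact Measure.restrict_congr_set Ioi_ae_eq_Ici

lemma edgeClosed_subset_closure_interior (e : I ⊕ X) :
    G.edgeClosed e ⊆ closure (interior (G.edgeClosed e)) := by
  cases e with
  | inl i => exact (closure_interior_Icc (G.length_pos i).ne).symm.subset
  | inr x => simp [edgeClosed]

lemma HasTraces.unique {f : G.L2} {a b : (I ⊕ X) ⊕ I → ℂ} (ha : G.HasTraces f a)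
    (hb : G.HasTraces f b) : a = b := by
  obtain ⟨r, hr, har⟩ := ha
  obtain ⟨s, hs, hbs⟩ := hb
  funext h
  rw [har, hbs]
  have h1 := (hr (endEdge h)).2.symm.trans (hs (endEdge h)).2
  rw [edgeMeasure_eq_restrict_edgeClosed] at h1
  exact Measure.eqOn_of_ae_eq h1 (hr _).1 (hs _).1 (edgeClosed_subset_closure_interior _)
    (endPoint_mem_edgeClosed h)

/-- Extension by zero of a function on an edge. -/
noncomputable def zeroExt (g : Lp ℂ 2 (G.edgeMeasure e)) : ℝ → ℂ := (G.edgeInterior e).indicator g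

lemma memLp_zeroExt (g : Lp ℂ 2 (G.edgeMeasure e)) : MemLp (zeroExt g) 2 volume :=
  (memLp_indicator_iff_restrict (isOpen_edgeInterior e).measurableSet).2 (Lp.memLp g)

lemma locallyIntegrable_zeroExt (g : Lp ℂ 2 (G.edgeMeasure e)) :
    LocallyIntegrable (zeroExt g) := (memLp_zeroExt g).locallyIntegrable (by norm_num)

/-- The primitive of a function on an edge with value `c` at `0`. -/
noncomputable def primitive (c : ℂ) (g : Lp ℂ 2 (G.edgeMeasure e)) (x : ℝ) : ℂ :=
  c + ∫ t in (0 : ℝ)..x, zeroExt g t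

lemma continuous_primitive (c : ℂ) (g : Lp ℂ 2 (G.edgeMeasure e)) : Continuous (primitive c g) :=
  continuous_primitive_add (locallyIntegrable_zeroExt g) c

lemma ae_edgeMeasure_iff {p : ℝ → Prop} :
    (∀ᵐ x ∂(G.edgeMeasure e), p x) ↔ ∀ᵐ x, x ∈ G.edgeInterior e → p x :=
  ae_restrict_iff' (isOpen_edgeInterior e).measurableSet

lemma ae_mem_edgeInterior : ∀ᵐ x ∂(G.edgeMeasure e), x ∈ G.edgeInterior e :=
  ae_restrict_mem (isOpen_edgeInterior e).measurableSet

lemma integral_smul_edgeMeasure {φ : ℝ → ℝ} (hs : ∀ x, x ∉ G.edgeInterior e → φ x = 0)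
    {f : ℝ → ℂ} {k : ℝ → ℂ} (hfk : f =ᵐ[G.edgeMeasure e] k) :
    ∫ x, φ x • f x ∂(G.edgeMeasure e) = ∫ x, φ x • k x := by
  rw [integral_congr_ae (hfk.mono fun x hx => by simp only [hx] :
    (fun x => φ x • f x) =ᵐ[G.edgeMeasure e] fun x => φ x • k x)]
  exact setIntegral_eq_integral_of_forall_compl_eq_zero fun x hx => by rw [hs x hx, zero_smul]

lemma coe_ae_eq_zeroExt (g : Lp ℂ 2 (G.edgeMeasure e)) : g =ᵐ[G.edgeMeasure e] zeroExt g := by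
  filter_upwards [ae_mem_edgeInterior] with x hx
  rw [zeroExt, indicator_of_mem hx]

/-- Weak differentiability on an edge is the existence of an absolutely continuous
representative. -/
lemma isWeakDeriv_iff {f g : Lp ℂ 2 (G.edgeMeasure e)} :
    G.IsWeakDeriv e f g ↔ ∃ c, f =ᵐ[G.edgeMeasure e] primitive c g := by
  have hd0 : ∀ φ : ℝ → ℝ, tsupport φ ⊆ G.edgeInterior e →
      ∀ x, x ∉ G.edgeInterior e → deriv φ x = 0 := fun φ hφ x hx => by
    by_contra h; exact hx (hφ (support_deriv_subset h))
  have hφ0 : ∀ φ : ℝ → ℝ, tsupport φ ⊆ G.edgeInterior e →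
      ∀ x, x ∉ G.edgeInterior e → φ x = 0 := fun φ hφ x hx =>
    image_eq_zero_of_notMem_tsupport fun h => hx (hφ h)
  constructor
  · intro h
    have hfl := locallyIntegrable_zeroExt f
    have hpl := (continuous_primitive 0 g).locallyIntegrable (μ := volume)
    have key : ∀ φ : ℝ → ℝ, ContDiff ℝ (⊤ : ℕ∞) φ → HasCompactSupport φ →
        tsupport φ ⊆ G.edgeInterior e →
        ∫ x, deriv φ x • (zeroExt f - primitive 0 g) x = 0 := by
      intro φ hφ hφc hφs
      have h1 := h φ hφ hφc hφs
      rw [integral_smul_edgeMeasure (hd0 φ hφs) (coe_ae_eq_zeroExt f),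
        integral_smul_edgeMeasure (hφ0 φ hφs) (coe_ae_eq_zeroExt g)] at h1
      have h2 := integral_deriv_smul_primitive (locallyIntegrable_zeroExt g) (c := 0)
        (p := primitive 0 g) (fun x => rfl) hφ hφc
      have hdc : Continuous (deriv φ) := hφ.continuous_deriv (by simp)
      simp only [Pi.sub_apply, smul_sub]
      rw [integral_sub (hfl.integrable_smul_left_of_hasCompactSupport hdc hφc.deriv)
        (hpl.integrable_smul_left_of_hasCompactSupport hdc hφc.deriv), h1, h2, sub_self]
    obtain ⟨c, hc⟩ := exists_ae_eq_const_of_integral_deriv_smul_eq_zero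
      (isOpen_edgeInterior e) (ordConnected_edgeInterior e) (nonempty_edgeInterior e)
      (hfl.sub hpl) key
    refine ⟨c, ?_⟩
    filter_upwards [ae_edgeMeasure_iff.2 hc, coe_ae_eq_zeroExt f] with x hx hx'
    rw [hx', ← hx, primitive, Pi.sub_apply, primitive]
    ring
  · rintro ⟨c, hc⟩ φ hφ hφc hφs
    rw [integral_smul_edgeMeasure (hd0 φ hφs) hc,
      integral_smul_edgeMeasure (hφ0 φ hφs) (coe_ae_eq_zeroExt g)]
    exact integral_deriv_smul_primitive (locallyIntegrable_zeroExt g) (fun x => rfl) hφ hφc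

/-- Makes the representation of Sobolev functions by pairs `(f, f')` faithful. -/
lemma IsWeakDeriv.unique {f g k : Lp ℂ 2 (G.edgeMeasure e)} (hg : G.IsWeakDeriv e f g)
    (hk : G.IsWeakDeriv e f k) : g = k := by
  refine Lp.ext ?_
  have h1 := (isOpen_edgeInterior (G := G) e).ae_eq_zero_of_integral_contDiff_smul_eq_zero
    (f := fun x => zeroExt g x - zeroExt k x) (μ := volume)
    (((locallyIntegrable_zeroExt g).sub (locallyIntegrable_zeroExt k)).locallyIntegrableOn _)
    (fun φ hφ hφc hφs => ?_)
  · filter_upwards [ae_edgeMeasure_iff.2 h1, coe_ae_eq_zeroExt g, coe_ae_eq_zeroExt k]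
      with x hx h2 h3
    rw [h2, h3, sub_eq_zero.1 hx]
  · have hφ0 : ∀ x, x ∉ G.edgeInterior e → φ x = 0 := fun x hx =>
      image_eq_zero_of_notMem_tsupport fun h => hx (hφs h)
    have h2 := (hg φ hφ hφc hφs).symm.trans (hk φ hφ hφc hφs)
    rw [integral_smul_edgeMeasure hφ0 (coe_ae_eq_zeroExt g),
      integral_smul_edgeMeasure hφ0 (coe_ae_eq_zeroExt k), neg_inj] at h2
    simp only [smul_sub]
    rw [integral_sub ((locallyIntegrable_zeroExt g).integrable_smul_left_of_hasCompactSupport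
      hφ.continuous hφc) ((locallyIntegrable_zeroExt k).integrable_smul_left_of_hasCompactSupport
      hφ.continuous hφc), h2, sub_self]

/-- Continuously differentiable functions are weakly differentiable. -/
lemma isWeakDeriv_toLp {q : ℝ → ℂ} (hq : ContDiff ℝ 1 q) (h0 : MemLp q 2 (G.edgeMeasure e))
    (h1 : MemLp (deriv q) 2 (G.edgeMeasure e)) : G.IsWeakDeriv e h0.toLp h1.toLp := by
  refine isWeakDeriv_iff.2 ⟨q 0, ?_⟩
  have hdc : Continuous (deriv q) := hq.continuous_deriv le_rfl
  have h2 : ∀ᵐ x, x ∈ G.edgeInterior e → zeroExt h1.toLp x = deriv q x :=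
    ae_edgeMeasure_iff.1 ((coe_ae_eq_zeroExt _).symm.trans h1.coeFn_toLp)
  filter_upwards [h0.coeFn_toLp, ae_mem_edgeInterior] with x hx hxe
  rw [hx, primitive, intervalIntegral.integral_congr_ae (g := deriv q),
    intervalIntegral.integral_deriv_eq_sub (fun x _ => hq.differentiable (by simp) x)
      (hdc.intervalIntegrable _ _), add_sub_cancel]
  filter_upwards [h2] with t ht htx
  rw [uIoc_of_le (pos_of_mem_edgeInterior hxe).le] at htx
  exact ht (Ioc_subset_edgeInterior hxe htx)

lemma integral_norm_le_sqrt_mul_norm (u : Lp ℂ 2 (G.edgeMeasure e)) {α d : ℝ} (hd : 0 ≤ d)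
    (hJ : Ioo α (α + d) ⊆ G.edgeInterior e) :
    IntegrableOn u (Ioo α (α + d)) ∧ ∫ x in Ioo α (α + d), ‖u x‖ ≤ √d * ‖u‖ := by
  have hle : volume.restrict (Ioo α (α + d)) ≤ G.edgeMeasure e := Measure.restrict_mono hJ le_rfl
  have hm : MemLp u 2 (volume.restrict (Ioo α (α + d))) := (Lp.memLp u).mono_measure hle
  have hfin : IsFiniteMeasure (volume.restrict (Ioo α (α + d))) := ⟨by simp⟩
  have hint : Integrable u (volume.restrict (Ioo α (α + d))) := hm.integrable (by norm_num)
  refine ⟨hint, ?_⟩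
  have h1 := eLpNorm_le_eLpNorm_mul_rpow_measure_univ (p := 1) (q := 2) (by norm_num)
    hm.aestronglyMeasurable
  have h2 : eLpNorm u 2 (volume.restrict (Ioo α (α + d))) ≤ eLpNorm u 2 (G.edgeMeasure e) :=
    eLpNorm_mono_measure _ hle
  have h3 : (volume.restrict (Ioo α (α + d))) univ = ENNReal.ofReal d := by simp
  rw [integral_norm_eq_lintegral_enorm hint.aestronglyMeasurable, ← eLpNorm_one_eq_lintegral_enorm]
  have h4 : eLpNorm u 1 (volume.restrict (Ioo α (α + d)))
      ≤ ENNReal.ofReal (√d * ‖u‖) := by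
    refine (h1.trans (mul_le_mul_left h2 _)).trans ?_
    rw [h3, mul_comm, ENNReal.ofReal_mul (by positivity), Lp.norm_def,
      ENNReal.ofReal_toReal (Lp.eLpNorm_ne_top u)]
    refine mul_le_mul_left ?_ _
    rw [Real.sqrt_eq_rpow, ENNReal.ofReal_rpow_of_nonneg hd (by norm_num)]
    norm_num
  exact ENNReal.toReal_le_of_le_ofReal (by positivity) h4

/-- Pointwise bound of a Sobolev function, from an interval of length `d` in the edge. -/
lemma norm_primitive_le {f g : Lp ℂ 2 (G.edgeMeasure e)} {c : ℂ}
    (hf : f =ᵐ[G.edgeMeasure e] primitive c g) {α d x : ℝ} (hd : 0 < d)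
    (hx : x ∈ Icc α (α + d)) (hJ : Ioo α (α + d) ⊆ G.edgeInterior e) :
    ‖primitive c g x‖ ≤ (√d)⁻¹ * ‖f‖ + √d * ‖g‖ := by
  obtain ⟨hfi, hf1⟩ := integral_norm_le_sqrt_mul_norm f hd.le hJ
  obtain ⟨hgi, hg1⟩ := integral_norm_le_sqrt_mul_norm g hd.le hJ
  have hgl := locallyIntegrable_zeroExt g
  set N := ∫ x in Ioo α (α + d), ‖g x‖ with hN
  have hgN : ∫ t in α..(α + d), ‖zeroExt g t‖ = N := by
    rw [intervalIntegral.integral_of_le (by linarith), integral_Ioc_eq_integral_Ioo, hN]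
    refine setIntegral_congr_fun measurableSet_Ioo fun t ht => ?_
    simp only [zeroExt, indicator_of_mem (hJ ht)]
  -- The value at `x` is compared with the values at all `y` of the interval and averaged over `y`;
  -- Cauchy-Schwarz turns the two `L¹` norms into `√d` times `L²` norms.
  have key : ∀ y ∈ Ioo α (α + d), ‖primitive c g x‖ ≤ ‖primitive c g y‖ + N := by
    intro y hy
    have e1 : primitive c g x = primitive c g y + ∫ t in y..x, zeroExt g t := by
      rw [primitive, primitive, add_assoc, intervalIntegral.integral_add_adjacent_intervals
        (hgl.intervalIntegrable _ _) (hgl.intervalIntegrable _ _)]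
    rw [e1]
    refine (norm_add_le _ _).trans ?_
    gcongr
    refine intervalIntegral.norm_integral_le_integral_norm_uIoc.trans ?_
    rw [← hgN, intervalIntegral.integral_of_le (by linarith)]
    refine setIntegral_mono_set (hgl.intervalIntegrable _ _).1.norm
      (Eventually.of_forall fun _ => norm_nonneg _) (LE.le.eventuallyLE ?_)
    refine fun t ht => ?_
    rcases le_total y x with h | h
    · rw [uIoc_of_le h] at ht; exact ⟨hy.1.trans ht.1, ht.2.trans hx.2⟩
    · rw [uIoc_of_ge h] at ht; exact ⟨hx.1.trans_lt ht.1, ht.2.trans hy.2.le⟩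
  have hvol : (volume.restrict (Ioo α (α + d))).real univ = d := by
    simp [measureReal_def, hd.le]
  have hfin : IsFiniteMeasure (volume.restrict (Ioo α (α + d))) := ⟨by simp⟩
  have hfp : ∀ᵐ y ∂(volume.restrict (Ioo α (α + d))), ‖f y‖ = ‖primitive c g y‖ := by
    have h1 : ∀ᵐ y ∂(volume.restrict (Ioo α (α + d))), f y = primitive c g y :=
      ae_mono (Measure.restrict_mono hJ le_rfl) hf
    filter_upwards [h1] with y hy using by rw [hy]
  have h2 : d * ‖primitive c g x‖ ≤ (∫ y in Ioo α (α + d), ‖f y‖) + d * N := by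
    have h3 : ∫ y in Ioo α (α + d), ‖primitive c g x‖
        ≤ ∫ y in Ioo α (α + d), (‖f y‖ + N) := by
      refine integral_mono_ae (integrable_const _) (hfi.norm.add (integrable_const _)) ?_
      filter_upwards [hfp, ae_restrict_mem measurableSet_Ioo] with y hy hyJ
      rw [hy]; exact key y hyJ
    rwa [integral_add hfi.norm (integrable_const _), integral_const, integral_const, hvol,
      smul_eq_mul, smul_eq_mul] at h3
  have h5 : d * ‖primitive c g x‖ ≤ √d * ‖f‖ + d * (√d * ‖g‖) :=
    h2.trans (add_le_add hf1 (mul_le_mul_of_nonneg_left hg1 hd.le))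
  have h6 : d * ((√d)⁻¹ * ‖f‖ + √d * ‖g‖) = √d * ‖f‖ + d * (√d * ‖g‖) := by
    rw [mul_add, ← mul_assoc d]
    rw [← div_eq_mul_inv, Real.div_sqrt]
  exact le_of_mul_le_mul_left (h5.trans h6.ge) hd

/-- All points of the edges have intervals of a given small length next to them. -/
lemma eventually_exists_interval [Finite I] [Finite X] (G : MetricGraph V I X) :
    ∀ᶠ d in 𝓝[>] (0 : ℝ), ∀ e : I ⊕ X, ∀ x ∈ G.edgeClosed e,
      ∃ α, x ∈ Icc α (α + d) ∧ Ioo α (α + d) ⊆ G.edgeInterior e := by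
  refine eventually_all.2 fun e => ?_
  cases e with
  | inl i =>
    have hl := G.length_pos i
    filter_upwards [Ioo_mem_nhdsGT (half_pos hl)] with d hd x hx
    rcases le_total x (G.length i / 2) with h | h
    · exact ⟨x, ⟨le_rfl, by linarith [hd.1]⟩, fun y hy =>
        ⟨hx.1.trans_lt hy.1, by linarith [hy.2, hd.2]⟩⟩
    · exact ⟨x - d, ⟨by linarith [hd.1], by linarith⟩, fun y hy =>
        ⟨by linarith [hy.1, hd.2], by linarith [hy.2, hx.2]⟩⟩
  | inr y =>
    filter_upwards [self_mem_nhdsWithin] with d hd x hx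
    exact ⟨x, ⟨le_rfl, by linarith [mem_Ioi.1 hd]⟩, fun y hy => lt_of_le_of_lt hx hy.1⟩

lemma inner_ae_eq {f₁ f₂ : Lp ℂ 2 (G.edgeMeasure e)} {p₁ p₂ : ℝ → ℂ}
    (h₁ : f₁ =ᵐ[G.edgeMeasure e] p₁) (h₂ : f₂ =ᵐ[G.edgeMeasure e] p₂) :
    (fun x => ⟪f₁ x, f₂ x⟫_ℂ) =ᵐ[G.edgeMeasure e] fun x => (starRingEnd ℂ) (p₁ x) * p₂ x := by
  filter_upwards [h₁, h₂] with x hx1 hx2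
  rw [hx1, hx2, RCLike.inner_apply, mul_comm]

/-- The boundary terms of an integration by parts on an edge. -/
def edgeBoundary (G : MetricGraph V I X) (b : ℝ → ℂ) : I ⊕ X → ℂ
  | Sum.inl i => b (G.length i) - b 0
  | Sum.inr _ => -b 0

/-- Integration by parts on an edge. -/
lemma inner_add_inner_eq_edgeBoundary {f₁ g₁ f₂ g₂ : Lp ℂ 2 (G.edgeMeasure e)} {c₁ c₂ : ℂ}
    (h₁ : f₁ =ᵐ[G.edgeMeasure e] primitive c₁ g₁) (h₂ : f₂ =ᵐ[G.edgeMeasure e] primitive c₂ g₂) :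
    ⟪g₁, f₂⟫_ℂ + ⟪f₁, g₂⟫_ℂ = G.edgeBoundary
      (fun x => (starRingEnd ℂ) (primitive c₁ g₁ x) * primitive c₂ g₂ x) e := by
  set b : ℝ → ℂ := fun x => (starRingEnd ℂ) (primitive c₁ g₁ x) * primitive c₂ g₂ x with hb
  set k : ℝ → ℂ := fun x => (starRingEnd ℂ) (zeroExt g₁ x) * primitive c₂ g₂ x +
    (starRingEnd ℂ) (primitive c₁ g₁ x) * zeroExt g₂ x with hk
  have hl1 : LocallyIntegrable fun x => (starRingEnd ℂ) (zeroExt g₁ x) := by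
    have h := locallyIntegrable_zeroExt g₁
    refine h.mono (Complex.continuous_conj.comp_aestronglyMeasurable h.aestronglyMeasurable)
      (Eventually.of_forall fun x => by rw [RCLike.norm_conj])
  have hFTC : ∀ x, ∫ t in (0 : ℝ)..x, k t = b x - b 0 := fun x =>
    integral_mul_add_mul_primitive hl1 (locallyIntegrable_zeroExt g₂)
      (c := (starRingEnd ℂ) c₁) (d := c₂) (p := fun x => (starRingEnd ℂ) (primitive c₁ g₁ x))
      (fun x => by
        rw [primitive, map_add]
        congr 1
        simp only [intervalIntegral, map_sub, integral_conj])
      (fun x => rfl) 0 x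
  have hI : ⟪g₁, f₂⟫_ℂ + ⟪f₁, g₂⟫_ℂ = ∫ x in G.edgeInterior e, k x ∧
      IntegrableOn k (G.edgeInterior e) := by
    have e1 := inner_ae_eq (coe_ae_eq_zeroExt g₁) h₂
    have e2 := inner_ae_eq h₁ (coe_ae_eq_zeroExt g₂)
    have i1 := L2.integrable_inner (𝕜 := ℂ) g₁ f₂
    have i2 := L2.integrable_inner (𝕜 := ℂ) f₁ g₂
    constructor
    · rw [L2.inner_def, L2.inner_def, ← integral_add i1 i2]
      exact integral_congr_ae (e1.add e2)
    · exact (i1.add i2).congr (e1.add e2)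
  rw [hI.1]
  cases e with
  | inl i =>
    have hl := G.length_pos i
    rw [edgeInterior, edgeBoundary, ← integral_Ioc_eq_integral_Ioo,
      ← intervalIntegral.integral_of_le hl.le, hFTC]
  | inr y =>
    have hki : IntegrableOn k (Ioi 0) := hI.2
    -- On a half-line the boundary product has a limit at infinity, by the fundamental theorem of
    -- calculus. It is also integrable, so the limit is zero and only the term at `0` remains.
    have ht := intervalIntegral_tendsto_integral_Ioi 0 hki tendsto_id
    simp only [id, hFTC] at ht
    have hb1 : Tendsto b atTop (𝓝 ((∫ x in Ioi 0, k x) + b 0)) := by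
      simpa using ht.add_const (b 0)
    have hbi : IntegrableOn b (Ioi 0) :=
      (L2.integrable_inner (𝕜 := ℂ) f₁ f₂).congr (inner_ae_eq h₁ h₂)
    have hb0 := IntegrableAtFilter.eq_zero_of_tendsto (l := atTop) (μ := volume)
      ⟨Ioi 0, Ioi_mem_atTop 0, hbi⟩ (fun s hs => ?_) hb1
    · rw [edgeInterior, edgeBoundary]
      exact eq_neg_of_add_eq_zero_left hb0
    · obtain ⟨N, hN⟩ := mem_atTop_sets.1 hs
      exact measure_mono_top (fun x hx => hN x hx) (Real.volume_Ici (a := N))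

end MetricGraph

/-! ### The Sobolev space of the graph and its boundary values -/

namespace MetricGraph

variable {V I X : Type*} (G : MetricGraph V I X)

/-- The Sobolev space `W^{1,2}(Γ)`, as a space of pairs `(f, f')`. -/
def sobolev : Submodule ℂ (WithLp 2 (G.L2 × G.L2)) where
  carrier := {p | ∀ e, G.IsWeakDeriv e (p.fst e) (p.snd e)}
  add_mem' := fun hp hq e => (hp e).add (hq e)
  zero_mem' := fun e => isWeakDeriv_zero e
  smul_mem' := fun c _ hp e => (hp e).smul c

variable {G}

lemma exists_primitive (p : G.sobolev) :
    ∃ c : I ⊕ X → ℂ, ∀ e, p.1.fst e =ᵐ[G.edgeMeasure e] primitive (c e) (p.1.snd e) :=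
  ⟨fun e => (isWeakDeriv_iff.1 (p.2 e)).choose, fun e => (isWeakDeriv_iff.1 (p.2 e)).choose_spec⟩

lemma hasTraces_primitive {f g : G.L2} {c : I ⊕ X → ℂ}
    (hc : ∀ e, f e =ᵐ[G.edgeMeasure e] primitive (c e) (g e)) :
    G.HasTraces f fun h => primitive (c (endEdge h)) (g (endEdge h)) (G.endPoint h) :=
  ⟨fun e => primitive (c e) (g e), fun e => ⟨(continuous_primitive _ _).continuousOn, hc e⟩,
    fun _ => rfl⟩

lemma exists_hasTraces (p : G.sobolev) : ∃ a, G.HasTraces p.1.fst a := by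
  obtain ⟨c, hc⟩ := exists_primitive p
  exact ⟨_, hasTraces_primitive hc⟩

/-- The boundary values of a Sobolev function at all edge ends. -/
noncomputable def trace (p : G.sobolev) : (I ⊕ X) ⊕ I → ℂ := (exists_hasTraces p).choose

lemma hasTraces_trace (p : G.sobolev) : G.HasTraces p.1.fst (trace p) :=
  (exists_hasTraces p).choose_spec

lemma trace_eq {p : G.sobolev} {a : (I ⊕ X) ⊕ I → ℂ} (ha : G.HasTraces p.1.fst a) : trace p = a :=
  (hasTraces_trace p).unique ha

lemma trace_add (p q : G.sobolev) : trace (p + q) = trace p + trace q :=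
  trace_eq ((hasTraces_trace p).add (hasTraces_trace q))

lemma trace_smul (c : ℂ) (p : G.sobolev) : trace (c • p) = c • trace p :=
  trace_eq ((hasTraces_trace p).smul c)

lemma continuous_integral_smul {e : I ⊕ X} {φ : ℝ → ℝ} (hφ : Continuous φ)
    (hc : HasCompactSupport φ) :
    Continuous fun f : Lp ℂ 2 (G.edgeMeasure e) => ∫ x, φ x • f x ∂(G.edgeMeasure e) := by
  have h1 : MemLp (fun x => (φ x : ℂ)) 2 (G.edgeMeasure e) :=
    ((Complex.continuous_ofReal.comp hφ).memLp_of_hasCompactSupport (p := 2) (μ := volume)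
      (hc.comp_left Complex.ofReal_zero)).restrict _
  have h2 : (fun f : Lp ℂ 2 (G.edgeMeasure e) => ∫ x, φ x • f x ∂(G.edgeMeasure e))
      = fun f => ⟪h1.toLp, f⟫_ℂ := by
    funext f
    rw [L2.inner_def]
    refine integral_congr_ae ?_
    filter_upwards [h1.coeFn_toLp] with x hx
    rw [hx, RCLike.inner_apply, Complex.conj_ofReal, mul_comm, Complex.real_smul]
  rw [h2]
  fun_prop

variable (G) in
-- Each test function imposes a condition that is continuous in `L²`. With bounded traces this makes
-- the form domain a Hilbert space.
lemma isClosed_sobolev : IsClosed (G.sobolev : Set (WithLp 2 (G.L2 × G.L2))) := by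
  have hset : (G.sobolev : Set (WithLp 2 (G.L2 × G.L2))) =
      ⋂ (e : I ⊕ X) (φ : ℝ → ℝ) (_ : ContDiff ℝ (⊤ : ℕ∞) φ) (_ : HasCompactSupport φ)
        (_ : tsupport φ ⊆ G.edgeInterior e),
        {p | ∫ x, deriv φ x • p.fst e x ∂(G.edgeMeasure e)
          = -∫ x, φ x • p.snd e x ∂(G.edgeMeasure e)} := by
    ext p
    simp only [mem_iInter, mem_ofPred_eq]
    rfl
  rw [hset]
  refine isClosed_iInter fun e => isClosed_iInter fun φ => isClosed_iInter fun hφ =>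
    isClosed_iInter fun hc => isClosed_iInter fun _ => ?_
  have hf : Continuous fun p : WithLp 2 (G.L2 × G.L2) => p.fst e :=
    (PiLp.continuous_apply 2 _ e).comp (WithLp.fstL 2 ℂ G.L2 G.L2).continuous
  have hs : Continuous fun p : WithLp 2 (G.L2 × G.L2) => p.snd e :=
    (PiLp.continuous_apply 2 _ e).comp (WithLp.sndL 2 ℂ G.L2 G.L2).continuous
  exact isClosed_eq ((continuous_integral_smul (hφ.continuous_deriv (by simp)) hc.deriv).comp hf)
    ((continuous_integral_smul hφ.continuous hc).comp hs).neg

/-- Families of continuously differentiable functions are Sobolev functions. -/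
lemma exists_sobolev_of_contDiff {q : I ⊕ X → ℝ → ℂ} (hq : ∀ e, ContDiff ℝ 1 (q e))
    (h0 : ∀ e, MemLp (q e) 2 (G.edgeMeasure e))
    (h1 : ∀ e, MemLp (deriv (q e)) 2 (G.edgeMeasure e)) :
    ∃ p : G.sobolev, p.1.fst = WithLp.toLp 2 (fun e => (h0 e).toLp) ∧
      p.1.snd = WithLp.toLp 2 (fun e => (h1 e).toLp) ∧
      ∀ h, trace p h = q (endEdge h) (G.endPoint h) := by
  let p : G.sobolev := ⟨WithLp.toLp 2 (WithLp.toLp 2 (fun e => (h0 e).toLp),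
    WithLp.toLp 2 (fun e => (h1 e).toLp)), fun e => isWeakDeriv_toLp (hq e) (h0 e) (h1 e)⟩
  refine ⟨p, rfl, rfl, fun h => ?_⟩
  have : G.HasTraces p.1.fst fun h => q (endEdge h) (G.endPoint h) :=
    ⟨q, fun e => ⟨(hq e).continuous.continuousOn, (h0 e).coeFn_toLp⟩, fun _ => rfl⟩
  rw [trace_eq this]

/-- All boundary values occur. -/
lemma exists_trace_eq (a : (I ⊕ X) ⊕ I → ℂ) : ∃ p : G.sobolev, trace p = a := by
  -- Affine interpolation on internal edges, and a decaying exponential on external ones so as to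
  -- remain in `L²`.
  let q : I ⊕ X → ℝ → ℂ := fun e => match e with
    | Sum.inl i => fun x => a (Sum.inl (Sum.inl i)) +
        (a (Sum.inr i) - a (Sum.inl (Sum.inl i))) / G.length i * (x : ℂ)
    | Sum.inr y => fun x => a (Sum.inl (Sum.inr y)) * ((Real.exp (-x) : ℝ) : ℂ)
  have hq : ∀ e, ContDiff ℝ (⊤ : ℕ∞) (q e) := by
    rintro (i | y)
    · exact contDiff_const.add (contDiff_const.mul Complex.ofRealCLM.contDiff)
    · exact contDiff_const.mul (Complex.ofRealCLM.contDiff.comp (Real.contDiff_exp.comp contDiff_neg))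
  have hexp : MemLp (fun x : ℝ => ((Real.exp (-x) : ℝ) : ℂ)) 2 (volume.restrict (Ioi (0 : ℝ))) := by
    rw [memLp_two_iff_integrable_sq_norm (by
      exact (Complex.continuous_ofReal.comp (Real.continuous_exp.comp
        continuous_neg)).aestronglyMeasurable)]
    have := integrableOn_exp_mul_Ioi (a := -2) (by norm_num) 0
    refine this.congr (Eventually.of_forall fun x => ?_)
    simp only [Complex.norm_real, Real.norm_eq_abs, Real.abs_exp]
    rw [← Real.exp_nat_mul]; congr 1; push_cast; ring
  have hbdd : ∀ (i : I) (k : ℝ → ℂ), Continuous k → MemLp k 2 (G.edgeMeasure (Sum.inl i)) := by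
    intro i k hk
    rw [edgeMeasure_eq_restrict_edgeClosed]
    have hfin : IsFiniteMeasure (volume.restrict (G.edgeClosed (Sum.inl i))) :=
      ⟨by simp [edgeClosed]⟩
    obtain ⟨C, hC⟩ := isCompact_Icc.exists_bound_of_continuousOn
      (hk.continuousOn (s := Icc 0 (G.length i)))
    exact MemLp.of_bound hk.aestronglyMeasurable C
      ((ae_restrict_iff' measurableSet_Icc).2 (Eventually.of_forall hC))
  have h0 : ∀ e, MemLp (q e) 2 (G.edgeMeasure e) := by
    rintro (i | y)
    · exact hbdd i _ (hq (Sum.inl i)).continuous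
    · exact hexp.const_mul _
  have h1 : ∀ e, MemLp (deriv (q e)) 2 (G.edgeMeasure e) := by
    rintro (i | y)
    · exact hbdd i _ ((hq (Sum.inl i)).continuous_deriv (by simp))
    · have : deriv (q (Sum.inr y)) = fun x => (-a (Sum.inl (Sum.inr y))) *
          ((Real.exp (-x) : ℝ) : ℂ) := by
        funext x
        have h := (((Real.hasDerivAt_exp (-x)).comp x (hasDerivAt_neg x)).ofReal_comp).const_mul
          (a (Sum.inl (Sum.inr y)))
        rw [show q (Sum.inr y) = fun x => a (Sum.inl (Sum.inr y)) * ((Real.exp (-x) : ℝ) : ℂ)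
          from rfl]
        refine h.deriv.trans ?_
        push_cast; ring
      rw [this]
      exact hexp.const_mul _
  obtain ⟨p, -, -, hp⟩ := exists_sobolev_of_contDiff (G := G)
    (fun e => (hq e).of_le (by exact_mod_cast le_top)) h0 h1
  refine ⟨p, funext fun h => ?_⟩
  rw [hp]
  rcases h with (i | y) | i
  · simp [q, endEdge, endPoint]
  · simp [q, endEdge, endPoint]
  · have : (G.length i : ℂ) ≠ 0 := by exact_mod_cast (G.length_pos i).ne'
    simp only [q, endEdge, endPoint]
    field_simp
    ring

variable [Fintype I] [Fintype X]

lemma norm_fst_le (p : WithLp 2 (G.L2 × G.L2)) : ‖p.fst‖ ≤ ‖p‖ := WithLp.norm_fst_le _ p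

lemma norm_snd_le (p : WithLp 2 (G.L2 × G.L2)) : ‖p.snd‖ ≤ ‖p‖ := WithLp.norm_snd_le _ p

variable (G) in
/-- The trace inequality, with a small constant in front of the derivative. -/
lemma eventually_norm_le : ∀ᶠ d in 𝓝[>] (0 : ℝ), ∀ p : G.sobolev,
    (∀ e, ∀ᵐ x ∂(G.edgeMeasure e), ‖p.1.fst e x‖ ≤ (√d)⁻¹ * ‖p.1.fst‖ + √d * ‖p.1.snd‖) ∧
    ∀ h, ‖trace p h‖ ≤ (√d)⁻¹ * ‖p.1.fst‖ + √d * ‖p.1.snd‖ := by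
  filter_upwards [eventually_exists_interval G, self_mem_nhdsWithin] with d hd hd0 p
  obtain ⟨c, hc⟩ := exists_primitive p
  have key : ∀ e, ∀ x ∈ G.edgeClosed e,
      ‖primitive (c e) (p.1.snd e) x‖ ≤ (√d)⁻¹ * ‖p.1.fst‖ + √d * ‖p.1.snd‖ := by
    intro e x hx
    obtain ⟨α, hα, hJ⟩ := hd e x hx
    refine (norm_primitive_le (hc e) hd0 hα hJ).trans ?_
    gcongr
    · exact PiLp.norm_apply_le p.1.fst e
    · exact PiLp.norm_apply_le p.1.snd e
  refine ⟨fun e => ?_, fun h => ?_⟩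
  · have hmem : ∀ᵐ x ∂(G.edgeMeasure e), x ∈ G.edgeClosed e := by
      rw [edgeMeasure_eq_restrict_edgeClosed]
      refine ae_restrict_mem ?_
      cases e
      · exact measurableSet_Icc
      · exact measurableSet_Ici
    filter_upwards [hc e, hmem] with x hx hxe
    rw [hx]; exact key e x hxe
  · rw [trace_eq (hasTraces_primitive hc)]
    exact key _ _ (endPoint_mem_edgeClosed h)

variable (G) in
lemma exists_norm_le : ∃ C : ℝ, 0 < C ∧ ∀ p : G.sobolev,
    (∀ e, ∀ᵐ x ∂(G.edgeMeasure e), ‖p.1.fst e x‖ ≤ C * ‖p‖) ∧ ∀ h, ‖trace p h‖ ≤ C * ‖p‖ := by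
  obtain ⟨d, hd, hd0⟩ := ((eventually_norm_le G).and self_mem_nhdsWithin).exists
  have hd0 : 0 < √d := Real.sqrt_pos.2 hd0
  refine ⟨(√d)⁻¹ + √d, by positivity, fun p => ?_⟩
  have hle : (√d)⁻¹ * ‖p.1.fst‖ + √d * ‖p.1.snd‖ ≤ ((√d)⁻¹ + √d) * ‖p‖ := by
    rw [add_mul]
    gcongr
    · exact norm_fst_le p.1
    · exact norm_snd_le p.1
  exact ⟨fun e => ((hd p).1 e).mono fun x hx => hx.trans hle, fun h => ((hd p).2 h).trans hle⟩

/-- The boundary values as a bounded operator. -/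
noncomputable def traceL : G.sobolev →L[ℂ] ((I ⊕ X) ⊕ I → ℂ) :=
  LinearMap.mkContinuousOfExistsBound ⟨⟨trace, trace_add⟩, trace_smul⟩ (by
    obtain ⟨C, hC, h⟩ := exists_norm_le G
    exact ⟨C, fun p => (pi_norm_le_iff_of_nonneg (by positivity)).2 (h p).2⟩)

/-- Integration by parts on the graph. -/
lemma inner_add_inner_eq_neg_sum (p q : G.sobolev) :
    ⟪p.1.snd, q.1.fst⟫_ℂ + ⟪p.1.fst, q.1.snd⟫_ℂ
      = -∑ h, (starRingEnd ℂ) (endSign h * trace p h) * trace q h := by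
  obtain ⟨c, hc⟩ := exists_primitive p
  obtain ⟨d, hd⟩ := exists_primitive q
  rw [trace_eq (hasTraces_primitive hc), trace_eq (hasTraces_primitive hd), PiLp.inner_apply,
    PiLp.inner_apply, ← Finset.sum_add_distrib,
    Finset.sum_congr rfl fun e _ => inner_add_inner_eq_edgeBoundary (hc e) (hd e),
    Fintype.sum_sum_type, Fintype.sum_sum_type, Fintype.sum_sum_type]
  simp only [edgeBoundary, endSign, endEdge, endPoint, Finset.sum_sub_distrib,
    Finset.sum_neg_distrib, map_neg, neg_mul, one_mul]
  ring

end MetricGraph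

/-! ### Uniqueness of groups with a given generator, and the group of a coercive form. -/

section FormGroup

variable {H : Type*} [NormedAddCommGroup H] [InnerProductSpace ℂ H]

/-- A group of isometries moves along its generator. -/
lemma hasDerivAt_group {U : ℝ → H →L[ℂ] H} (hadd : ∀ s t, U (s + t) = U s ∘L U t)
    {f h : H} (hf : Tendsto (fun t : ℝ => (t : ℂ)⁻¹ • (U t f - f)) (𝓝[≠] 0) (𝓝 h)) (t : ℝ) :
    HasDerivAt (fun s => U s f) (U t h) t := by
  rw [hasDerivAt_iff_tendsto_slope_zero]
  refine (((U t).continuous.tendsto h).comp hf).congr fun s => ?_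
  simp only [Function.comp, map_smul, map_sub]
  rw [hadd t s, ← Complex.ofReal_inv, Complex.coe_smul]
  rfl

lemma tendsto_slope_group {U : ℝ → H →L[ℂ] H} (hadd : ∀ s t, U (s + t) = U s ∘L U t)
    {f h : H} (hf : Tendsto (fun t : ℝ => (t : ℂ)⁻¹ • (U t f - f)) (𝓝[≠] 0) (𝓝 h)) (s : ℝ) :
    Tendsto (fun t : ℝ => (t : ℂ)⁻¹ • (U t (U s f) - U s f)) (𝓝[≠] 0) (𝓝 (U s h)) := by
  refine (((U s).continuous.tendsto h).comp hf).congr fun t => ?_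
  simp only [Function.comp, map_smul, map_sub]
  have h1 : U s (U t f) = U t (U s f) := by
    rw [← ContinuousLinearMap.comp_apply, ← hadd, add_comm, hadd]; rfl
  rw [h1]

/-- The generator of a group of isometries is skew-symmetric. -/
lemma re_inner_slope_eq_zero {U : ℝ → H →L[ℂ] H} (h0 : U 0 = 1)
    (hadd : ∀ s t, U (s + t) = U s ∘L U t) (hn : ∀ t f, ‖U t f‖ = ‖f‖) {f h : H}
    (hf : Tendsto (fun t : ℝ => (t : ℂ)⁻¹ • (U t f - f)) (𝓝[≠] 0) (𝓝 h)) :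
    RCLike.re ⟪f, h⟫_ℂ = 0 := by
  let _ : InnerProductSpace ℝ H := InnerProductSpace.rclikeToReal ℂ H
  have h1 := (hasDerivAt_group hadd hf 0).norm_sq
  simp only [h0, hn, one_apply_eq_self] at h1
  have h2 := h1.unique (hasDerivAt_const (0 : ℝ) (‖f‖ ^ 2))
  rw [real_inner_eq_re_inner ℂ] at h2
  linarith

/-- A group of isometries is determined by its generator. -/
theorem group_eq_of_generator_eq {U U' : ℝ → H →L[ℂ] H} (h0 : U 0 = 1)
    (hadd : ∀ s t, U (s + t) = U s ∘L U t) (hn : ∀ t f, ‖U t f‖ = ‖f‖) (h0' : U' 0 = 1)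
    (hadd' : ∀ s t, U' (s + t) = U' s ∘L U' t)
    (hgen : ∀ f h, Tendsto (fun t : ℝ => (t : ℂ)⁻¹ • (U t f - f)) (𝓝[≠] 0) (𝓝 h) ↔
      Tendsto (fun t : ℝ => (t : ℂ)⁻¹ • (U' t f - f)) (𝓝[≠] 0) (𝓝 h))
    (hdense : Dense {f | ∃ h, Tendsto (fun t : ℝ => (t : ℂ)⁻¹ • (U t f - f)) (𝓝[≠] 0) (𝓝 h)}) :
    U = U' := by
  funext t
  ext f
  refine hdense.induction (P := fun f => U t f = U' t f) (fun f hf => ?_)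
    (isClosed_eq (by fun_prop) (by fun_prop)) f
  obtain ⟨h, hf⟩ := hf
  let _ : InnerProductSpace ℝ H := InnerProductSpace.rclikeToReal ℂ H
  have hf' := (hgen f h).1 hf
  -- Both orbits stay in the common domain of the generator, so the velocity of their difference is
  -- the generator applied to it, and skew-symmetry makes the distance constant.
  have h1 : ∀ s, HasDerivAt (fun s => ‖U s f - U' s f‖ ^ 2) 0 s := by
    intro s
    have h2 := ((hasDerivAt_group hadd hf s).sub (hasDerivAt_group hadd' hf' s)).norm_sq
    have h3 := (tendsto_slope_group hadd hf s).sub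
      ((hgen _ _).2 (tendsto_slope_group hadd' hf' s))
    have h4 := re_inner_slope_eq_zero (f := U s f - U' s f) (h := U s h - U' s h) h0 hadd hn
      (h3.congr fun t => by rw [← smul_sub, map_sub]; congr 1; abel)
    convert! h2 using 1
    simp only [Pi.sub_apply]
    rw [real_inner_eq_re_inner ℂ, h4, mul_zero]
  have h2 := is_const_of_deriv_eq_zero (fun s => (h1 s).differentiableAt)
    (fun s => (h1 s).deriv) t 0
  simp only [h0, h0', sub_self, norm_zero, ne_eq, OfNat.ofNat_ne_zero, not_false_eq_true,
    zero_pow, pow_eq_zero_iff, norm_eq_zero] at h2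
  exact sub_eq_zero.1 h2

variable [CompleteSpace H] {E : Type*} [NormedAddCommGroup E] [InnerProductSpace ℂ E]
  [CompleteSpace E] {ι : Type*} [Fintype ι] {W : ι → Type*} [∀ i, NormedAddCommGroup (W i)]
  [∀ i, InnerProductSpace ℂ (W i)] [∀ i, CompleteSpace (W i)]

/-- The operator on `E` that represents the form `M ⟨J f, J g⟩ + ⟨D f, D g⟩ + ∑ i, ⟨L τ f, τ g⟩`. -/
noncomputable def formOperator (J D : E →L[ℂ] H) (τ : ∀ i, E →L[ℂ] W i)
    (L : ∀ i, W i →L[ℂ] W i) (M : ℝ) : E →L[ℂ] E :=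
  (M : ℂ) • (J.adjoint ∘L J) + D.adjoint ∘L D + ∑ i, (τ i).adjoint ∘L L i ∘L τ i

variable {J D : E →L[ℂ] H} {τ : ∀ i, E →L[ℂ] W i} {L : ∀ i, W i →L[ℂ] W i} {M c : ℝ}

lemma inner_formOperator (f g : E) :
    ⟪formOperator J D τ L M f, g⟫_ℂ = M * ⟪J f, J g⟫_ℂ + ⟪D f, D g⟫_ℂ
      + ∑ i, ⟪L i (τ i f), τ i g⟫_ℂ := by
  simp only [formOperator, add_apply, smul_apply, sum_apply, inner_add_left, inner_smul_left,
    sum_inner, ContinuousLinearMap.comp_apply, ContinuousLinearMap.adjoint_inner_left,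
    Complex.conj_ofReal]

lemma isSelfAdjoint_formOperator (hL : ∀ i, IsSelfAdjoint (L i)) :
    IsSelfAdjoint (formOperator J D τ L M) := by
  rw [ContinuousLinearMap.isSelfAdjoint_iff_isSymmetric]
  intro f g
  change ⟪formOperator J D τ L M f, g⟫_ℂ = ⟪f, formOperator J D τ L M g⟫_ℂ
  rw [← inner_conj_symm f, inner_formOperator, inner_formOperator]
  simp only [map_add, map_mul, map_sum, inner_conj_symm, Complex.conj_ofReal]
  congr 1
  refine Finset.sum_congr rfl fun i _ => ?_
  rw [← ContinuousLinearMap.adjoint_inner_right, ContinuousLinearMap.isSelfAdjoint_iff'.1 (hL i)]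

lemma re_inner_formOperator_self (f : E) :
    RCLike.re ⟪formOperator J D τ L M f, f⟫_ℂ = M * ‖J f‖ ^ 2 + ‖D f‖ ^ 2
      + ∑ i, (⟪L i (τ i f), τ i f⟫_ℂ).re := by
  rw [inner_formOperator, inner_self_eq_norm_sq_to_K, inner_self_eq_norm_sq_to_K]
  simp only [RCLike.re_to_complex, Complex.add_re, Complex.re_sum, Complex.re_ofReal_mul,
    Complex.coe_algebraMap, ← Complex.ofReal_pow, Complex.ofReal_re]

/-- The unitary group of a form that is coercive up to a multiple of the norm of the ambient
Hilbert space, its generator, and its restriction to the form domain. -/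
theorem exists_unitaryGroup_of_form (hL : ∀ i, IsSelfAdjoint (L i)) (hJ : Function.Injective J)
    (hJd : DenseRange J) (hc : 0 < c)
    (hcoer : ∀ f, c * ‖f‖ ^ 2 ≤ M * ‖J f‖ ^ 2 + ‖D f‖ ^ 2 + ∑ i, (⟪L i (τ i f), τ i f⟫_ℂ).re) :
    ∃ (U : ℝ → H →L[ℂ] H) (V : ℝ → E →L[ℂ] E) (C : ℝ),
      U 0 = 1 ∧ (∀ s t, U (s + t) = U s ∘L U t) ∧ (∀ t f, ‖U t f‖ = ‖f‖) ∧
      (∀ f, Continuous fun t => U t f) ∧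
      (∀ f h, Tendsto (fun t : ℝ => (t : ℂ)⁻¹ • (U t f - f)) (𝓝[≠] 0) (𝓝 h) ↔
        ∃ (w : E) (y : H), J w = f ∧ (∀ g, M * ⟪J w, J g⟫_ℂ + ⟪D w, D g⟫_ℂ
          + ∑ i, ⟪L i (τ i w), τ i g⟫_ℂ = ⟪y, J g⟫_ℂ) ∧ h = Complex.I • ((M : ℂ) • f - y)) ∧
      Dense {f | ∃ h, Tendsto (fun t : ℝ => (t : ℂ)⁻¹ • (U t f - f)) (𝓝[≠] 0) (𝓝 h)} ∧
      (∀ t x, J (V t x) = U t (J x)) ∧ (∀ t x, ‖V t x‖ ≤ C * ‖x‖) ∧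
      ∀ x, Continuous fun t => V t x := by
  set S := formOperator J D τ L M with hSdef
  have hS : IsSelfAdjoint S := isSelfAdjoint_formOperator hL
  have hcoer' : ∀ f, c * ‖f‖ ^ 2 ≤ RCLike.re ⟪S f, f⟫_ℂ := fun f => by
    rw [re_inner_formOperator_self]; exact hcoer f
  -- The Lax-Milgram argument: a coercive bounded operator is invertible.
  have hunit : IsUnit S := by
    refine ContinuousLinearMap.isUnit_of_forall_le_norm_inner_map S (c := ⟨c, hc.le⟩) hc fun f => ?_
    refine le_trans (le_of_eq ?_) ((hcoer' f).trans (RCLike.re_le_norm _))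
    rw [mul_comm]; rfl
  obtain ⟨R, hSR, hRS⟩ := isUnit_iff_exists.1 hunit
  set K := formInverse J R with hKdef
  have hK : IsSelfAdjoint K := isSelfAdjoint_formInverse hS hSR
  have hinj : Function.Injective K := injective_formInverse hSR hJd hc hcoer'
  obtain ⟨V, C, hV1, hV2, hV3⟩ := exists_group_on_formDomain hS hSR hRS hJ hJd hc hcoer' M
  refine ⟨expInverse K M, V, C, expInverse_zero hK hinj M, expInverse_add hK hinj M,
    norm_expInverse hK hinj M, continuous_expInverse hK hinj M, fun f h => ?_, ?_, hV1, hV2, hV3⟩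
  · rw [tendsto_expInverse_slope_iff hK hinj]
    constructor
    · rintro ⟨y, rfl, rfl⟩
      refine ⟨R (J.adjoint y), y, rfl, fun g => ?_, rfl⟩
      rw [← inner_formOperator, ← ContinuousLinearMap.adjoint_inner_left]
      congr 1
      exact DFunLike.congr_fun hSR _
    · rintro ⟨w, y, rfl, hw, rfl⟩
      refine ⟨y, ?_, rfl⟩
      -- The weak equation says `S w = J* y`, so `f = J w` is `K y`, and the generator of the
      -- abstract group applies.
      have h1 : S w = J.adjoint y := ext_inner_right ℂ fun g => by
        rw [ContinuousLinearMap.adjoint_inner_left, ← hw g, hSdef, inner_formOperator]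
      change J w = J (R (J.adjoint y))
      rw [← h1]
      congr 1
      exact (DFunLike.congr_fun hRS w).symm
  · refine (hK.denseRange_of_injective hinj).mono ?_
    rintro _ ⟨y, rfl⟩
    exact ⟨_, (tendsto_expInverse_slope_iff hK hinj M _ _).2 ⟨y, rfl, rfl⟩⟩

end FormGroup

/-! ### The form domain and the Laplacian -/

namespace QuantumGraph

open MetricGraph

variable {V I X : Type*} [Fintype V] [Fintype I] [Fintype X] [DecidableEq V] [DecidableEq I]
  [DecidableEq X] {G : QuantumGraph V I X}

section Vertex

omit [DecidableEq I] [DecidableEq X]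

/-- The values at the edge ends attached to a vertex, as a bounded operator. -/
noncomputable def atVertexL (G : QuantumGraph V I X) (v : V) :
    ((I ⊕ X) ⊕ I → ℂ) →L[ℂ] EuclideanSpace ℂ (G.Star v) :=
  LinearMap.toContinuousLinearMap ⟨⟨G.atVertex v, fun _ _ => rfl⟩, fun _ _ => rfl⟩

lemma sum_inner_atVertex (a b : (I ⊕ X) ⊕ I → ℂ) :
    ∑ v, ⟪G.atVertex v a, G.atVertex v b⟫_ℂ = ∑ h, (starRingEnd ℂ) (a h) * b h := by
  rw [← Finset.sum_fiberwise Finset.univ G.endVertex]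
  refine Finset.sum_congr rfl fun v _ => ?_
  rw [PiLp.inner_apply, Finset.sum_subtype (p := fun h => G.endVertex h = v) _ (fun h => by simp)]
  refine Finset.sum_congr rfl fun h _ => ?_
  rw [RCLike.inner_apply, mul_comm]
  rfl

lemma exists_atVertex_eq (v : V) (b : EuclideanSpace ℂ (G.Star v)) :
    ∃ a, G.atVertex v a = b ∧ ∀ w, w ≠ v → G.atVertex w a = 0 := by
  refine ⟨fun h => if hv : G.endVertex h = v then b ⟨h, hv⟩ else 0, ?_, fun w hw => ?_⟩
  · ext ⟨h, hh⟩
    simp [MetricGraph.atVertex, hh]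
  · ext ⟨h, hh⟩
    have : G.endVertex h ≠ v := by rw [hh]; exact hw
    simp [MetricGraph.atVertex, this]

end Vertex

lemma mem_energyDomain_iff {p : WithLp 2 (G.L2 × G.L2)} :
    p ∈ G.energyDomain ↔
      ∃ hp : p ∈ G.sobolev, ∀ v, G.projD v (G.atVertex v (trace ⟨p, hp⟩)) = 0 := by
  constructor
  · rintro ⟨hp, a, ha, hD⟩
    refine ⟨hp, ?_⟩
    rwa [trace_eq (p := ⟨p, hp⟩) ha]
  · rintro ⟨hp, hD⟩
    exact ⟨hp, _, hasTraces_trace ⟨p, hp⟩, hD⟩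

lemma energyDomain_le_sobolev : G.energyDomain ≤ G.sobolev := fun _ hp => hp.1

/-- The inclusion of the form domain in the Sobolev space. -/
noncomputable def toSobolev : G.EnergyDomain →L[ℂ] G.sobolev :=
  ⟨Submodule.inclusion energyDomain_le_sobolev, by
    exact continuous_subtype_val.subtype_mk _⟩

lemma isClosed_energyDomain : IsClosed (G.energyDomain : Set (WithLp 2 (G.L2 × G.L2))) := by
  have h1 : IsClosed {p : G.sobolev | ∀ v, G.projD v (G.atVertexL v (traceL p)) = 0} := by
    simp only [Set.ofPred_forall]
    exact isClosed_iInter fun v => isClosed_eq (by fun_prop) continuous_const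
  have h2 := G.isClosed_sobolev.isClosedEmbedding_subtypeVal.isClosedMap _ h1
  convert! h2 using 1
  ext p
  simp only [SetLike.mem_coe, mem_energyDomain_iff, mem_image, Subtype.exists, exists_and_right,
    exists_eq_right]
  rfl

instance : CompleteSpace G.EnergyDomain := isClosed_energyDomain.completeSpace_coe

/-- The inclusion of the form domain in `L²(Γ)` as a bounded operator. -/
noncomputable def toL2L (G : QuantumGraph V I X) : G.EnergyDomain →L[ℂ] G.L2 :=
  (WithLp.fstL 2 ℂ G.L2 G.L2) ∘L G.energyDomain.subtypeL

/-- The derivative on the form domain as a bounded operator. -/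
noncomputable def derivL (G : QuantumGraph V I X) : G.EnergyDomain →L[ℂ] G.L2 :=
  (WithLp.sndL 2 ℂ G.L2 G.L2) ∘L G.energyDomain.subtypeL

lemma toL2L_apply (f : G.EnergyDomain) : G.toL2L f = f.toL2 := rfl

lemma derivL_apply (f : G.EnergyDomain) : G.derivL f = f.deriv := rfl

lemma norm_sq_eq (f : G.EnergyDomain) : ‖f‖ ^ 2 = ‖f.toL2‖ ^ 2 + ‖f.deriv‖ ^ 2 :=
  WithLp.prod_norm_sq_eq_of_L2 f.1

lemma toL2L_injective : Function.Injective (G.toL2L) := by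
  intro f g h
  refine Subtype.ext ((WithLp.equiv 2 _).injective (Prod.ext h ?_))
  refine PiLp.ext fun e => (f.2.1 e).unique ?_
  have h1 : f.1.fst = g.1.fst := h
  rw [h1]
  exact g.2.1 e

/-- The boundary values of an element of the form domain at the vertex `v`. -/
noncomputable def vertexTrace (G : QuantumGraph V I X) (v : V) :
    G.EnergyDomain →L[ℂ] EuclideanSpace ℂ (G.Star v) :=
  G.atVertexL v ∘L traceL ∘L toSobolev

lemma vertexTrace_eq {f : G.EnergyDomain} {a : (I ⊕ X) ⊕ I → ℂ} (ha : G.HasTraces f.toL2 a)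
    (v : V) : G.vertexTrace v f = G.atVertex v a := by
  rw [← trace_eq (p := toSobolev f) ha]; rfl

lemma projD_vertexTrace (v : V) (f : G.EnergyDomain) : G.projD v (G.vertexTrace v f) = 0 :=
  (mem_energyDomain_iff.1 f.2).2 v

/-- Test functions on an edge are in the form domain. -/
lemma exists_energyDomain_test (e : I ⊕ X) {φ : ℝ → ℝ} (hφ : ContDiff ℝ (⊤ : ℕ∞) φ)
    (hc : HasCompactSupport φ) (hs : tsupport φ ⊆ G.edgeInterior e) :
    ∃ f : G.EnergyDomain, (∀ k : G.L2,
      ⟪f.toL2, k⟫_ℂ = ∫ x, φ x • k e x ∂(G.edgeMeasure e)) ∧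
      (∀ k : G.L2, ⟪f.deriv, k⟫_ℂ = ∫ x, deriv φ x • k e x ∂(G.edgeMeasure e)) ∧
      ∀ v, G.vertexTrace v f = 0 := by
  classical
  let q : I ⊕ X → ℝ → ℂ := fun e' => if e' = e then fun x => (φ x : ℂ) else 0
  have hqe : q e = fun x => (φ x : ℂ) := by simp [q]
  have hqe' : ∀ e', e' ≠ e → q e' = 0 := fun e' h => by simp [q, h]
  have hd : deriv (q e) = fun x => ((deriv φ x : ℝ) : ℂ) := by
    rw [hqe]
    funext x
    exact (hφ.differentiable (by simp) x).hasDerivAt.ofReal_comp.deriv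
  have hdc : Continuous (deriv φ) := hφ.continuous_deriv (by simp)
  have hq : ∀ e', ContDiff ℝ 1 (q e') := by
    intro e'
    by_cases h : e' = e
    · rw [h, hqe]
      exact Complex.ofRealCLM.contDiff.comp (hφ.of_le (by exact_mod_cast le_top))
    · rw [hqe' e' h]; exact contDiff_const
  have hmem : ∀ (ψ : ℝ → ℝ), Continuous ψ → HasCompactSupport ψ →
      MemLp (fun x => (ψ x : ℂ)) 2 (G.edgeMeasure e) := fun ψ hψ hψc =>
    ((Complex.continuous_ofReal.comp hψ).memLp_of_hasCompactSupport (p := 2) (μ := volume)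
      (hψc.comp_left Complex.ofReal_zero)).restrict _
  have h0 : ∀ e', MemLp (q e') 2 (G.edgeMeasure e') := by
    intro e'
    by_cases h : e' = e
    · subst h; rw [hqe]; exact hmem φ hφ.continuous hc
    · rw [hqe' e' h]; exact MemLp.zero
  have h1 : ∀ e', MemLp (deriv (q e')) 2 (G.edgeMeasure e') := by
    intro e'
    by_cases h : e' = e
    · subst h; rw [hd]; exact hmem _ hdc hc.deriv
    · rw [hqe' e' h, deriv_zero]; exact MemLp.zero
  obtain ⟨p, hp0, hp1, hpt⟩ := exists_sobolev_of_contDiff hq h0 h1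
  have htr : trace p = 0 := by
    funext h
    rw [hpt]
    by_cases he : endEdge h = e
    · have : φ (G.endPoint h) = 0 := image_eq_zero_of_notMem_tsupport fun h' =>
        G.endPoint_notMem_edgeInterior h (he ▸ hs h')
      simp only [he, hqe, this, Complex.ofReal_zero, Pi.zero_apply]
    · rw [hqe' _ he]; rfl
  have hpE : p.1 ∈ G.energyDomain := mem_energyDomain_iff.2 ⟨p.2, fun v => by
    rw [show (⟨p.1, p.2⟩ : G.sobolev) = p from rfl, htr]
    exact map_zero _⟩
  have hinner : ∀ (r : I ⊕ X → ℝ → ℂ) (hr : ∀ e', MemLp (r e') 2 (G.edgeMeasure e'))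
      (ψ : ℝ → ℝ), (r e = fun x => (ψ x : ℂ)) → (∀ e', e' ≠ e → r e' = 0) → ∀ k : G.L2,
      ⟪(WithLp.toLp 2 (fun e' => (hr e').toLp) : G.L2), k⟫_ℂ
        = ∫ x, ψ x • k e x ∂(G.edgeMeasure e) := by
    intro r hr ψ hψ hr0 k
    rw [PiLp.inner_apply, Finset.sum_eq_single e]
    · rw [L2.inner_def]
      refine integral_congr_ae ?_
      filter_upwards [(hr e).coeFn_toLp] with x hx
      rw [hx, hψ, RCLike.inner_apply, Complex.conj_ofReal, mul_comm, Complex.real_smul]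
    · intro e' _ he'
      have : (hr e').toLp = 0 := by
        rw [Lp.eq_zero_iff_ae_eq_zero]
        filter_upwards [(hr e').coeFn_toLp] with x hx
        rw [hx, hr0 e' he']
      change ⟪(hr e').toLp, k e'⟫_ℂ = 0
      rw [this, inner_zero_left]
    · simp
  refine ⟨⟨p.1, hpE⟩, fun k => ?_, fun k => ?_, fun v => ?_⟩
  · change ⟪p.1.fst, k⟫_ℂ = _
    rw [hp0]
    exact hinner q h0 φ hqe hqe' k
  · change ⟪p.1.snd, k⟫_ℂ = _
    rw [hp1]
    exact hinner (fun e' => deriv (q e')) h1 (deriv φ) hd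
      (fun e' h => by rw [hqe' e' h, deriv_zero]) k
  · rw [vertexTrace_eq (f := ⟨p.1, hpE⟩) (hasTraces_trace p), htr]
    exact map_zero (G.atVertexL v)

/-- Test functions on the edges are in the form domain, and a function orthogonal to all of them
vanishes. -/
lemma toL2L_denseRange : DenseRange (G.toL2L) := by
  have h1 : (LinearMap.range (G.toL2L).toLinearMap)ᗮ = ⊥ := by
    rw [Submodule.eq_bot_iff]
    intro k hk
    refine PiLp.ext fun e => ?_
    rw [PiLp.zero_apply, Lp.eq_zero_iff_ae_eq_zero]
    have h2 := (isOpen_edgeInterior (G := G.toMetricGraph)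
      e).ae_eq_zero_of_integral_contDiff_smul_eq_zero (μ := volume)
      ((locallyIntegrable_zeroExt (k e)).locallyIntegrableOn _) (fun φ hφ hφc hφs => ?_)
    · filter_upwards [ae_edgeMeasure_iff.2 h2, coe_ae_eq_zeroExt (k e)] with x hx h3
      rw [h3, hx]; rfl
    · obtain ⟨f, hf, -, -⟩ := exists_energyDomain_test e hφ hφc hφs
      rw [← integral_smul_edgeMeasure (fun x hx => image_eq_zero_of_notMem_tsupport
        fun h => hx (hφs h)) (coe_ae_eq_zeroExt (k e)), ← hf]
      exact (Submodule.mem_orthogonal _ _).1 hk _ ⟨f, rfl⟩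
  have h2 := (Submodule.topologicalClosure_eq_top_iff).2 h1
  exact (Submodule.dense_iff_topologicalClosure_eq_top).2 h2

/-- Boundary values at a vertex that satisfy the Dirichlet condition occur in the form domain. -/
lemma exists_vertexTrace_eq (v : V) {b : EuclideanSpace ℂ (G.Star v)} (hb : G.projD v b = 0) :
    ∃ f : G.EnergyDomain, G.vertexTrace v f = b ∧ ∀ w, w ≠ v → G.vertexTrace w f = 0 := by
  obtain ⟨a, hav, haw⟩ := exists_atVertex_eq v b
  obtain ⟨p, rfl⟩ := exists_trace_eq (G := G.toMetricGraph) a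
  have hpE : p.1 ∈ G.energyDomain := mem_energyDomain_iff.2 ⟨p.2, fun w => by
    rw [show (⟨p.1, p.2⟩ : G.sobolev) = p from rfl]
    by_cases hw : w = v
    · subst hw; rw [hav, hb]
    · rw [haw w hw, map_zero]⟩
  have h := vertexTrace_eq (f := ⟨p.1, hpE⟩) (hasTraces_trace p)
  exact ⟨⟨p.1, hpE⟩, by rw [h, hav], fun w hw => by rw [h, haw w hw]⟩

end QuantumGraph

/-! ### The Schrödinger group -/

namespace QuantumGraph

open MetricGraph

variable {V I X : Type*} [Fintype V] [Fintype I] [Fintype X] [DecidableEq V] [DecidableEq I]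
  [DecidableEq X] {G : QuantumGraph V I X}
  {L : ∀ v, EuclideanSpace ℂ (G.Star v) →L[ℂ] EuclideanSpace ℂ (G.Star v)} {M : ℝ}

/-- The Robin projectors can be dropped because `L v` is unchanged by composition with them on
either side. -/
lemma energy_eq (hL : ∀ v, G.IsRobinOperator v (L v)) {f : G.EnergyDomain}
    {a : (I ⊕ X) ⊕ I → ℂ} (ha : G.HasTraces f.toL2 a) :
    G.energy L f.deriv a = ‖f.deriv‖ ^ 2
      + ∑ v, (⟪L v (G.vertexTrace v f), G.vertexTrace v f⟫_ℂ).re := by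
  have h1 : ∀ v, ⟪L v (G.projR v (G.atVertex v a)), G.projR v (G.atVertex v a)⟫_ℂ
      = ⟪L v (G.vertexTrace v f), G.vertexTrace v f⟫_ℂ := fun v => by
    rw [vertexTrace_eq ha, ← inner_projR_left, (hL v).apply_projR, (hL v).projR_apply]
  simp only [energy, h1]

/-- The form is coercive up to a multiple of the norm of `L²(Γ)`. -/
lemma exists_coercive
    (L : ∀ v, EuclideanSpace ℂ (G.Star v) →L[ℂ] EuclideanSpace ℂ (G.Star v)) :
    ∃ M > (0 : ℝ), ∀ f : G.EnergyDomain,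
      1 / 2 * ‖f‖ ^ 2 ≤ M * ‖f.toL2‖ ^ 2 + ‖f.deriv‖ ^ 2
        + ∑ v, (⟪L v (G.vertexTrace v f), G.vertexTrace v f⟫_ℂ).re := by
  set Λ := ∑ v, ‖L v‖ with hΛ
  set N := (Fintype.card ((I ⊕ X) ⊕ I) : ℝ) with hN
  have hΛ0 : 0 ≤ Λ := Finset.sum_nonneg fun _ _ => norm_nonneg _
  -- With such a `d`, the vertex terms consume at most half of `‖f'‖²`; the price is a multiple of
  -- `‖f‖²` of order `d⁻¹`.
  have hev : ∀ᶠ d in 𝓝[>] (0 : ℝ), Λ * N * 2 * d < 1 / 2 := by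
    have h1 : Continuous fun d : ℝ => Λ * N * 2 * d := by fun_prop
    have h2 := h1.tendsto 0
    rw [mul_zero] at h2
    exact (h2.mono_left nhdsWithin_le_nhds).eventually_lt_const (by norm_num)
  obtain ⟨d, ⟨hd, hd1⟩, hd0⟩ := (((eventually_norm_le G.toMetricGraph).and hev).and
    self_mem_nhdsWithin).exists
  have hd0 : (0 : ℝ) < d := hd0
  have htrace : ∀ v (f : G.EnergyDomain),
      ‖G.vertexTrace v f‖ ^ 2 ≤ N * (2 * d⁻¹ * ‖f.toL2‖ ^ 2 + 2 * d * ‖f.deriv‖ ^ 2) := by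
    intro v f
    have h2 : ∀ h, ‖trace (toSobolev f) h‖ ^ 2
        ≤ 2 * d⁻¹ * ‖f.toL2‖ ^ 2 + 2 * d * ‖f.deriv‖ ^ 2 := by
      intro h
      have h3 : ‖trace (toSobolev f) h‖ ≤ (√d)⁻¹ * ‖f.toL2‖ + √d * ‖f.deriv‖ :=
        (hd (toSobolev f)).2 h
      have h4 := pow_le_pow_left₀ (norm_nonneg _) h3 2
      have h5 : ((√d)⁻¹) ^ 2 = d⁻¹ := by rw [inv_pow, Real.sq_sqrt hd0.le]
      have h6 : (√d) ^ 2 = d := Real.sq_sqrt hd0.le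
      calc _ ≤ _ := h4
        _ ≤ 2 * ((√d)⁻¹) ^ 2 * ‖f.toL2‖ ^ 2 + 2 * (√d) ^ 2 * ‖f.deriv‖ ^ 2 := by
            nlinarith [sq_nonneg ((√d)⁻¹ * ‖f.toL2‖ - √d * ‖f.deriv‖)]
        _ = _ := by rw [h5, h6]
    have h3 : 0 ≤ 2 * d⁻¹ * ‖f.toL2‖ ^ 2 + 2 * d * ‖f.deriv‖ ^ 2 := by positivity
    rw [EuclideanSpace.norm_sq_eq]
    calc _ ≤ ∑ _h : G.Star v, (2 * d⁻¹ * ‖f.toL2‖ ^ 2 + 2 * d * ‖f.deriv‖ ^ 2) :=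
          Finset.sum_le_sum fun h _ => h2 h.1
      _ = (Fintype.card (G.Star v)) * (2 * d⁻¹ * ‖f.toL2‖ ^ 2 + 2 * d * ‖f.deriv‖ ^ 2) := by
          rw [Finset.sum_const, Finset.card_univ, nsmul_eq_mul]
      _ ≤ _ := by
          gcongr
          rw [hN]
          exact_mod_cast Fintype.card_subtype_le (fun h => G.endVertex h = v)
  -- The second summand pays for the `L²` part of the trace inequality, and the `1` remains for
  -- coercivity.
  refine ⟨1 + Λ * N * (2 * d⁻¹), by positivity, fun f => ?_⟩
  rw [norm_sq_eq]
  set A := ‖f.toL2‖ ^ 2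
  set B := ‖f.deriv‖ ^ 2
  have hB : 0 ≤ B := by positivity
  have hA : 0 ≤ A := by positivity
  have hsum : -(Λ * (N * (2 * d⁻¹ * A + 2 * d * B)))
      ≤ ∑ v, (⟪L v (G.vertexTrace v f), G.vertexTrace v f⟫_ℂ).re := by
    rw [hΛ, Finset.sum_mul, ← Finset.sum_neg_distrib]
    refine Finset.sum_le_sum fun v _ => ?_
    have h1 : ‖⟪L v (G.vertexTrace v f), G.vertexTrace v f⟫_ℂ‖
        ≤ ‖L v‖ * (N * (2 * d⁻¹ * A + 2 * d * B)) :=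
      calc _ ≤ ‖L v (G.vertexTrace v f)‖ * ‖G.vertexTrace v f‖ := norm_inner_le_norm _ _
        _ ≤ ‖L v‖ * ‖G.vertexTrace v f‖ * ‖G.vertexTrace v f‖ := by
            gcongr; exact (L v).le_opNorm _
        _ = ‖L v‖ * ‖G.vertexTrace v f‖ ^ 2 := by ring
        _ ≤ _ := by gcongr; exact htrace v f
    have h2 := neg_le_of_abs_le ((Complex.abs_re_le_norm _).trans h1)
    exact h2
  nlinarith [mul_le_mul_of_nonneg_right hd1.le hB]

lemma exists_form_le (L : ∀ v, EuclideanSpace ℂ (G.Star v) →L[ℂ] EuclideanSpace ℂ (G.Star v))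
    (hM : 0 ≤ M) : ∃ C > (0 : ℝ), ∀ f : G.EnergyDomain,
      M * ‖f.toL2‖ ^ 2 + ‖f.deriv‖ ^ 2
        + ∑ v, (⟪L v (G.vertexTrace v f), G.vertexTrace v f⟫_ℂ).re ≤ C * ‖f‖ ^ 2 := by
  refine ⟨M + 1 + ∑ v, ‖L v‖ * ‖G.vertexTrace v‖ ^ 2, by positivity, fun f => ?_⟩
  have h1 : ∑ v, (⟪L v (G.vertexTrace v f), G.vertexTrace v f⟫_ℂ).re
      ≤ (∑ v, ‖L v‖ * ‖G.vertexTrace v‖ ^ 2) * ‖f‖ ^ 2 := by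
    rw [Finset.sum_mul]
    refine Finset.sum_le_sum fun v _ => ?_
    calc (⟪L v (G.vertexTrace v f), G.vertexTrace v f⟫_ℂ).re
        ≤ ‖L v (G.vertexTrace v f)‖ * ‖G.vertexTrace v f‖ :=
          re_inner_le_norm (𝕜 := ℂ) (L v (G.vertexTrace v f)) (G.vertexTrace v f)
      _ ≤ ‖L v‖ * ‖G.vertexTrace v f‖ * ‖G.vertexTrace v f‖ := by
          gcongr; exact (L v).le_opNorm _
      _ = ‖L v‖ * ‖G.vertexTrace v f‖ ^ 2 := by ring
      _ ≤ ‖L v‖ * (‖G.vertexTrace v‖ * ‖f‖) ^ 2 := by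
          gcongr; exact (G.vertexTrace v).le_opNorm f
      _ = _ := by ring
  have h2 : ‖f‖ ^ 2 = ‖f.toL2‖ ^ 2 + ‖f.deriv‖ ^ 2 := norm_sq_eq f
  have h3 : 0 ≤ ‖f.toL2‖ ^ 2 := by positivity
  have h4 : 0 ≤ M * ‖f.deriv‖ ^ 2 := by positivity
  nlinarith

/-- Integration by parts against an element of the form domain. -/
lemma inner_add_inner_deriv {w : G.EnergyDomain} {k : G.L2} {b : (I ⊕ X) ⊕ I → ℂ}
    (hk : ∀ e, G.IsWeakDeriv e (w.deriv e) (k e)) (hb : G.HasTraces w.deriv b)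
    (g : G.EnergyDomain) :
    ⟪k, g.toL2⟫_ℂ + ⟪w.deriv, g.deriv⟫_ℂ
      = -∑ v, ⟪G.atVertex v (fun h => endSign h * b h), G.vertexTrace v g⟫_ℂ := by
  let p : G.sobolev := ⟨WithLp.toLp 2 (w.deriv, k), hk⟩
  have h1 := inner_add_inner_eq_neg_sum p (toSobolev g)
  rw [trace_eq (p := p) hb] at h1
  have h2 := sum_inner_atVertex (G := G) (fun h => endSign h * b h) (trace (toSobolev g))
  rw [← h2] at h1
  exact h1

/-- The operator associated with the form is the Laplacian. -/
lemma form_eq_iff_isLaplacian (hL : ∀ v, G.IsRobinOperator v (L v)) (f y : G.L2) :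
    (∃ w : G.EnergyDomain, G.toL2L w = f ∧ ∀ g : G.EnergyDomain,
      M * ⟪G.toL2L w, G.toL2L g⟫_ℂ + ⟪G.derivL w, G.derivL g⟫_ℂ
        + ∑ v, ⟪L v (G.vertexTrace v w), G.vertexTrace v g⟫_ℂ = ⟪y, G.toL2L g⟫_ℂ) ↔
      G.IsLaplacian f ((M : ℂ) • f - y) := by
  have hsub : ∀ g : G.L2, ⟪(M : ℂ) • f - y, g⟫_ℂ = M * ⟪f, g⟫_ℂ - ⟪y, g⟫_ℂ := fun g => by
    rw [inner_sub_left, inner_smul_left, Complex.conj_ofReal]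
  constructor
  · rintro ⟨w, rfl, hw⟩
    simp only [toL2L_apply, derivL_apply] at hw hsub ⊢
    -- Test functions supported inside an edge have no boundary terms, so the weak equation
    -- identifies the second derivative.
    have hk : ∀ e, G.IsWeakDeriv e (w.deriv e) (((M : ℂ) • w.toL2 - y) e) := by
      intro e φ hφ hc hs
      obtain ⟨t, ht0, ht1, htv⟩ := exists_energyDomain_test (G := G) e hφ hc hs
      have h1 := hw t
      simp only [htv, inner_zero_right, Finset.sum_const_zero, add_zero] at h1
      have h2 := congrArg (starRingEnd ℂ) h1
      simp only [map_add, map_mul, inner_conj_symm, Complex.conj_ofReal] at h2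
      rw [← ht1, ← ht0, inner_sub_right, inner_smul_right, ← h2]
      ring
    obtain ⟨b, hb⟩ := exists_hasTraces (⟨WithLp.toLp 2 (w.deriv, (M : ℂ) • w.toL2 - y), hk⟩ :
      G.sobolev)
    refine ⟨w.deriv, w.2.1, hk, trace (toSobolev w), b, hasTraces_trace (toSobolev w), hb,
      fun v => ?_⟩
    have htr : G.atVertex v (trace (toSobolev w)) = G.vertexTrace v w := rfl
    rw [htr, (hL v).coupling_iff (projD_vertexTrace v w)]
    intro c hc
    -- Testing with a function whose trace is `c` at `v` and zero at all other vertices isolates the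
    -- boundary term at `v`.
    obtain ⟨g, hgv, hgw⟩ := exists_vertexTrace_eq v hc
    have h1 := inner_add_inner_deriv hk hb g
    have h2 := hw g
    rw [Finset.sum_eq_single v (fun u _ hu => by rw [hgw u hu, inner_zero_right]) (by simp),
      hgv] at h1 h2
    rw [hsub] at h1
    linear_combination h1 - h2
  · rintro ⟨g', hg', hk, a, b, ha, hb, hv⟩
    let w : G.EnergyDomain := ⟨WithLp.toLp 2 (f, g'), hg', a, ha,
      fun v => G.projD_eq_zero_of_coupling v (hv v)⟩
    refine ⟨w, rfl, fun g => ?_⟩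
    have h1 := inner_add_inner_deriv (w := w) hk hb g
    -- The coupling condition replaces the normal derivatives by `L` of the traces when paired with
    -- admissible traces.
    have h2 : ∀ v, ⟪G.atVertex v (fun h => endSign h * b h), G.vertexTrace v g⟫_ℂ
        = ⟪L v (G.vertexTrace v w), G.vertexTrace v g⟫_ℂ := fun v => by
      have h3 := hv v
      rw [← vertexTrace_eq (f := w) ha v, (hL v).coupling_iff (projD_vertexTrace v w)] at h3
      exact h3 _ (projD_vertexTrace v g)
    simp only [h2] at h1
    rw [hsub] at h1
    simp only [toL2L_apply, derivL_apply]
    change M * ⟪f, g.toL2⟫_ℂ + _ + _ = _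
    linear_combination h1

lemma exists_schrodingerGroup (G : QuantumGraph V I X) :
    ∃ U, G.IsSchrodingerGroup U ∧
      Dense {f | ∃ h, Tendsto (fun t : ℝ => (t : ℂ)⁻¹ • (U t f - f)) (𝓝[≠] 0) (𝓝 h)} ∧
      ∃ (W : ℝ → G.EnergyDomain →L[ℂ] G.EnergyDomain) (C : ℝ),
        (∀ t x, G.toL2L (W t x) = U t (G.toL2L x)) ∧ (∀ t x, ‖W t x‖ ≤ C * ‖x‖) ∧
        ∀ x, Continuous fun t => W t x := by
  choose L hL using fun v => G.exists_isRobinOperator v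
  obtain ⟨M, -, hM⟩ := exists_coercive L
  have hsa : ∀ v, IsSelfAdjoint (L v) := fun v => (hL v).isSelfAdjoint
  have key :=
    exists_unitaryGroup_of_form (E := G.EnergyDomain) (H := G.L2) (ι := V)
      (W := fun v => EuclideanSpace ℂ (G.Star v)) (J := G.toL2L) (D := G.derivL) (τ := G.vertexTrace) (L := L) (M := M) (c := 1 / 2) hsa
      toL2L_injective toL2L_denseRange (by norm_num) hM
  obtain ⟨U, W, C, h0, hadd, hn, hcont, hgen, hd, hW1, hW2, hW3⟩ := key
  refine ⟨U, ⟨h0, hadd, hn, hcont, fun f h => ?_⟩, hd, W, C, hW1, hW2, hW3⟩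
  rw [hgen]
  constructor
  · rintro ⟨w, y, rfl, hw, rfl⟩
    exact ⟨_, (form_eq_iff_isLaplacian hL _ _).1 ⟨w, rfl, hw⟩, rfl⟩
  · rintro ⟨k, hk, rfl⟩
    have hk' : (M : ℂ) • f - ((M : ℂ) • f - k) = k := sub_sub_cancel _ _
    obtain ⟨w, hwf, hw⟩ := (form_eq_iff_isLaplacian hL f ((M : ℂ) • f - k)).2 (by rwa [hk'])
    exact ⟨w, _, hwf, hw, by rw [hk']⟩

theorem isSchrodingerGroup_schrodingerGroup (G : QuantumGraph V I X) :
    G.IsSchrodingerGroup G.schrodingerGroup :=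
  Classical.epsilon_spec (let ⟨U, hU, _⟩ := G.exists_schrodingerGroup; ⟨U, hU⟩)

/-- The Schrödinger group restricts to a bounded strongly continuous group on the form domain. -/
theorem exists_group_on_energyDomain (G : QuantumGraph V I X) :
    ∃ (W : ℝ → G.EnergyDomain →L[ℂ] G.EnergyDomain) (C : ℝ),
      (∀ t x, G.toL2L (W t x) = G.schrodingerGroup t (G.toL2L x)) ∧
      (∀ t x, ‖W t x‖ ≤ C * ‖x‖) ∧ ∀ x, Continuous fun t => W t x := by
  obtain ⟨U, hU, hd, h⟩ := G.exists_schrodingerGroup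
  have hS := G.isSchrodingerGroup_schrodingerGroup
  -- The chosen group is known only through its generator, so it has to be identified with the
  -- constructed one by uniqueness.
  rwa [group_eq_of_generator_eq hU.zero hU.add hU.norm_map hS.zero hS.add
    (fun f h => by rw [hU.generator, hS.generator]) hd] at h

/-- The form norm is equivalent to the Sobolev norm. -/
theorem exists_energy_equiv (G : QuantumGraph V I X) :
    ∃ L : ∀ v, EuclideanSpace ℂ (G.Star v) →L[ℂ] EuclideanSpace ℂ (G.Star v),
      (∀ v, G.IsRobinOperator v (L v)) ∧
      ∃ M > (0 : ℝ), ∃ c > (0 : ℝ), ∃ C > (0 : ℝ), ∀ (f : G.EnergyDomain) (a : (I ⊕ X) ⊕ I → ℂ),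
        G.HasTraces f.toL2 a →
          c * ‖f‖ ^ 2 ≤ M * ‖f.toL2‖ ^ 2 + G.energy L f.deriv a ∧
          M * ‖f.toL2‖ ^ 2 + G.energy L f.deriv a ≤ C * ‖f‖ ^ 2 := by
  choose L hL using fun v => G.exists_isRobinOperator v
  obtain ⟨M, hM0, hM⟩ := exists_coercive L
  obtain ⟨C, hC0, hC⟩ := exists_form_le L hM0.le
  refine ⟨L, hL, M, hM0, 1 / 2, by norm_num, C, hC0, fun f a ha => ?_⟩
  rw [energy_eq hL ha, ← add_assoc]
  exact ⟨hM f, hC f⟩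

end QuantumGraph

/-! ### The truncated nonlinearity -/

section Nonlinearity

/-- A Lipschitz function of the radius that vanishes at the origin, times a quadratic function of
the direction, is Lipschitz. -/
lemma lipschitzWith_radial_smul {E W : Type*} [NormedAddCommGroup E] [NormedSpace ℝ E]
    [NormedAddCommGroup W] [NormedSpace ℝ W] {K : ℝ≥0} {φ : ℝ → ℝ} (hφ : LipschitzWith K φ)
    (hφ0 : φ 0 = 0) {B : E → W} (hB : ∀ y, ‖B y‖ ≤ ‖y‖ ^ 2)
    (hBs : ∀ y y', ‖B y - B y'‖ ≤ (‖y‖ + ‖y'‖) * ‖y - y'‖) :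
    LipschitzWith (5 * K) fun z => φ ‖z‖ • B (‖z‖⁻¹ • z) := by
  have hb : ∀ r, |φ r| ≤ K * |r| := fun r => by
    simpa [hφ0, Real.norm_eq_abs] using hφ.norm_sub_le r 0
  have hu : ∀ z : E, ‖‖z‖⁻¹ • z‖ ≤ 1 := fun z => by
    rw [norm_smul, norm_inv, norm_norm]
    exact inv_mul_le_one
  refine LipschitzWith.of_dist_le_mul fun z z' => ?_
  rw [dist_eq_norm, dist_eq_norm]
  have hK := K.2
  set y := ‖z‖⁻¹ • z
  set y' := ‖z'‖⁻¹ • z'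
  have h1 : φ ‖z‖ • B y - φ ‖z'‖ • B y' = φ ‖z‖ • (B y - B y') + (φ ‖z‖ - φ ‖z'‖) • B y' := by
    module
  have h2 : ‖(φ ‖z‖ - φ ‖z'‖) • B y'‖ ≤ K * ‖z - z'‖ := by
    rw [norm_smul]
    have h3 := hφ.norm_sub_le ‖z‖ ‖z'‖
    have h4 := abs_norm_sub_norm_le z z'
    have h5 : ‖B y'‖ ≤ 1 := (hB y').trans (pow_le_one₀ (norm_nonneg _) (hu z'))
    calc _ ≤ K * ‖‖z‖ - ‖z'‖‖ * 1 := by gcongr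
      _ ≤ K * ‖z - z'‖ * 1 := by gcongr; exact h4
      _ = _ := mul_one _
  -- The direction is not Lipschitz near the origin, but it becomes so after multiplication by the
  -- radius, which `|φ(r)| ≤ K |r|` provides. This accounts for `4 K` of the constant, the radial
  -- difference for the remaining `K`.
  have h6 : ‖z‖ * ‖y - y'‖ ≤ 2 * ‖z - z'‖ := by
    have e1 : ‖z‖ • (y - y') = (z - z') + (‖z'‖ - ‖z‖) • y' := by
      have e2 : ∀ x : E, ‖x‖ • (‖x‖⁻¹ • x) = x := fun x => by
        rcases eq_or_ne x 0 with rfl | hx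
        · simp
        · exact smul_inv_smul₀ (norm_ne_zero_iff.2 hx) x
      have h7 := e2 z
      have h8 := e2 z'
      rw [smul_sub, sub_smul, h7, h8]
      abel
    rw [← norm_norm z, ← norm_smul, e1]
    refine (norm_add_le _ _).trans ?_
    rw [norm_smul]
    have h7 : ‖‖z'‖ - ‖z‖‖ ≤ ‖z - z'‖ := by
      rw [norm_sub_rev z]; exact abs_norm_sub_norm_le z' z
    have h8 := mul_le_mul h7 (hu z') (norm_nonneg _) (norm_nonneg _)
    linarith
  have h9 : ‖φ ‖z‖ • (B y - B y')‖ ≤ 4 * K * ‖z - z'‖ := by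
    rw [norm_smul]
    calc _ ≤ (K * ‖z‖) * (2 * ‖y - y'‖) := by
          have := hb ‖z‖
          rw [abs_norm] at this
          gcongr
          · exact this
          · exact (hBs y y').trans (by gcongr; linarith [hu z, hu z'])
      _ = 2 * K * (‖z‖ * ‖y - y'‖) := by ring
      _ ≤ 2 * K * (2 * ‖z - z'‖) := by gcongr
      _ = _ := by ring
  rw [h1]
  push_cast
  linarith [norm_add_le (φ ‖z‖ • (B y - B y')) ((φ ‖z‖ - φ ‖z'‖) • B y')]

/-- The rank one operator `w ↦ ⟨z, w⟩ z`. -/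
noncomputable def rankOneSelf (z : ℂ) : ℂ →L[ℝ] ℂ := (innerSL ℝ z).smulRight z

lemma norm_rankOneSelf_le (z : ℂ) : ‖rankOneSelf z‖ ≤ ‖z‖ ^ 2 := by
  rw [rankOneSelf, ContinuousLinearMap.norm_smulRight_apply, innerSL_apply_norm, sq]

lemma norm_rankOneSelf_sub_le (z w : ℂ) :
    ‖rankOneSelf z - rankOneSelf w‖ ≤ (‖z‖ + ‖w‖) * ‖z - w‖ := by
  have h1 : rankOneSelf z - rankOneSelf w
      = (innerSL ℝ z).smulRight (z - w) + (innerSL ℝ (z - w)).smulRight w := by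
    ext1 x
    simp only [rankOneSelf, sub_apply, add_apply, ContinuousLinearMap.smulRight_apply, map_sub,
      innerSL_apply_apply]
    module
  rw [h1]
  refine (norm_add_le _ _).trans (le_of_eq ?_)
  rw [ContinuousLinearMap.norm_smulRight_apply, ContinuousLinearMap.norm_smulRight_apply,
    innerSL_apply_norm, innerSL_apply_norm]
  ring

/-- Truncated powers are Lipschitz and bounded. -/
lemma exists_lipschitzWith_rpow_mul {p R : ℝ} (hp : 1 ≤ p) (hR : 0 < R) {η : ℝ → ℝ}
    (hη : ContDiff ℝ 1 η) (hc : HasCompactSupport η) :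
    ∃ K : ℝ≥0, LipschitzWith K (fun r : ℝ => r ^ p * η (r ^ 2 / R)) ∧
      ∀ r : ℝ, |r ^ p * η (r ^ 2 / R)| ≤ K := by
  have h1 : ContDiff ℝ 1 (fun r : ℝ => r ^ p * η (r ^ 2 / R)) :=
    (Real.contDiff_rpow_const_of_le (n := 1) (by exact_mod_cast hp)).mul
      (hη.comp (by fun_prop))
  have h2 : HasCompactSupport (fun r : ℝ => η (r ^ 2 / R)) := by
    obtain ⟨C, hC⟩ := hc.isBounded.exists_norm_le
    refine HasCompactSupport.of_support_subset_isCompact (isCompact_Icc (a := -√(C * R))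
      (b := √(C * R))) fun r hr => ?_
    have h3 : ‖r ^ 2 / R‖ ≤ C := hC _ (subset_tsupport _ hr)
    rw [Real.norm_eq_abs, abs_of_nonneg (by positivity), div_le_iff₀ hR] at h3
    exact abs_le.1 (Real.abs_le_sqrt h3)
  have h3 : HasCompactSupport (fun r : ℝ => r ^ p * η (r ^ 2 / R)) := h2.mul_left
  obtain ⟨K, hK⟩ := h1.lipschitzWith_of_hasCompactSupport h3 (by simp)
  obtain ⟨C, hC⟩ := h3.exists_bound_of_continuous h1.continuous
  refine ⟨max K C.toNNReal, hK.weaken (le_max_left _ _), fun r => (hC r).trans ?_⟩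
  push_cast
  exact (le_max_left _ _).trans (le_max_right _ _)

/-- With the derivative written in terms of `z / |z|`, its coefficients are truncated powers of
exponent at least `2σ ≥ 1`, hence Lipschitz, and all non-smoothness is in the direction. The formula
includes `z = 0`, where both coefficients vanish. -/
lemma hasFDerivAt_truncatedNonlinearity {σ R : ℝ} (hσ : 1 / 2 ≤ σ) (hR : 0 < R) {θ : ℝ → ℝ}
    (hθ : ContDiff ℝ 2 θ) (hθc : HasCompactSupport θ) (z : ℂ) :
    HasFDerivAt (truncatedNonlinearity σ R θ)
      ((‖z‖ ^ (2 * σ) * θ (‖z‖ ^ 2 / R)) • ContinuousLinearMap.id ℝ ℂ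
        + (2 * σ * (‖z‖ ^ (2 * σ) * θ (‖z‖ ^ 2 / R))
          + 2 / R * (‖z‖ ^ (2 * σ + 2) * deriv θ (‖z‖ ^ 2 / R))) • rankOneSelf (‖z‖⁻¹ • z)) z := by
  have hFeq : ∀ w : ℂ, truncatedNonlinearity σ R θ w
      = (‖w‖ ^ (2 * σ) * θ (‖w‖ ^ 2 / R)) • w := fun w => by
    rw [truncatedNonlinearity, Complex.real_smul]; push_cast; ring
  have hp : ∀ w : ℂ, ‖w‖ ^ (2 * σ) = (‖w‖ ^ 2) ^ σ := fun w => by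
    rw [Real.rpow_mul (norm_nonneg w), Real.rpow_two]
  rcases eq_or_ne z 0 with rfl | hz
  · obtain ⟨K, hK, -⟩ := exists_lipschitzWith_rpow_mul (p := 2 * σ) (by linarith) hR
      (hθ.of_le (by norm_num)) hθc
    have h0 : (0 : ℝ) ^ (2 * σ) = 0 := Real.zero_rpow (by linarith)
    have h0' : (0 : ℝ) ^ (2 * σ + 2) = 0 := Real.zero_rpow (by linarith)
    simp only [norm_zero, h0, h0', zero_mul, mul_zero, add_zero]
    have hz : ∀ A : ℂ →L[ℝ] ℂ, (0 : ℝ) • A = 0 := fun A => by ext1 w; simp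
    rw [hz, hz, add_zero, hasFDerivAt_iff_isLittleO_nhds_zero]
    -- The scalar factor is Lipschitz in the radius and vanishes at `0`, so the function is of
    -- second order at the origin.
    have h1 : (fun h : ℂ => truncatedNonlinearity σ R θ (0 + h) - truncatedNonlinearity σ R θ 0
        - (0 : ℂ →L[ℝ] ℂ) h) =O[𝓝 0] fun h => ‖h‖ ^ 2 := by
      refine Asymptotics.IsBigO.of_bound K (Eventually.of_forall fun h => ?_)
      have h2 := hK.norm_sub_le ‖h‖ 0
      simp only [h0, zero_mul, sub_zero, norm_norm] at h2
      rw [zero_add, hFeq, hFeq 0, smul_zero, sub_zero, zero_apply, sub_zero, norm_smul, norm_pow,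
        norm_norm]
      nlinarith [norm_nonneg h]
    exact h1.trans_isLittleO (Asymptotics.isLittleO_norm_pow_id one_lt_two)
  · have hz0 : 0 < ‖z‖ := norm_pos_iff.2 hz
    have hs : ‖z‖ ^ 2 ≠ 0 := by positivity
    have h1 : HasDerivAt (fun s : ℝ => s ^ σ * θ (s / R))
        (σ * (‖z‖ ^ 2) ^ (σ - 1) * θ (‖z‖ ^ 2 / R)
          + (‖z‖ ^ 2) ^ σ * (deriv θ (‖z‖ ^ 2 / R) * (1 / R))) (‖z‖ ^ 2) := by
      refine HasDerivAt.mul (Real.hasDerivAt_rpow_const (Or.inl hs)) ?_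
      exact ((hθ.differentiable (by norm_num) _).hasDerivAt).comp _
        ((hasDerivAt_id _).div_const R)
    have h2 : HasFDerivAt (fun w : ℂ => ‖w‖ ^ 2) (2 • innerSL ℝ z) z :=
      (hasStrictFDerivAt_norm_sq z).hasFDerivAt
    have h3 := (h1.comp_hasFDerivAt z h2).smul (hasFDerivAt_id z)
    have h4 : truncatedNonlinearity σ R θ = fun w => (((fun s : ℝ => s ^ σ * θ (s / R)) ∘
        fun w : ℂ => ‖w‖ ^ 2) w) • id w := by
      funext w; rw [hFeq, hp]; rfl
    rw [h4]
    convert! h3 using 1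
    ext1 w
    have e1 : (‖z‖ ^ 2) ^ (σ - 1) = ‖z‖ ^ (2 * σ) * (‖z‖⁻¹ * ‖z‖⁻¹) := by
      rw [hp, Real.rpow_sub_one hs, div_eq_mul_inv, sq, mul_inv]
    have e2 : ‖z‖ ^ (2 * σ + 2) * (‖z‖⁻¹ * ‖z‖⁻¹) = ‖z‖ ^ (2 * σ) := by
      rw [Real.rpow_add hz0, Real.rpow_two]; field_simp
    simp only [rankOneSelf, add_apply, smul_apply, ContinuousLinearMap.smulRight_apply,
      innerSL_apply_apply, ContinuousLinearMap.id_apply, Function.comp, real_inner_smul_left, ← hp,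
      id, e1]
    rw [← e2]
    simp only [Complex.real_smul, smul_eq_mul, nsmul_eq_mul]
    push_cast
    ring

/-- The truncated nonlinearity has a bounded and Lipschitz derivative. -/
theorem exists_truncatedNonlinearity_lipschitz {σ R : ℝ} (hσ : 1 / 2 ≤ σ) (hR : 0 < R)
    {θ : ℝ → ℝ} (hθ : ContDiff ℝ 2 θ) (hθc : HasCompactSupport θ) :
    ∃ K : ℝ≥0, Differentiable ℝ (truncatedNonlinearity σ R θ) ∧
      LipschitzWith K (truncatedNonlinearity σ R θ) ∧
      LipschitzWith K (fderiv ℝ (truncatedNonlinearity σ R θ)) := by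
  have hd := hasFDerivAt_truncatedNonlinearity hσ hR hθ hθc
  obtain ⟨K₁, hK₁, hb₁⟩ := exists_lipschitzWith_rpow_mul (p := 2 * σ) (by linarith) hR
    (hθ.of_le (by norm_num)) hθc
  obtain ⟨K₂, hK₂, hb₂⟩ := exists_lipschitzWith_rpow_mul (p := 2 * σ + 2) (by linarith) hR
    (hθ.deriv' (n := 1)) hθc.deriv
  set g₁ : ℝ → ℝ := fun r => r ^ (2 * σ) * θ (r ^ 2 / R) with hg₁
  set g₂ : ℝ → ℝ := fun r => r ^ (2 * σ + 2) * deriv θ (r ^ 2 / R) with hg₂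
  set φ : ℝ → ℝ := fun r => 2 * σ * g₁ r + 2 / R * g₂ r with hφdef
  set c : ℝ≥0 := ‖2 * σ‖₊ * K₁ + ‖2 / R‖₊ * K₂ with hc
  have hφ : LipschitzWith c φ :=
    ((lipschitzWith_smul (2 * σ)).comp hK₁).add ((lipschitzWith_smul (2 / R)).comp hK₂)
  have hφ0 : φ 0 = 0 := by
    simp only [hφdef, hg₁, hg₂, Real.zero_rpow (show 2 * σ ≠ 0 by linarith),
      Real.zero_rpow (show 2 * σ + 2 ≠ 0 by linarith), zero_mul, mul_zero, add_zero]
  have hφb : ∀ r, ‖φ r‖ ≤ c := fun r => by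
    refine (norm_add_le _ _).trans ?_
    rw [norm_mul, norm_mul (2 / R), hc]
    exact add_le_add (mul_le_mul_of_nonneg_left (hb₁ r) (norm_nonneg _))
      (mul_le_mul_of_nonneg_left (hb₂ r) (norm_nonneg _))
  have hfd : fderiv ℝ (truncatedNonlinearity σ R θ) = fun z => g₁ ‖z‖ • ContinuousLinearMap.id ℝ ℂ
      + φ ‖z‖ • rankOneSelf (‖z‖⁻¹ • z) := funext fun z => (hd z).fderiv
  have hid : ‖ContinuousLinearMap.id ℝ ℂ‖ ≤ 1 := ContinuousLinearMap.norm_id_le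
  have hdiff : Differentiable ℝ (truncatedNonlinearity σ R θ) := fun z => (hd z).differentiableAt
  have h1 : LipschitzWith (K₁ + c) (truncatedNonlinearity σ R θ) := by
    refine lipschitzWith_of_nnnorm_fderiv_le hdiff fun z => ?_
    rw [hfd, ← NNReal.coe_le_coe, coe_nnnorm]
    refine (norm_add_le _ _).trans ?_
    rw [norm_smul, norm_smul, NNReal.coe_add]
    have hu : ‖‖z‖⁻¹ • z‖ ≤ 1 := by
      rw [norm_smul, norm_inv, norm_norm]
      exact inv_mul_le_one
    have h2 : ‖rankOneSelf (‖z‖⁻¹ • z)‖ ≤ 1 :=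
      (norm_rankOneSelf_le _).trans (pow_le_one₀ (norm_nonneg _) hu)
    have h3 := mul_le_mul (hb₁ ‖z‖) hid (norm_nonneg _) K₁.2
    have h4 := mul_le_mul (hφb ‖z‖) h2 (norm_nonneg _) c.2
    rw [mul_one] at h3 h4
    exact add_le_add h3 h4
  have h2 : LipschitzWith (K₁ + 5 * c) (fderiv ℝ (truncatedNonlinearity σ R θ)) := by
    rw [hfd]
    refine LipschitzWith.add (LipschitzWith.of_dist_le_mul fun z w => ?_)
      (lipschitzWith_radial_smul hφ hφ0 norm_rankOneSelf_le norm_rankOneSelf_sub_le)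
    rw [dist_eq_norm, dist_eq_norm, ← sub_smul, norm_smul]
    have h3 := hK₁.norm_sub_le ‖z‖ ‖w‖
    have h4 : ‖‖z‖ - ‖w‖‖ ≤ ‖z - w‖ := abs_norm_sub_norm_le z w
    have h5 := mul_le_mul (h3.trans (mul_le_mul_of_nonneg_left h4 K₁.2)) hid (norm_nonneg _)
      (by positivity)
    rwa [mul_one] at h5
  refine ⟨K₁ + 5 * c, hdiff, h1.weaken ?_, h2⟩
  gcongr
  exact le_mul_of_one_le_left' (by norm_num)

end Nonlinearity

/-! ### The superposition operator -/

lemma PiLp.norm_le_mul_norm_of_forall {ι : Type*} [Fintype ι] {E F : ι → Type*}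
    [∀ i, NormedAddCommGroup (E i)] [∀ i, NormedAddCommGroup (F i)] {C : ℝ} (hC : 0 ≤ C)
    {x : PiLp 2 E} {y : PiLp 2 F} (h : ∀ i, ‖x i‖ ≤ C * ‖y i‖) : ‖x‖ ≤ C * ‖y‖ := by
  refine (sq_le_sq₀ (norm_nonneg _) (by positivity)).1 ?_
  rw [mul_pow, PiLp.norm_sq_eq_of_L2, PiLp.norm_sq_eq_of_L2, Finset.mul_sum]
  refine Finset.sum_le_sum fun i _ => ?_
  rw [← mul_pow]
  exact pow_le_pow_left₀ (norm_nonneg _) (h i) 2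

namespace MetricGraph

variable {V I X : Type*} {G : MetricGraph V I X} {F : ℂ → ℂ} {K : ℝ≥0}

lemma superposition_ae_eq (hF : LipschitzWith K F) (hF0 : F 0 = 0) (u : G.L2) (e : I ⊕ X) :
    G.superposition F u e =ᵐ[G.edgeMeasure e] fun x => F (u e x) := by
  have h : MemLp (fun x => F (u e x)) 2 (G.edgeMeasure e) := hF.comp_memLp hF0 (Lp.memLp (u e))
  have h1 : G.superposition F u e = h.toLp := dif_pos h
  rw [h1]
  exact h.coeFn_toLp

lemma superposition_zero (hF : LipschitzWith K F) (hF0 : F 0 = 0) : G.superposition F 0 = 0 := by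
  refine PiLp.ext fun e => ?_
  rw [PiLp.zero_apply, Lp.eq_zero_iff_ae_eq_zero]
  filter_upwards [superposition_ae_eq hF hF0 (0 : G.L2) e, Lp.coeFn_zero ℂ 2 (G.edgeMeasure e)]
    with x hx h0
  rw [hx, PiLp.zero_apply, h0, Pi.zero_apply, hF0]

lemma lipschitzWith_superposition [Fintype I] [Fintype X] (hF : LipschitzWith K F)
    (hF0 : F 0 = 0) : LipschitzWith K (G.superposition F) := by
  refine LipschitzWith.of_dist_le_mul fun u w => ?_
  rw [dist_eq_norm, dist_eq_norm]
  refine PiLp.norm_le_mul_norm_of_forall K.2 fun e => ?_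
  rw [PiLp.sub_apply, PiLp.sub_apply]
  refine Lp.norm_le_mul_norm_of_ae_le_mul ?_
  filter_upwards [superposition_ae_eq hF hF0 u e, superposition_ae_eq hF hF0 w e,
    Lp.coeFn_sub (G.superposition F u e) (G.superposition F w e), Lp.coeFn_sub (u e) (w e)]
    with x h1 h2 h3 h4
  rw [h3, h4, Pi.sub_apply, Pi.sub_apply, h1, h2]
  exact hF.norm_sub_le _ _

lemma memLp_fderiv_apply (hF : LipschitzWith K F) (hF' : Continuous (fderiv ℝ F)) {e : I ⊕ X}
    (f g : Lp ℂ 2 (G.edgeMeasure e)) :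
    MemLp (fun x => fderiv ℝ F (f x) (g x)) 2 (G.edgeMeasure e) := by
  refine MemLp.of_le_mul (c := K) (Lp.memLp g) ?_ (Eventually.of_forall fun x => ?_)
  · exact isBoundedBilinearMap_apply.continuous.comp_aestronglyMeasurable
      ((hF'.comp_aestronglyMeasurable (Lp.aestronglyMeasurable f)).prodMk
        (Lp.aestronglyMeasurable g))
  · exact ((fderiv ℝ F (f x)).le_opNorm _).trans
      (mul_le_mul_of_nonneg_right (norm_fderiv_le_of_lipschitz ℝ hF) (norm_nonneg _))

/-- The chain rule for weak derivatives on an edge. -/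
lemma IsWeakDeriv.ae_eq_fderiv_apply (hF : LipschitzWith K F) (hFd : Differentiable ℝ F)
    (hF' : Continuous (fderiv ℝ F)) {e : I ⊕ X} {f g h k : Lp ℂ 2 (G.edgeMeasure e)}
    (hfg : G.IsWeakDeriv e f g) (hhk : G.IsWeakDeriv e h k)
    (hh : h =ᵐ[G.edgeMeasure e] fun x => F (f x)) :
    k =ᵐ[G.edgeMeasure e] fun x => fderiv ℝ F (f x) (g x) := by
  obtain ⟨c, hc⟩ := isWeakDeriv_iff.1 hfg
  have hm := memLp_fderiv_apply hF hF' f g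
  have h1 : G.IsWeakDeriv e h hm.toLp := by
    refine isWeakDeriv_iff.2 ⟨F c, ?_⟩
    filter_upwards [hh, hc] with x hx hx'
    rw [hx, hx', comp_primitive_eq hF hFd (locallyIntegrable_zeroExt g) (c := c)
      (p := primitive c g) (fun _ => rfl), primitive]
    congr 1
    · simp
    · refine intervalIntegral.integral_congr_ae ?_
      have h2 : ∀ᵐ t, t ∈ G.edgeInterior e →
          zeroExt hm.toLp t = fderiv ℝ F (primitive c g t) (zeroExt g t) := by
        refine ae_edgeMeasure_iff.1 ?_
        filter_upwards [coe_ae_eq_zeroExt hm.toLp, hm.coeFn_toLp, hc, coe_ae_eq_zeroExt g]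
          with t h3 h4 h5 h6
        rw [← h3, h4, h5, h6]
      filter_upwards [h2] with t ht _
      by_cases hte : t ∈ G.edgeInterior e
      · exact (ht hte).symm
      · simp only [zeroExt, indicator_of_notMem hte, map_zero]
  rw [hhk.unique h1]
  exact hm.coeFn_toLp

end MetricGraph

namespace QuantumGraph

open MetricGraph

variable {V I X : Type*} [Fintype V] [Fintype I] [Fintype X] [DecidableEq V] [DecidableEq I]
  [DecidableEq X] {G : QuantumGraph V I X} {F : ℂ → ℂ} {K : ℝ≥0}

lemma norm_le_add (f : G.EnergyDomain) : ‖f‖ ≤ ‖f.toL2‖ + ‖f.deriv‖ := by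
  refine (sq_le_sq₀ (norm_nonneg _) (by positivity)).1 ?_
  have h : ‖f‖ ^ 2 = ‖f.toL2‖ ^ 2 + ‖f.deriv‖ ^ 2 := norm_sq_eq f
  nlinarith [norm_nonneg f.toL2, norm_nonneg f.deriv]

lemma norm_toL2_le (f : G.EnergyDomain) : ‖f.toL2‖ ≤ ‖f‖ := norm_fst_le f.1

lemma norm_deriv_le (f : G.EnergyDomain) : ‖f.deriv‖ ≤ ‖f‖ := norm_snd_le f.1

/-- Elements of the form domain are bounded. -/
lemma exists_ae_norm_le (G : QuantumGraph V I X) : ∃ C : ℝ, 0 < C ∧ ∀ (f : G.EnergyDomain) (e),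
    ∀ᵐ x ∂(G.edgeMeasure e), ‖f.toL2 e x‖ ≤ C * ‖f‖ := by
  obtain ⟨C, hC, h⟩ := exists_norm_le G.toMetricGraph
  exact ⟨C, hC, fun f => (h (toSobolev f)).1⟩

/-- By the chain rule the difference of the derivatives is `F'(u)(u' - w') + (F'(u) - F'(w)) w'`. In
the second term `u - w` is estimated in the supremum norm, which is possible in one dimension and
produces the factor that grows with `w`. -/
lemma norm_deriv_superposition_sub_le (hF : LipschitzWith K F) (hFd : Differentiable ℝ F)
    (hF' : LipschitzWith K (fderiv ℝ F)) (hF0 : F 0 = 0) {C : ℝ} (hC : 0 < C)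
    (hbound : ∀ (f : G.EnergyDomain) (e), ∀ᵐ x ∂(G.edgeMeasure e), ‖f.toL2 e x‖ ≤ C * ‖f‖)
    {u w u' w' : G.EnergyDomain} (hu : u'.toL2 = G.superposition F u.toL2)
    (hw : w'.toL2 = G.superposition F w.toL2) :
    ‖u'.deriv - w'.deriv‖ ≤ K * ‖u.deriv - w.deriv‖ + K * (C * ‖u - w‖) * ‖w.deriv‖ := by
  have key : ∀ {u u' : G.EnergyDomain}, u'.toL2 = G.superposition F u.toL2 → ∀ e,
      u'.deriv e =ᵐ[G.edgeMeasure e] fun x => fderiv ℝ F (u.toL2 e x) (u.deriv e x) := by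
    intro u u' hu e
    refine (u.2.1 e).ae_eq_fderiv_apply hF hFd hF'.continuous (u'.2.1 e) ?_
    change u'.toL2 e =ᵐ[G.edgeMeasure e] _
    rw [hu]
    exact superposition_ae_eq hF hF0 u.toL2 e
  have hm := fun e => memLp_fderiv_apply hF hF'.continuous (u.toL2 e) (w.deriv e)
  let m : G.L2 := WithLp.toLp 2 fun e => (hm e).toLp
  have hme : ∀ e, m e =ᵐ[G.edgeMeasure e] fun x => fderiv ℝ F (u.toL2 e x) (w.deriv e x) :=
    fun e => (hm e).coeFn_toLp
  have h1 : ‖u'.deriv - m‖ ≤ K * ‖u.deriv - w.deriv‖ := by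
    refine PiLp.norm_le_mul_norm_of_forall K.2 fun e => ?_
    rw [PiLp.sub_apply, PiLp.sub_apply]
    refine Lp.norm_le_mul_norm_of_ae_le_mul ?_
    filter_upwards [key hu e, hme e, Lp.coeFn_sub (u'.deriv e) (m e),
      Lp.coeFn_sub (u.deriv e) (w.deriv e)] with x h1 h2 h3 h4
    rw [h3, h4, Pi.sub_apply, Pi.sub_apply, h1, h2, ← map_sub]
    exact (ContinuousLinearMap.le_opNorm _ _).trans
      (mul_le_mul_of_nonneg_right (norm_fderiv_le_of_lipschitz ℝ hF) (norm_nonneg _))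
  have h2 : ‖m - w'.deriv‖ ≤ K * (C * ‖u - w‖) * ‖w.deriv‖ := by
    refine PiLp.norm_le_mul_norm_of_forall (by positivity) fun e => ?_
    rw [PiLp.sub_apply]
    refine Lp.norm_le_mul_norm_of_ae_le_mul ?_
    filter_upwards [key hw e, hme e, Lp.coeFn_sub (m e) (w'.deriv e),
      Lp.coeFn_sub (u.toL2 e) (w.toL2 e), hbound (u - w) e] with x h1 h2 h3 h4 h5
    rw [h3, Pi.sub_apply, h1, h2, ← sub_apply]
    refine (ContinuousLinearMap.le_opNorm _ _).trans
      (mul_le_mul_of_nonneg_right ((hF'.norm_sub_le _ _).trans ?_) (norm_nonneg _))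
    refine mul_le_mul_of_nonneg_left ?_ K.2
    rw [← Pi.sub_apply, ← h4]
    exact h5
  calc _ = ‖(u'.deriv - m) + (m - w'.deriv)‖ := by rw [sub_add_sub_cancel]
    _ ≤ _ := (norm_add_le _ _).trans (add_le_add h1 h2)

/-- The superposition operator on the form domain. -/
theorem exists_superposition (hF : LipschitzWith K F) (hFd : Differentiable ℝ F)
    (hF' : LipschitzWith K (fderiv ℝ F)) (hF0 : F 0 = 0) (hstable : G.StableUnder F) :
    ∃ (N : G.EnergyDomain → G.EnergyDomain) (c : ℝ≥0),
      (∀ u, (N u).toL2 = G.superposition F u.toL2) ∧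
      (∀ u w, ‖N u - N w‖ ≤ c * (1 + ‖w‖) * ‖u - w‖) ∧ ∀ u, ‖N u‖ ≤ c * ‖u‖ := by
  choose N hN using hstable
  obtain ⟨C, hC, hbound⟩ := G.exists_ae_norm_le
  have h1 : ∀ u w, ‖N u - N w‖ ≤ (2 * K + K * C) * (1 + ‖w‖) * ‖u - w‖ := by
    intro u w
    have h2 : ‖(N u).toL2 - (N w).toL2‖ ≤ K * ‖u.toL2 - w.toL2‖ := by
      rw [hN, hN]
      exact (lipschitzWith_superposition hF hF0).norm_sub_le _ _
    have h3 := norm_deriv_superposition_sub_le hF hFd hF' hF0 hC hbound (hN u) (hN w)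
    have h4 : ‖u.toL2 - w.toL2‖ ≤ ‖u - w‖ := norm_toL2_le (u - w)
    have h5 : ‖u.deriv - w.deriv‖ ≤ ‖u - w‖ := norm_deriv_le (u - w)
    have h6 : ‖N u - N w‖ ≤ ‖(N u).toL2 - (N w).toL2‖ + ‖(N u).deriv - (N w).deriv‖ :=
      norm_le_add (N u - N w)
    calc ‖N u - N w‖ ≤ K * ‖u.toL2 - w.toL2‖
          + (K * ‖u.deriv - w.deriv‖ + K * (C * ‖u - w‖) * ‖w.deriv‖) :=
          h6.trans (add_le_add h2 h3)
      _ ≤ K * ‖u - w‖ + (K * ‖u - w‖ + K * (C * ‖u - w‖) * ‖w‖) := by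
          gcongr
          exact norm_deriv_le w
      _ ≤ K * ‖u - w‖ + (K * ‖u - w‖ + K * (C * ‖u - w‖) * ‖w‖)
          + (2 * K * ‖w‖ * ‖u - w‖ + K * C * ‖u - w‖) := le_add_of_nonneg_right (by positivity)
      _ = _ := by ring
  -- With `w = 0` the growing factor is `1`, so the local Lipschitz estimate becomes the linear
  -- growth bound.
  have h0 : N 0 = 0 := by
    refine toL2L_injective ?_
    rw [map_zero, toL2L_apply, hN]
    exact superposition_zero hF hF0
  refine ⟨N, 2 * K + K * ⟨C, hC.le⟩, hN, fun u w => by push_cast; exact h1 u w, fun u => ?_⟩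
  have h2 := h1 u 0
  rw [h0, sub_zero, sub_zero, norm_zero, add_zero, mul_one] at h2
  push_cast
  exact h2

end QuantumGraph

/-! ### The mild equation and the diffusion approximation -/

namespace QuantumGraph

open MetricGraph

variable {V I X : Type*} [Fintype V] [Fintype I] [Fintype X] [DecidableEq V] [DecidableEq I]
  [DecidableEq X]

/-- Well-posedness of the mild equation in the form domain, and continuity of its solution as a
function of the clock. -/
theorem exists_continuous_isMildSolution_iff (G : QuantumGraph V I X) {F : ℂ → ℂ} {K : ℝ≥0}
    (hF : LipschitzWith K F) (hFd : Differentiable ℝ F) (hF' : LipschitzWith K (fderiv ℝ F))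
    (hF0 : F 0 = 0) (hstable : G.StableUnder F) {T : ℝ} (hT : 0 < T) (u₀ : G.EnergyDomain) :
    ∃ Φ : C(Icc 0 T, ℝ) → C(Icc 0 T, G.EnergyDomain), Continuous Φ ∧
      ∀ (n : C(Icc 0 T, ℝ)) (w : C(Icc 0 T, G.L2)),
        G.IsMildSolution F hT n u₀.toL2 w ↔ ∀ t, w t = (Φ n t).toL2 := by
  obtain ⟨N, c, hN, hNl, hNb⟩ := exists_superposition hF hFd hF' hF0 hstable
  obtain ⟨W, C, hW, hWb, hWc⟩ := G.exists_group_on_energyDomain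
  have hS := G.isSchrodingerGroup_schrodingerGroup
  have hU : IsBoundedGroup G.schrodingerGroup 1 :=
    ⟨hS.zero, hS.add, fun t x => by rw [hS.norm_map, NNReal.coe_one, one_mul], hS.continuous⟩
  -- The group law is inherited from `L²`, since the inclusion is injective.
  have hV : IsBoundedGroup W C.toNNReal := by
    refine ⟨?_, fun s t => ?_, fun t x => ?_, hWc⟩
    · ext1 x
      refine toL2L_injective ?_
      rw [hW, hS.zero]
      rfl
    · ext1 x
      refine toL2L_injective ?_
      rw [hW, hS.add, ContinuousLinearMap.comp_apply, ContinuousLinearMap.comp_apply, hW, hW]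
    · exact (hWb t x).trans (mul_le_mul_of_nonneg_right (le_max_left _ _) (norm_nonneg _))
  have hsup : LipschitzWith K (G.superposition F) := lipschitzWith_superposition hF hF0
  have key := exists_continuous_isMild_iff (E := G.EnergyDomain) (H := G.L2) (J := G.toL2L) hV hU
    hW hNl hNb hsup hN hT u₀
  exact key

end QuantumGraph

theorem theorem2p12 {V I X : Type*} [Fintype V] [Fintype I] [Fintype X] [DecidableEq V] [DecidableEq I]
    [DecidableEq X] (G : QuantumGraph V I X)
    (σ R : ℝ) (hσ : 1 / 2 ≤ σ) (hR : 0 < R)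
    (θ : ℝ → ℝ) (hθ : ContDiff ℝ (⊤ : ℕ∞) θ) (hθc : HasCompactSupport θ)
    (hθ1 : ∀ x ∈ Icc (0 : ℝ) 1, θ x = 1) (hθ0 : ∀ x ∈ Ici (2 : ℝ), θ x = 0)
    (hH2 : G.StableUnder (truncatedNonlinearity σ R θ))
    {Ω Ω' : Type*} [MeasurableSpace Ω] [MeasurableSpace Ω']
    (P : Measure Ω) [IsProbabilityMeasure P] (P' : Measure Ω') [IsProbabilityMeasure P']
    (m : ℝ → Ω → ℝ)
    (hm : ∀ᵐ ω ∂P, ∀ t : ℝ, 0 ≤ t → IntervalIntegrable (fun s => m s ω) volume 0 t)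
    (β : ℝ≥0 → Ω' → ℝ) (hβ : IsBrownianReal β P')
    (hH0 : InvariancePrinciple P P' m β)
    (u₀ : G.EnergyDomain) (T : ℝ) (hT : 0 < T) :
    -- the group `exp (i t Δ_Γ)` exists
    G.IsSchrodingerGroup G.schrodingerGroup ∧
    -- the form norm is well defined and equivalent to the norm of `W^{1,2}(Γ)`
    (∃ L : ∀ v, EuclideanSpace ℂ (G.Star v) →L[ℂ] EuclideanSpace ℂ (G.Star v),
      (∀ v, G.IsRobinOperator v (L v)) ∧
      ∃ M > (0 : ℝ), ∃ c > (0 : ℝ), ∃ C > (0 : ℝ), ∀ (f : G.EnergyDomain) (a : (I ⊕ X) ⊕ I → ℂ),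
        G.HasTraces f.toL2 a →
          c * ‖f‖ ^ 2 ≤ M * ‖f.toL2‖ ^ 2 + G.energy L f.deriv a ∧
          M * ‖f.toL2‖ ^ 2 + G.energy L f.deriv a ≤ C * ‖f‖ ^ 2) ∧
    -- the mild equation has a unique solution, and the solution map is continuous
    (∃ Φ : C(Icc 0 T, ℝ) → C(Icc 0 T, G.EnergyDomain), Continuous Φ ∧
      ∀ (n : C(Icc 0 T, ℝ)) (w : C(Icc 0 T, G.L2)),
        G.IsMildSolution (truncatedNonlinearity σ R θ) hT n u₀.toL2 w ↔
          ∀ t, w t = (Φ n t).toL2) ∧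
    -- the mild solutions converge in law in `C([0,T], D(𝓔))`
    (∀ (u : Ioi (0 : ℝ) → Ω → C(Icc 0 T, G.EnergyDomain)) (v : Ω' → C(Icc 0 T, G.EnergyDomain)),
      (∀ ε : Ioi (0 : ℝ), ∀ᵐ ω ∂P, G.IsMildSolution (truncatedNonlinearity σ R θ) hT
        (pathOn T (integratedDispersion m ε ω)) u₀.toL2 (fun t => (u ε ω t).toL2)) →
      (∀ᵐ ω ∂P', G.IsMildSolution (truncatedNonlinearity σ R θ) hT
        (pathOn T (fun t => β t ω)) u₀.toL2 (fun t => (v ω t).toL2)) →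
      TendstoInDistribution u epsToZero v (fun _ => P) P') := by
  have hθ2 : ContDiff ℝ 2 θ := by exact_mod_cast contDiff_infty.1 hθ 2
  obtain ⟨K, hFd, hF, hF'⟩ := exists_truncatedNonlinearity_lipschitz hσ hR hθ2 hθc
  obtain ⟨Φ, hΦ, hmild⟩ := G.exists_continuous_isMildSolution_iff hF hFd hF'
    (by simp [truncatedNonlinearity]) hH2 hT u₀
  refine ⟨G.isSchrodingerGroup_schrodingerGroup, G.exists_energy_equiv, ⟨Φ, hΦ, hmild⟩,
    fun u v hu hv => ?_⟩
  -- A mild solution with values in `D(𝓔)` is also one in `L²`, where uniqueness identifies it with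
  -- `Φ n`.
  have key : ∀ (n : C(Icc 0 T, ℝ)) (w : C(Icc 0 T, G.EnergyDomain)),
      G.IsMildSolution (truncatedNonlinearity σ R θ) hT n u₀.toL2 (fun t => (w t).toL2) →
        Φ n = w := fun n w hw =>
    ContinuousMap.ext fun t => QuantumGraph.toL2L_injective
      ((hmild n ⟨fun t => (w t).toL2, G.toL2L.continuous.comp w.continuous⟩).1 hw t).symm
  -- The continuous mapping theorem for `Φ`; convergence in law only sees the processes up to almost
  -- sure equality.
  refine ((hH0 T hT).continuous_comp hΦ).congr (fun ε => ?_) ?_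
  · filter_upwards [hu ε] with ω hω using key _ _ hω
  · filter_upwards [hv] with ω hω using key _ _ hω
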